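/- **Setting.** Let $d\ge 0$, $K\ge 1$, let $(X,Y)$ be a random pair in $[0,1]^d\times\{1,\dots,K\}$ with law $\mu$, put $\bar V(x,y)=\mathbb P(Y=y\mid X=x)$ and $W(x)=\max_{y}\bar V(x,y)$. Assume that for some $1/K\le\kappa<B^*\le 1$ the variable $W(X)$ has a density that vanishes outside $[\kappa,B^*]$, is continuous on $[\kappa,B^*]$ and is positive on $(\kappa,B^*)$. Let $\alpha\in(0,1)$ satisfy $1-B^*<\alpha<1-\mathbb E[W(X)]$. Then there is exactly one $q^0_\alpha\in(\kappa,1-\alpha)$ with $\mathbb E[W(X)\mid W(X)>q^0_\alpha]=1-\alpha$. The oracle procedure selects $x$ if $S^*(x)=\mathbf 1\{W(x)>q^0_\alpha\}$ equals $1$ and predicts $Y^*(x)=\arg\max_y\bar V(x,y)$ (here and below $\arg\max$ is the smallest maximizer). Let $(X_t,Y_t)_{t\ge1}$ be iid with law $\mu$, let $\mathcal D_0$ be a finite holdout sample independent of $(X_t,Y_t)_{t\ge1}$, and let $\mathcal F_t=\sigma(\mathcal D_0,(X_k,Y_k)_{1\le k\le t})$. Let $\bar V_t(x,y)\in[0,1]$,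 $t\ge1$, be estimators of $\bar V(x,y)$ that are measurable with respect to $\mathcal F_{t-1}$ (jointly with $x$) and satisfy, for some $C_1>0$, $\nu_0>0$, $\nu\in(0,1/2]$ and all large $t$, $$\mathbb P\Big(\mathbb E\big[\max_y|\bar V_t(X_t,y)-\bar V(X_t,y)|\,\big|\,\mathcal F_{t-1}\big]\ge C_1(\log t)^{\nu_0}t^{-\nu}\Big)\le \frac{3}{\pi^2t^3}.$$ The OnlineSCI procedure with steps $\gamma_j=c\,j^{-\beta}$, $c>0$, $\beta\in(1/2,1)$, and starting point $q_1\in[0,1-\alpha]$ uses $\hat Y^{\rm SCI}_t(x)=\arg\max_y\bar V_t(x,y)$ and $S^{\rm SCI}_t(x)=\mathbf 1\{\max_y\bar V_t(x,y)>q_t\}$, where $$q_{t+1}=q_t+\gamma_{J(t)}\big(\mathbf 1\{q_t\ge0\}\mathbf 1\{Y_t\ne\hat Y^{\rm SCI}_t(X_t)\}+\mathbf 1\{q_t<0\}-\alpha\big)S^{\rm SCI}_t(X_t),\qquad J(t)=1+\sum_{i=1}^{t-1}S^{\rm SCI}_i(X_i).$$ Let $\delta=\inf_{q\in[0,B^*)}\inf_{t\ge1}\mathbb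 P(\sup_{T\ge t}q_T>q)$, and let $$r(t)=(\log t)^{1/2}t^{1/2-\beta}+t^{\beta-1}+(\log t)^{\nu_0/2}t^{-\nu/2}.$$ **Claim.** There is a constant $C>0$ depending only on $\alpha$ and on the law $\mu$ such that, for every such sequence, estimators and parameters and every $\delta'$ with $\delta<\delta'<1-\alpha$, there exist $C_0=C_0(\delta')>0$ and $T_0=T_0(\delta')\ge1$ with the following properties (a conditional probability given an event of probability zero is read as $0$). (i) For all $t\ge T_0$: $\ \mathbb P(Y_t\ne\hat Y^{\rm SCI}_t(X_t)\mid S^{\rm SCI}_t(X_t)=1)\le\alpha+\delta'+C_0\,r(t)$. (ii) For all $t\ge T_0$: $\ \mathbb E[\mathbf 1\{Y_t=Y^*(X_t)\}S^*(X_t)]\le\mathbb E[\mathbf 1\{Y_t=\hat Y^{\rm SCI}_t(X_t)\}S^{\rm SCI}_t(X_t)]+C_0\,r(t)+\delta'$. (iii) For every selective classification procedure $(S_t(\cdot),\hat Y_t(\cdot))_{t\ge1}$, with $S_t(\cdot)\in\{0,1\}$ and $\hat Y_t(\cdot)\in\{1,\dots,K\}$ measurable with respect to $\mathcal F_{t-1}$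 (jointly with $x$), and every sequence $\eta_t\ge0$ with $\eta_t\to0$: if $\mathbb P(Y_t\ne\hat Y_t(X_t)\mid S_t(X_t)=1)\le\alpha+\delta'+\eta_t$ for all $t\ge T_0$, then for all $t\ge T_0$ $$\mathbb E[\mathbf 1\{Y_t=\hat Y_t(X_t)\}S_t(X_t)]\le\mathbb E[\mathbf 1\{Y_t=\hat Y^{\rm SCI}_t(X_t)\}S^{\rm SCI}_t(X_t)]+C_0\,r(t)+C\delta'+C\eta_t.$$ -/

import Mathlib

open MeasureTheory ProbabilityTheory Set Filter Topology

namespace OnlineSCI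

noncomputable section

/-- The feature space `[0,1]^d`. -/
abbrev Feature (d : ℕ) : Type := Fin d → Set.Icc (0 : ℝ) 1

/-- The largest entry `max_y v y` of a vector of class scores. -/
def maxScore {K : ℕ} (v : Fin K → ℝ) : ℝ := ⨆ y, v y

theorem exists_maximizer {K : ℕ} [NeZero K] (v : Fin K → ℝ) :
    (Finset.univ.filter fun y => ∀ y', v y' ≤ v y).Nonempty := by
  obtain ⟨y, hy⟩ := Finite.exists_max v
  exact ⟨y, by simpa using hy⟩

/-- `argmax_y v y`; if there are several maximizers, the smallest one. -/
def argmaxLabel {K : ℕ} [NeZero K] (v : Fin K → ℝ) : Fin K :=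
  (Finset.univ.filter fun y => ∀ y', v y' ≤ v y).min' (exists_maximizer v)

section Law

variable {d K : ℕ} [NeZero K]

/-- The class probabilities `P(Y = y | X = x)` when `(X, Y)` has law `μ`. -/
def classProb (μ : Measure (Feature d × Fin K)) [IsFiniteMeasure μ]
    (x : Feature d) (y : Fin K) : ℝ :=
  (μ.condKernel x).real {y}

/-- `W(x) = max_y P(Y = y | X = x)`. -/
def topProb (μ : Measure (Feature d × Fin K)) [IsFiniteMeasure μ] (x : Feature d) : ℝ :=
  maxScore (classProb μ x)

/-- `W(X)` has a density that is continuous on `[κ, Bstar]`, positive on `(κ, Bstar)`, and zero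
outside `[κ, Bstar]`, where `0 ≤ κ < Bstar ≤ 1`. -/
structure TopProbDensity (μ : Measure (Feature d × Fin K)) [IsFiniteMeasure μ]
    (κ Bstar : ℝ) : Prop where
  nonneg : 0 ≤ κ
  lt : κ < Bstar
  le_one : Bstar ≤ 1
  density : ∃ g : ℝ → ℝ, ContinuousOn g (Icc κ Bstar) ∧ (∀ w ∈ Ioo κ Bstar, 0 < g w) ∧
    μ.fst.map (topProb μ) =
      (volume.restrict (Icc κ Bstar)).withDensity fun w => ENNReal.ofReal (g w)

/-- `E[W(X) | W(X) > q]`. -/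
def meanAbove (μ : Measure (Feature d × Fin K)) [IsFiniteMeasure μ] (q : ℝ) : ℝ :=
  ∫ x, topProb μ x ∂(μ.fst[|{x | q < topProb μ x}])

end Law

section Model

variable {Ω : Type*} {d K n : ℕ}

/-- The information `F_t` generated by the holdout sample and the pairs at times `1, …, t`. -/
@[reducible] def past (D₀ : Ω → Fin n → Feature d × Fin K) (X : ℕ → Ω → Feature d) (Y : ℕ → Ω → Fin K)
    (t : ℕ) : MeasurableSpace Ω :=
  MeasurableSpace.comap D₀ inferInstance ⊔
    ⨆ k ∈ Icc 1 t, MeasurableSpace.comap (fun ω => (X k ω, Y k ω)) inferInstance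

/-- The pairs `(X_t, Y_t)`, `t ≥ 1`, are iid with law `μ` and independent of the holdout sample
`D₀`. Times start at `1`; the values `X 0`, `Y 0` are never used. -/
structure IIDModel [MeasurableSpace Ω] (P : Measure Ω) (μ : Measure (Feature d × Fin K))
    (D₀ : Ω → Fin n → Feature d × Fin K) (X : ℕ → Ω → Feature d) (Y : ℕ → Ω → Fin K) :
    Prop where
  measurable_holdout : Measurable D₀
  measurable_X : ∀ t, 1 ≤ t → Measurable (X t)
  measurable_Y : ∀ t, 1 ≤ t → Measurable (Y t)
  law : ∀ t, 1 ≤ t → P.map (fun ω => (X t ω, Y t ω)) = μ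
  indep : iIndepFun (fun (k : ℕ) ω => (X (k + 1) ω, Y (k + 1) ω)) P
  indep_holdout : IndepFun D₀ (fun ω (k : ℕ) => (X (k + 1) ω, Y (k + 1) ω)) P

/-- Estimated class probabilities: `p t ω x y` estimates `P(Y = y | X = x)` at time `t`, takes
values in `[0,1]`, and is measurable with respect to `F_{t-1}` (jointly with `x`). -/
structure IsOnlineEstimator (ℱ : ℕ → MeasurableSpace Ω)
    (p : ℕ → Ω → Feature d → Fin K → ℝ) : Prop where
  mem_Icc : ∀ t, 1 ≤ t → ∀ ω x y, p t ω x y ∈ Icc (0 : ℝ) 1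
  measurable : ∀ t, 1 ≤ t → ∀ y,
    Measurable[(ℱ (t - 1)).prod inferInstance] fun z : Ω × Feature d => p t z.1 z.2 y

/-- For `t` large,
`P(E[max_y |p_t(X_t,y) - P(Y = y | X = X_t)| | F_{t-1}] ≥ C₁ (log t)^ν₀ t^(-ν)) ≤ 3/(π² t³)`. -/
def EstimationRate [NeZero K] [MeasurableSpace Ω] (P : Measure Ω)
    (μ : Measure (Feature d × Fin K)) [IsFiniteMeasure μ] (ℱ : ℕ → MeasurableSpace Ω)
    (X : ℕ → Ω → Feature d) (p : ℕ → Ω → Feature d → Fin K → ℝ) (ν₀ ν : ℝ) : Prop :=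
  ∃ C₁ > (0 : ℝ), ∀ᶠ t : ℕ in atTop,
    P.real {ω | C₁ * Real.log t ^ ν₀ * (t : ℝ) ^ (-ν) ≤
      (P[fun ω' => maxScore fun y => |p t ω' (X t ω') y - classProb μ (X t ω') y| | ℱ (t - 1)]) ω}
      ≤ 3 / (Real.pi ^ 2 * (t : ℝ) ^ 3)

end Model

section Procedures

/-- A selective classification procedure: for each time `t`, a selection rule `S_t(·)` and a
classifier `Ŷ_t(·)`, which may be random through the past. -/
structure SelectiveClassifier (Ω : Type*) (d K : ℕ) where
  select : ℕ → Ω → Feature d → Prop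
  predict : ℕ → Ω → Feature d → Fin K

variable {Ω : Type*} {d K : ℕ}

/-- The functions `S_t(·)` and `Ŷ_t(·)` are `F_{t-1}`-measurable (jointly with `x`). -/
structure SelectiveClassifier.IsOnline (R : SelectiveClassifier Ω d K)
    (ℱ : ℕ → MeasurableSpace Ω) : Prop where
  select : ∀ t, 1 ≤ t →
    MeasurableSet[(ℱ (t - 1)).prod inferInstance] {z : Ω × Feature d | R.select t z.1 z.2}
  predict : ∀ t, 1 ≤ t →
    Measurable[(ℱ (t - 1)).prod inferInstance] fun z : Ω × Feature d => R.predict t z.1 z.2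

/-- `P(Y_t ≠ Ŷ_t(X_t) | S_t(X_t) = 1)`, understood as `0` if `P(S_t(X_t) = 1) = 0`. -/
def SelectiveClassifier.errorRate [MeasurableSpace Ω] (R : SelectiveClassifier Ω d K)
    (P : Measure Ω) (X : ℕ → Ω → Feature d) (Y : ℕ → Ω → Fin K) (t : ℕ) : ℝ :=
  (P[|{ω | R.select t ω (X t ω)}]).real {ω | Y t ω ≠ R.predict t ω (X t ω)}

/-- The probability of correct selection `E[1{Y_t = Ŷ_t(X_t)} S_t(X_t)]`. -/
def SelectiveClassifier.power [MeasurableSpace Ω] (R : SelectiveClassifier Ω d K)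
    (P : Measure Ω) (X : ℕ → Ω → Feature d) (Y : ℕ → Ω → Fin K) (t : ℕ) : ℝ :=
  P.real {ω | Y t ω = R.predict t ω (X t ω) ∧ R.select t ω (X t ω)}

/-- The oracle procedure: select if `W(x) > q₀`, and predict `argmax_y P(Y = y | X = x)`. -/
def oracle (Ω : Type*) [NeZero K] (μ : Measure (Feature d × Fin K)) [IsFiniteMeasure μ] (q₀ : ℝ) :
    SelectiveClassifier Ω d K where
  select _ _ x := q₀ < topProb μ x
  predict _ _ x := argmaxLabel (classProb μ x)

open Classical in
/-- The reaction `err · 1{q ≥ 0} + 1{q < 0}`, where `err` is the indicator of an error. -/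
def react (err : Prop) (q : ℝ) : ℝ := if q < 0 ∨ err then 1 else 0

open Classical in
/-- The pair `(q_t, J(t))` along one trajectory: `q_1 = q₁`, `J(1) = 1`, and, if there is a
selection at time `t` with the threshold `q_t`, then `q_{t+1} = q_t + γ_{J(t)} (react_t - α)` and
`J(t+1) = J(t) + 1`; otherwise nothing changes. (The value at `t = 0` is never used.) -/
def sciState (γ : ℕ → ℝ) (α q₁ : ℝ) (sel : ℕ → ℝ → Prop) (err : ℕ → Prop) : ℕ → ℝ × ℕ
  | 0 => (q₁, 1)
  | 1 => (q₁, 1)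
  | t + 2 =>
    let s := sciState γ α q₁ sel err (t + 1)
    if sel (t + 1) s.1 then (s.1 + γ s.2 * (react (err (t + 1)) s.1 - α), s.2 + 1) else s

/-- The threshold `q_t` of online selective classification with estimated class probabilities `p`
and step sequence `γ`: there is a selection at time `t` if `max_y p_t(X_t, y) > q_t`, and an error
if `Y_t ≠ argmax_y p_t(X_t, y)`. -/
def threshold [NeZero K] (γ : ℕ → ℝ) (α q₁ : ℝ) (X : ℕ → Ω → Feature d) (Y : ℕ → Ω → Fin K)
    (p : ℕ → Ω → Feature d → Fin K → ℝ) (t : ℕ) (ω : Ω) : ℝ :=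
  (sciState γ α q₁ (fun s q => q < maxScore (p s ω (X s ω)))
    (fun s => Y s ω ≠ argmaxLabel (p s ω (X s ω))) t).1

/-- The OnlineSCI selective classification procedure. -/
def sci [NeZero K] (γ : ℕ → ℝ) (α q₁ : ℝ) (X : ℕ → Ω → Feature d) (Y : ℕ → Ω → Fin K)
    (p : ℕ → Ω → Feature d → Fin K → ℝ) : SelectiveClassifier Ω d K where
  select t ω x := threshold γ α q₁ X Y p t ω < maxScore (p t ω x)
  predict t ω x := argmaxLabel (p t ω x)

/-- The failure probability `δ = inf_{0 ≤ q < Bstar} inf_{t ≥ 1} P(sup_{T ≥ t} q_T > q)` of a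
threshold sequence `q_T`; the supremum is taken in the extended reals. -/
def failureProb [MeasurableSpace Ω] (P : Measure Ω) (Bstar : ℝ) (qseq : ℕ → Ω → ℝ) : ℝ :=
  ⨅ q : Ico (0 : ℝ) Bstar, ⨅ t : Ici (1 : ℕ),
    P.real {ω | ((q : ℝ) : EReal) < ⨆ T : Ici (t : ℕ), (qseq T ω : EReal)}

end Procedures

/-- `ρ(t) + (log t)^(ν₀/2) t^(-ν/2)` with `ρ(t) = (log t)^(1/2) t^(1/2-β) + t^(β-1)`. -/
def rate (β ν₀ ν : ℝ) (t : ℕ) : ℝ :=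
  (Real.log t ^ (1 / 2 : ℝ) * (t : ℝ) ^ (1 / 2 - β) + (t : ℝ) ^ (β - 1)) +
    Real.log t ^ (ν₀ / 2) * (t : ℝ) ^ (-ν / 2)

end

end OnlineSCI

set_option linter.unusedSectionVars false

namespace OnlineSCI

/-! ### Maxima and maximizers of score vectors. -/

section Scores

variable {K : ℕ}

/-! A reward `a + b 1{Y = Ŷ}`, collected on selection, covers every quantity at once: `(1, 0)` gives
the selection probability, `(0, 1)` the power, `(1, -1)` the error probability, and `(A, -1)` with
`A = 1 - α` the excess of the error over its level. For thresholding the true `W`, the mean reward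
is `levelGain`. The function h(q) = E[(A - W) 1{W > q}] governs the problem: it is positive below
q₀, vanishes at q₀, and is never positive beyond, since it decreases up to A and afterwards climbs
back towards 0.

OnlineSCI is stochastic approximation of the root of h. Given the past, the threshold moves on
average by h(q_t) times the step, up to the square root of the estimation error: as `W` has a
bounded density, estimated scores change a selection only in a thin layer around the threshold or
where they are poor (`abs_ruleGain_sub_levelGain_le`). On bounded intervals that end below B*, h
pulls towards q₀ at least linearly (`exists_drift_le`). Near B* selection dies out and so does the
drift; this is the failure that δ measures. With probability at least 1 - δ' the threshold
eventually stays below some qbar < B* and the estimation errors stay small (`goodEvent`). There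
selections have probability bounded below, J(t) grows linearly, and the mean squared distance to q₀
obeys a contracting recursion, which gives a mean distance of order r(t). Since `levelGain` is
Lipschitz, this yields (ii), and leaving the good event costs at most δ'.

For (i) this is too crude, because δ' would be divided by the selection probability. But thresholds
above q₀ do no harm, as h ≤ 0 there, and those below q₀ are pushed up even outside the good event.
By `tendsto_integral_max_sub_sq` the shortfall below q₀ vanishes in mean square on the whole space,
so for late times it costs at most δ' times the selection probability.

For (iii), take the Lagrange multiplier l for which (1 + l) W - l (1 - α) is positive exactly when W
> q₀. The oracle maximizes this penalized reward among all rules, so an error budget enlarged by a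
buys at most l a of power (`power_le`). -/

theorem le_maxScore (v : Fin K → ℝ) (y : Fin K) : v y ≤ maxScore v :=
  le_ciSup (Set.finite_range v).bddAbove y

theorem measurable_maxScore {α : Type*} [MeasurableSpace α] {f : α → Fin K → ℝ}
    (hf : ∀ y, Measurable fun a => f a y) : Measurable fun a => maxScore (f a) :=
  Measurable.iSup hf

variable [NeZero K]

theorem maxScore_le {v : Fin K → ℝ} {c : ℝ} (h : ∀ y, v y ≤ c) : maxScore v ≤ c :=
  ciSup_le h

theorem maxScore_mem_Icc {v : Fin K → ℝ} (h : ∀ y, v y ∈ Icc (0 : ℝ) 1) :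
    maxScore v ∈ Icc (0 : ℝ) 1 :=
  ⟨(h 0).1.trans (le_maxScore v 0), maxScore_le fun y => (h y).2⟩

theorem maxScore_abs_nonneg (v : Fin K → ℝ) : 0 ≤ maxScore fun y => |v y| :=
  (abs_nonneg (v 0)).trans (le_maxScore (fun y => |v y|) 0)

theorem le_argmaxLabel (v : Fin K → ℝ) (y : Fin K) : v y ≤ v (argmaxLabel v) :=
  (Finset.mem_filter.1 (Finset.min'_mem _ (exists_maximizer v))).2 y

theorem apply_argmaxLabel (v : Fin K → ℝ) : v (argmaxLabel v) = maxScore v :=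
  le_antisymm (le_maxScore v _) (maxScore_le (le_argmaxLabel v))

/-- Only comparisons of scores over a finite label set appear on the right, which makes the
measurability of the maximizer visible. -/
theorem argmaxLabel_eq_iff (v : Fin K → ℝ) (y : Fin K) :
    argmaxLabel v = y ↔ (∀ y', v y' ≤ v y) ∧ ∀ y', (∀ y'', v y'' ≤ v y') → y ≤ y' := by
  constructor
  · rintro rfl
    exact ⟨le_argmaxLabel v, fun y' hy' => Finset.min'_le _ _ (by simpa using hy')⟩
  · rintro ⟨h1, h2⟩
    exact le_antisymm (Finset.min'_le _ _ (by simpa using h1)) (h2 _ (le_argmaxLabel v))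

theorem measurable_argmaxLabel {α : Type*} [MeasurableSpace α] {f : α → Fin K → ℝ}
    (hf : ∀ y, Measurable fun a => f a y) : Measurable fun a => argmaxLabel (f a) := by
  refine measurable_to_countable' fun y => ?_
  have hmax : ∀ y, Measurable fun a => ∀ y', f a y' ≤ f a y := fun y =>
    Measurable.forall fun y' => measurableSet_setOfPred.1 (measurableSet_le (hf y') (hf y))
  have : (fun a => argmaxLabel (f a)) ⁻¹' {y} =
      {a | (∀ y', f a y' ≤ f a y) ∧ ∀ y', (∀ y'', f a y'' ≤ f a y') → y ≤ y'} := by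
    ext a
    simp [argmaxLabel_eq_iff]
  rw [this]
  exact measurableSet_setOfPred.2
    ((hmax y).and (Measurable.forall fun y' => (hmax y').imp measurable_const))

theorem abs_maxScore_sub_le (v w : Fin K → ℝ) :
    |maxScore v - maxScore w| ≤ maxScore fun y => |v y - w y| := by
  have h : ∀ y, |v y - w y| ≤ maxScore fun y => |v y - w y| :=
    le_maxScore fun y => |v y - w y|
  rw [abs_sub_le_iff]
  constructor
  · rw [sub_le_iff_le_add]
    exact maxScore_le fun y => by
      linarith [le_maxScore w y, le_abs_self (v y - w y), h y]
  · rw [sub_le_iff_le_add]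
    exact maxScore_le fun y => by
      linarith [le_maxScore v y, neg_abs_le (v y - w y), h y]

/-- Two exchanges of `v` for `w` are made, at the chosen label and at the maximum, and each costs at
most the uniform distance. -/
theorem abs_apply_argmaxLabel_sub_le (v w : Fin K → ℝ) :
    |w (argmaxLabel v) - maxScore w| ≤ 2 * maxScore fun y => |v y - w y| := by
  have h1 := le_maxScore (fun y => |v y - w y|) (argmaxLabel v)
  have h2 := abs_maxScore_sub_le v w
  have h3 := apply_argmaxLabel v
  have h4 := le_maxScore w (argmaxLabel v)
  rw [abs_sub_le_iff] at h2
  rw [abs_le]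
  constructor <;> linarith [le_abs_self (v (argmaxLabel v) - w (argmaxLabel v))]

end Scores

/-! ### Mean rewards under the law of (X, Y), and the effect of estimated scores. -/

section Law

variable {d K : ℕ} [NeZero K] (μ : Measure (Feature d × Fin K)) [IsProbabilityMeasure μ]

theorem classProb_mem_Icc (x : Feature d) (y : Fin K) : classProb μ x y ∈ Icc (0 : ℝ) 1 :=
  ⟨measureReal_nonneg, measureReal_le_one⟩

theorem measurable_classProb (y : Fin K) : Measurable fun x => classProb μ x y :=
  (Kernel.measurable_coe _ (measurableSet_singleton y)).ennreal_toReal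

theorem measurable_classProb_prod :
    Measurable fun z : Feature d × Fin K => classProb μ z.1 z.2 :=
  measurable_from_prod_countable_left fun y => measurable_classProb μ y

theorem topProb_mem_Icc (x : Feature d) : topProb μ x ∈ Icc (0 : ℝ) 1 :=
  maxScore_mem_Icc (classProb_mem_Icc μ x)

theorem measurable_topProb : Measurable (topProb μ) :=
  measurable_maxScore (measurable_classProb μ)

/-- Averaging the reward `a + b 1{Y = pred X}` on `{X ∈ s}` over the label given the feature. -/
theorem integral_indicator_label {s : Set (Feature d)} (hs : MeasurableSet s)
    {pred : Feature d → Fin K} (hpred : Measurable pred) (a b : ℝ) :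
    ∫ z, {z : Feature d × Fin K | z.1 ∈ s}.indicator
        (fun z => a + b * {z : Feature d × Fin K | z.2 = pred z.1}.indicator 1 z) z ∂μ =
      ∫ x, s.indicator (fun x => a + b * classProb μ x (pred x)) x ∂μ.fst := by
  have hpm : MeasurableSet {z : Feature d × Fin K | z.2 = pred z.1} :=
    measurableSet_eq_fun measurable_snd (hpred.comp measurable_fst)
  have hmeas : Measurable ({z : Feature d × Fin K | z.1 ∈ s}.indicator
      (fun z => a + b * {z : Feature d × Fin K | z.2 = pred z.1}.indicator 1 z)) :=
    (measurable_const.add (measurable_const.mul (measurable_one.indicator hpm))).indicator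
      (measurable_fst hs)
  rw [← Measure.integral_condKernel]
  · refine integral_congr_ae (ae_of_all _ fun x => ?_)
    by_cases hx : x ∈ s
    · have : ∀ y, {z : Feature d × Fin K | z.1 ∈ s}.indicator
          (fun z => a + b * {z : Feature d × Fin K | z.2 = pred z.1}.indicator 1 z) (x, y) =
          a + b * ({pred x} : Set (Fin K)).indicator 1 y := by
        intro y
        rw [indicator_of_mem (by exact hx)]
        by_cases hy : y = pred x <;> simp [indicator, hy]
      simp only [this, indicator_of_mem hx]
      rw [integral_add (integrable_const _), integral_const_mul,
        integral_indicator_one (measurableSet_singleton _)]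
      · simp [classProb]
      · exact ((integrable_const (1 : ℝ)).indicator (measurableSet_singleton _)).const_mul b
    · simp [indicator, hx]
  · refine Integrable.of_bound hmeas.aestronglyMeasurable (|a| + |b|) (ae_of_all _ fun z => ?_)
    refine (norm_indicator_le_norm_self _ _).trans ?_
    refine (norm_add_le _ _).trans ?_
    rw [norm_mul]
    refine add_le_add le_rfl (mul_le_of_le_one_right (norm_nonneg _) ?_)
    refine (norm_indicator_le_norm_self _ _).trans ?_
    simp

/-- `E[(a + b W(X)) 1{W(X) > q}]`. -/
noncomputable def levelGain (a b q : ℝ) : ℝ :=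
  ∫ x, {x | q < topProb μ x}.indicator (fun x => a + b * topProb μ x) x ∂μ.fst

/-- `E[(a + b 1{Y = pred X}) 1{X ∈ s}]`. -/
noncomputable def ruleGain (a b : ℝ) (s : Set (Feature d)) (pred : Feature d → Fin K) : ℝ :=
  ∫ x, s.indicator (fun x => a + b * classProb μ x (pred x)) x ∂μ.fst

variable {μ}

/-- An affine function on the unit interval is extremal at the endpoints, where it equals `a` and `a
+ b`; hence the pair of hypotheses on rewards throughout. -/
theorem abs_affine_le {a b w : ℝ} (h0 : |a| ≤ 1) (h1 : |a + b| ≤ 1) (hw : w ∈ Icc (0 : ℝ) 1) :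
    |a + b * w| ≤ 1 := by
  obtain ⟨hw0, hw1⟩ := hw
  rw [abs_le] at *
  constructor <;> nlinarith

theorem abs_ruleGain_le {a b : ℝ} (h0 : |a| ≤ 1) (h1 : |a + b| ≤ 1) (s : Set (Feature d))
    (pred : Feature d → Fin K) : |ruleGain μ a b s pred| ≤ 1 := by
  have := norm_integral_le_of_norm_le_const (μ := μ.fst) (C := 1)
    (f := s.indicator (fun x => a + b * classProb μ x (pred x))) (ae_of_all _ fun x =>
      (norm_indicator_le_norm_self _ _).trans (abs_affine_le h0 h1 (classProb_mem_Icc μ x _)))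
  simpa [ruleGain] using this

theorem integrable_of_measurable_of_bound {α : Type*} [MeasurableSpace α] {ν : Measure α}
    [IsFiniteMeasure ν] {f : α → ℝ} (hf : Measurable f) {C : ℝ} (hC : ∀ x, |f x| ≤ C) :
    Integrable f ν :=
  Integrable.of_bound hf.aestronglyMeasurable C (ae_of_all _ hC)

theorem integrable_ruleGain_integrand (a b : ℝ) {s : Set (Feature d)} (hs : MeasurableSet s)
    {pred : Feature d → Fin K} (hpred : Measurable pred) :
    Integrable (s.indicator (fun x => a + b * classProb μ x (pred x))) μ.fst := by
  refine Integrable.indicator ?_ hs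
  refine integrable_of_measurable_of_bound (C := |a| + |b|) (measurable_const.add
    (measurable_const.mul ((measurable_classProb_prod μ).comp (measurable_id.prodMk hpred))))
    fun x => ?_
  refine (abs_add_le _ _).trans (add_le_add le_rfl ?_)
  rw [abs_mul]
  refine mul_le_of_le_one_right (abs_nonneg _) ?_
  have := classProb_mem_Icc μ x (pred x)
  exact abs_le.2 ⟨by linarith [this.1], this.2⟩

theorem integrable_levelGain_integrand (a b q : ℝ) :
    Integrable ({x | q < topProb μ x}.indicator (fun x => a + b * topProb μ x)) μ.fst := by
  refine Integrable.indicator ?_ (measurableSet_lt measurable_const (measurable_topProb μ))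
  refine integrable_of_measurable_of_bound (C := |a| + |b|) (measurable_const.add
    (measurable_const.mul (measurable_topProb μ))) fun x => ?_
  refine (abs_add_le _ _).trans (add_le_add le_rfl ?_)
  rw [abs_mul]
  refine mul_le_of_le_one_right (abs_nonneg _) ?_
  have := topProb_mem_Icc μ x
  exact abs_le.2 ⟨by linarith [this.1], this.2⟩

/-- Selecting and predicting with scores `p` instead of the class probabilities changes the mean
reward by at most a multiple of the square root of the mean estimation error. -/
theorem abs_ruleGain_sub_levelGain_le {L : ℝ}
    (hL : ∀ u v, u ≤ v → μ.fst.real {x | topProb μ x ∈ Icc u v} ≤ L * (v - u))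
    {p : Feature d → Fin K → ℝ} (hp : ∀ y, Measurable fun x => p x y)
    (hp01 : ∀ x y, p x y ∈ Icc (0 : ℝ) 1)
    {a b : ℝ} (h0 : |a| ≤ 1) (h1 : |a + b| ≤ 1) (hb : |b| ≤ 1) (q : ℝ) {η : ℝ} (hη : 0 < η)
    (hη1 : η ≤ 1) (hD : ∫ x, maxScore (fun y => |p x y - classProb μ x y|) ∂μ.fst ≤ η) :
    |ruleGain μ a b {x | q < maxScore (p x)} (fun x => argmaxLabel (p x)) - levelGain μ a b q| ≤
      (2 * L + 3) * √η := by
  set D : Feature d → ℝ := fun x => maxScore (fun y => |p x y - classProb μ x y|) with hDdef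
  have hD0 : ∀ x, 0 ≤ D x := fun x => maxScore_abs_nonneg _
  have hD1 : ∀ x, D x ≤ 1 := fun x => maxScore_le fun y => by
    have := hp01 x y
    have := classProb_mem_Icc μ x y
    simp only [mem_Icc] at *
    rw [abs_le]
    constructor <;> linarith
  have hDm : Measurable D := measurable_maxScore fun y =>
    ((hp y).sub (measurable_classProb μ y)).abs
  have hDi : Integrable D μ.fst := integrable_of_measurable_of_bound (C := 1) hDm fun x => by
    rw [abs_of_nonneg (hD0 x)]
    exact hD1 x
  -- The layer of half-width ε around the level has mass at most 2Lε, while Markov's inequality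
  -- bounds the probability of an error above ε by η/ε. The choice ε = √η balances the two.
  have hε : 0 < √η := Real.sqrt_pos.2 hη
  set ε := √η with hεdef
  have hεη : ε * ε = η := Real.mul_self_sqrt hη.le
  have hηε : η ≤ ε := by
    rw [← hεη]
    exact mul_le_of_le_one_right hε.le (Real.sqrt_le_one.2 hη1)
  set N : Set (Feature d) := {x | topProb μ x ∈ Icc (q - ε) (q + ε)} with hN
  have hNm : MeasurableSet N := measurable_topProb μ measurableSet_Icc
  have hpt : ∀ x, |{x | q < maxScore (p x)}.indicator
      (fun x => a + b * classProb μ x (argmaxLabel (p x))) x -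
      {x | q < topProb μ x}.indicator (fun x => a + b * topProb μ x) x| ≤
      2 * D x + N.indicator 1 x + D x / ε := by
    intro x
    have hx1 := abs_affine_le h0 h1 (classProb_mem_Icc μ x (argmaxLabel (p x)))
    have hx2 := abs_affine_le h0 h1 (topProb_mem_Icc μ x)
    have hx3 : |maxScore (p x) - topProb μ x| ≤ D x := abs_maxScore_sub_le _ _
    have hx4 : |classProb μ x (argmaxLabel (p x)) - topProb μ x| ≤ 2 * D x :=
      abs_apply_argmaxLabel_sub_le _ _
    have hN0 : 0 ≤ N.indicator (1 : Feature d → ℝ) x := indicator_nonneg (by simp) x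
    have hDε : 0 ≤ D x / ε := div_nonneg (hD0 x) hε.le
    -- The two selections can differ at x only if W(x) is within ε of q or the error D(x) is at
    -- least ε.
    have hcross : (q < maxScore (p x) ∧ topProb μ x ≤ q ∨ maxScore (p x) ≤ q ∧ q < topProb μ x) →
        1 ≤ N.indicator 1 x + D x / ε := by
      intro h
      by_cases hxN : x ∈ N
      · rw [indicator_of_mem hxN]
        simpa using hDε
      · have : ε ≤ D x := by
          rw [abs_le] at hx3
          by_contra hlt
          push Not at hlt
          refine hxN ⟨?_, ?_⟩ <;> rcases h with h | h <;> linarith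
        linarith [(one_le_div hε).2 this]
    by_cases hs : q < maxScore (p x) <;> by_cases ht : q < topProb μ x
    · rw [indicator_of_mem (by exact hs), indicator_of_mem (by exact ht)]
      have : |b| * |classProb μ x (argmaxLabel (p x)) - topProb μ x| ≤ 1 * (2 * D x) :=
        mul_le_mul hb hx4 (abs_nonneg _) zero_le_one
      rw [← abs_mul] at this
      have heq : a + b * classProb μ x (argmaxLabel (p x)) - (a + b * topProb μ x) =
          b * (classProb μ x (argmaxLabel (p x)) - topProb μ x) := by ring
      rw [heq]
      linarith
    · rw [indicator_of_mem (by exact hs), indicator_of_notMem (by exact ht), sub_zero]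
      linarith [hcross (Or.inl ⟨hs, not_lt.1 ht⟩), hD0 x]
    · rw [indicator_of_notMem (by exact hs), indicator_of_mem (by exact ht), zero_sub, abs_neg]
      linarith [hcross (Or.inr ⟨not_lt.1 hs, ht⟩), hD0 x]
    · rw [indicator_of_notMem (by exact hs), indicator_of_notMem (by exact ht)]
      simp only [sub_zero, abs_zero]
      linarith [hD0 x]
  have hi1 := integrable_ruleGain_integrand (μ := μ) a b
    (measurableSet_lt measurable_const (measurable_maxScore hp) :
      MeasurableSet {x | q < maxScore (p x)}) (measurable_argmaxLabel hp)
  have hi2 := integrable_levelGain_integrand (μ := μ) a b q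
  have hiN : Integrable (N.indicator (1 : Feature d → ℝ)) μ.fst :=
    (integrable_const (1 : ℝ)).indicator hNm
  rw [ruleGain, levelGain, ← integral_sub hi1 hi2]
  refine (abs_integral_le_integral_abs).trans ?_
  refine (integral_mono (hi1.sub hi2).abs (((hDi.const_mul 2).add hiN).add (hDi.div_const ε))
    hpt).trans ?_
  have hA : Integrable (fun x => 2 * D x + N.indicator 1 x) μ.fst := (hDi.const_mul 2).add hiN
  simp only [Pi.add_apply]
  rw [integral_add hA (hDi.div_const ε), integral_add (hDi.const_mul 2) hiN, integral_const_mul, integral_div,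
    integral_indicator_one hNm]
  have hN1 := hL (q - ε) (q + ε) (by linarith)
  -- The total is 2η for wrong labels, 2Lε for the layer and ε for large errors; η ≤ ε then gives
  -- the factor 2L + 3.
  have hdiv : (∫ x, D x ∂μ.fst) / ε ≤ ε := by
    rw [div_le_iff₀ hε, hεη]
    exact hD
  linarith

end Law

/-! ### Monotonicity and regularity of the mean reward as a function of the level. -/

section LevelGain

variable {d K : ℕ} [NeZero K] {μ : Measure (Feature d × Fin K)} [IsProbabilityMeasure μ]

theorem levelGain_sub (a b : ℝ) {q q' : ℝ} (h : q ≤ q') :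
    levelGain μ a b q - levelGain μ a b q' =
      ∫ x in {x | topProb μ x ∈ Ioc q q'}, (a + b * topProb μ x) ∂μ.fst := by
  have hm : MeasurableSet {x | topProb μ x ∈ Ioc q q'} := measurable_topProb μ measurableSet_Ioc
  rw [levelGain, levelGain, ← integral_sub (integrable_levelGain_integrand a b q)
    (integrable_levelGain_integrand a b q'), ← integral_indicator hm]
  refine integral_congr_ae (ae_of_all _ fun x => ?_)
  simp only [indicator, mem_ofPred_eq, mem_Ioc]
  split_ifs <;> first | linarith | (exfalso; grind)

theorem integrable_affine_topProb (a b : ℝ) :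
    Integrable (fun x => a + b * topProb μ x) μ.fst :=
  (integrable_const a).add ((integrable_of_measurable_of_bound (C := 1) (measurable_topProb μ)
    fun x => abs_le.2 ⟨by linarith [(topProb_mem_Icc μ x).1], (topProb_mem_Icc μ x).2⟩).const_mul b)

theorem abs_levelGain_sub_le {a b : ℝ} (h0 : |a| ≤ 1) (h1 : |a + b| ≤ 1) {q q' : ℝ}
    (h : q ≤ q') :
    |levelGain μ a b q - levelGain μ a b q'| ≤ μ.fst.real {x | topProb μ x ∈ Ioc q q'} := by
  rw [levelGain_sub a b h]
  have := norm_setIntegral_le_of_norm_le_const (μ := μ.fst) (C := 1)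
    (s := {x | topProb μ x ∈ Ioc q q'}) (f := fun x => a + b * topProb μ x)
    (measure_lt_top _ _) fun x _ => abs_affine_le h0 h1 (topProb_mem_Icc μ x)
  simpa using this

theorem lipschitz_levelGain {L : ℝ}
    (hL : ∀ u v, u ≤ v → μ.fst.real {x | topProb μ x ∈ Icc u v} ≤ L * (v - u)) {a b : ℝ}
    (h0 : |a| ≤ 1) (h1 : |a + b| ≤ 1) (q q' : ℝ) :
    |levelGain μ a b q - levelGain μ a b q'| ≤ L * |q - q'| := by
  wlog h : q ≤ q' generalizing q q'
  · rw [abs_sub_comm, abs_sub_comm q]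
    exact this q' q (le_of_not_ge h)
  refine (abs_levelGain_sub_le h0 h1 h).trans ?_
  rw [abs_sub_comm, abs_of_nonneg (sub_nonneg.2 h)]
  refine le_trans (measureReal_mono ?_) (hL q q' h)
  exact fun x hx => Ioc_subset_Icc_self hx

theorem continuous_levelGain {L : ℝ}
    (hL : ∀ u v, u ≤ v → μ.fst.real {x | topProb μ x ∈ Icc u v} ≤ L * (v - u)) {a b : ℝ}
    (h0 : |a| ≤ 1) (h1 : |a + b| ≤ 1) : Continuous (levelGain μ a b) := by
  refine (LipschitzWith.of_dist_le_mul (K := L.toNNReal) fun q q' => ?_).continuous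
  rw [Real.dist_eq, Real.dist_eq]
  exact (lipschitz_levelGain hL h0 h1 q q').trans
    (mul_le_mul_of_nonneg_right (Real.le_coe_toNNReal L) (abs_nonneg _))

theorem levelGain_eq (a b q : ℝ) :
    levelGain μ a b q = a * levelGain μ 1 0 q + b * levelGain μ 0 1 q := by
  simp only [levelGain]
  rw [← integral_const_mul, ← integral_const_mul, ← integral_add
    ((integrable_levelGain_integrand 1 0 q).const_mul a)
    ((integrable_levelGain_integrand 0 1 q).const_mul b)]
  refine integral_congr_ae (ae_of_all _ fun x => ?_)
  simp only [indicator]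
  split_ifs <;> ring

theorem levelGain_one_zero (q : ℝ) : levelGain μ 1 0 q = μ.fst.real {x | q < topProb μ x} := by
  rw [levelGain, ← integral_indicator_one (measurableSet_lt measurable_const (measurable_topProb μ))]
  simp [indicator]

theorem levelGain_one_zero_antitone : Antitone (levelGain μ 1 0) := fun q q' h => by
  rw [levelGain_one_zero, levelGain_one_zero]
  exact measureReal_mono fun x (hx : q' < _) => h.trans_lt hx

theorem levelGain_one_zero_nonneg (q : ℝ) : 0 ≤ levelGain μ 1 0 q := by
  rw [levelGain_one_zero]
  exact measureReal_nonneg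

theorem levelGain_le (A q : ℝ) : levelGain μ A (-1) q ≤ (A - q) * levelGain μ 1 0 q := by
  rw [levelGain, levelGain, ← integral_const_mul]
  refine integral_mono (integrable_levelGain_integrand A (-1) q)
    ((integrable_levelGain_integrand 1 0 q).const_mul _) fun x => ?_
  simp only [indicator, mem_ofPred_eq]
  split_ifs with hx <;> linarith

/-- Raising the level from `q` to `q'` removes the points with W in (q, q'], where the integrand A -
W is at least A - q' and less than A - q. This and the companion upper bound replace the derivative
of h. -/
theorem le_levelGain_sub (A : ℝ) {q q' : ℝ} (h : q ≤ q') :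
    (A - q') * μ.fst.real {x | topProb μ x ∈ Ioc q q'} ≤
      levelGain μ A (-1) q - levelGain μ A (-1) q' := by
  have hm : MeasurableSet {x | topProb μ x ∈ Ioc q q'} := measurable_topProb μ measurableSet_Ioc
  rw [levelGain_sub A (-1) h]
  have := setIntegral_mono_on (μ := μ.fst) (f := fun _ => A - q')
    (integrableOn_const (by simp)) (integrable_affine_topProb (μ := μ) A (-1)).integrableOn hm
    fun x hx => by linarith [hx.2]
  simpa [mul_comm] using this

theorem levelGain_sub_le (A : ℝ) {q q' : ℝ} (h : q ≤ q') :
    levelGain μ A (-1) q - levelGain μ A (-1) q' ≤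
      (A - q) * μ.fst.real {x | topProb μ x ∈ Ioc q q'} := by
  have hm : MeasurableSet {x | topProb μ x ∈ Ioc q q'} := measurable_topProb μ measurableSet_Ioc
  rw [levelGain_sub A (-1) h]
  have := setIntegral_mono_on (μ := μ.fst) (g := fun _ => A - q)
    (integrable_affine_topProb (μ := μ) A (-1)).integrableOn (integrableOn_const (by simp)) hm
    fun x hx => by linarith [hx.1]
  simpa [mul_comm] using this

theorem levelGain_of_neg (A : ℝ) {q : ℝ} (hq : q < 0) :
    levelGain μ A (-1) q = A - ∫ x, topProb μ x ∂μ.fst := by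
  have : ({x | q < topProb μ x} : Set (Feature d)) = univ :=
    eq_univ_of_forall fun x => hq.trans_le (topProb_mem_Icc μ x).1
  have hW : Integrable (topProb μ) μ.fst := by
    simpa using integrable_affine_topProb (μ := μ) 0 1
  rw [levelGain, this]
  simp only [indicator_univ, neg_mul, one_mul, ← sub_eq_add_neg]
  rw [integral_sub (integrable_const _) hW]
  simp

/-- As long as the level stays below A, raising it removes only nonnegative contributions A - W. -/
theorem levelGain_antitoneOn (A : ℝ) : AntitoneOn (levelGain μ A (-1)) (Iic A) :=
  fun q _ q' hq' h => by
    have := mul_nonneg (sub_nonneg.2 hq') (measureReal_nonneg (μ := μ.fst)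
      (s := {x | topProb μ x ∈ Ioc q q'}))
    linarith [le_levelGain_sub (μ := μ) A h]

/-- No positivity is required: on a null level set both sides are zero by the conventions for
conditioning and for inverses. -/
theorem meanAbove_eq (q : ℝ) :
    meanAbove μ q = (levelGain μ 1 0 q)⁻¹ * levelGain μ 0 1 q := by
  rw [meanAbove, ProbabilityTheory.cond, integral_smul_measure, levelGain_one_zero, levelGain,
    integral_indicator (measurableSet_lt measurable_const (measurable_topProb μ))]
  simp [measureReal_def]

end LevelGain

/-! ### Consequences of the density of W: the root q₀ and the restoring drift. -/

section Density

variable {d K : ℕ} [NeZero K] {μ : Measure (Feature d × Fin K)} [IsProbabilityMeasure μ]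
  {κ Bstar : ℝ}

namespace TopProbDensity

/-- A continuous density on a compact interval is bounded. -/
theorem exists_mass_Icc_le (hW : TopProbDensity μ κ Bstar) :
    ∃ L > (0 : ℝ), ∀ u v, u ≤ v → μ.fst.real {x | topProb μ x ∈ Icc u v} ≤ L * (v - u) := by
  obtain ⟨g, hg, -, hmap⟩ := hW.density
  obtain ⟨C, hC⟩ := isCompact_Icc.exists_bound_of_continuousOn hg
  refine ⟨|C| + 1, by positivity, fun u v huv => ?_⟩
  have h1 : μ.fst {x | topProb μ x ∈ Icc u v} ≤ ENNReal.ofReal ((|C| + 1) * (v - u)) := by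
    change μ.fst (topProb μ ⁻¹' Icc u v) ≤ _
    rw [← Measure.map_apply (measurable_topProb μ) measurableSet_Icc, hmap,
      withDensity_apply _ measurableSet_Icc, ENNReal.ofReal_mul (by positivity)]
    calc ∫⁻ w in Icc u v, ENNReal.ofReal (g w) ∂volume.restrict (Icc κ Bstar)
        ≤ ∫⁻ w in Icc u v, ENNReal.ofReal (|C| + 1) ∂volume.restrict (Icc κ Bstar) := by
          refine lintegral_mono_ae (ae_restrict_of_ae ?_)
          refine (ae_restrict_mem measurableSet_Icc).mono fun w hw => ?_
          refine ENNReal.ofReal_le_ofReal ?_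
          have := hC w hw
          rw [Real.norm_eq_abs] at this
          linarith [le_abs_self (g w), le_abs_self C]
      _ ≤ ENNReal.ofReal (|C| + 1) * ENNReal.ofReal (v - u) := by
          rw [lintegral_const, Measure.restrict_apply_univ]
          gcongr
          exact (Measure.restrict_apply_le _ _).trans (by rw [Real.volume_Icc])
  exact ENNReal.toReal_le_of_le_ofReal (mul_nonneg (by positivity) (sub_nonneg.2 huv)) h1

/-- On a compact part of the open interval the density is continuous and positive, hence bounded
below. Nothing of this kind holds up to the endpoints, where the density may vanish. -/
theorem exists_le_mass_Ioc (hW : TopProbDensity μ κ Bstar) {a b : ℝ} (ha : κ < a)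
    (hb : b < Bstar) :
    ∃ m > (0 : ℝ), ∀ u v, a ≤ u → u ≤ v → v ≤ b →
      m * (v - u) ≤ μ.fst.real {x | topProb μ x ∈ Ioc u v} := by
  obtain ⟨g, hg, hpos, hmap⟩ := hW.density
  have hsub : Icc a b ⊆ Ioo κ Bstar := fun w hw => ⟨ha.trans_le hw.1, hw.2.trans_lt hb⟩
  obtain ⟨m, hm, hmg⟩ := isCompact_Icc.exists_forall_le' (a := 0)
    (hg.mono (hsub.trans Ioo_subset_Icc_self)) fun w hw => hpos w (hsub hw)
  refine ⟨m, hm, fun u v hu huv hv => ?_⟩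
  have hss : Ioc u v ⊆ Icc a b := fun w hw => ⟨hu.trans hw.1.le, hw.2.trans hv⟩
  have h1 : ENNReal.ofReal (m * (v - u)) ≤ μ.fst {x | topProb μ x ∈ Ioc u v} := by
    change _ ≤ μ.fst (topProb μ ⁻¹' Ioc u v)
    rw [← Measure.map_apply (measurable_topProb μ) measurableSet_Ioc, hmap,
      withDensity_apply _ measurableSet_Ioc, Measure.restrict_restrict measurableSet_Ioc,
      inter_eq_left.2 (hss.trans (hsub.trans Ioo_subset_Icc_self)), ENNReal.ofReal_mul hm.le,
      ← Real.volume_Ioc, ← setLIntegral_const]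
    exact setLIntegral_mono_ae' measurableSet_Ioc (ae_of_all _ fun w hw =>
      ENNReal.ofReal_le_ofReal (hmg w (hss hw)))
  exact (ENNReal.ofReal_le_iff_le_toReal (measure_ne_top _ _)).1 h1

theorem mass_Ioc_eq_zero (hW : TopProbDensity μ κ Bstar) (u : ℝ) :
    μ.fst.real {x | topProb μ x ∈ Ioc u κ} = 0 := by
  obtain ⟨g, -, -, hmap⟩ := hW.density
  have : μ.fst (topProb μ ⁻¹' Ioc u κ) = 0 := by
    rw [← Measure.map_apply (measurable_topProb μ) measurableSet_Ioc, hmap]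
    refine withDensity_absolutelyContinuous _ _ ?_
    rw [Measure.restrict_apply measurableSet_Ioc]
    refine measure_mono_null (t := {κ}) (fun w hw => ?_) Real.volume_singleton
    exact le_antisymm hw.1.2 hw.2.1
  exact (measureReal_eq_zero_iff).2 this

theorem levelGain_one_zero_pos (hW : TopProbDensity μ κ Bstar) {q : ℝ} (hq : q < Bstar) :
    0 < levelGain μ 1 0 q := by
  obtain ⟨a, ha, haB⟩ := exists_between (max_lt hq hW.lt)
  obtain ⟨b, hab, hb⟩ := exists_between haB
  obtain ⟨m, hm, hmass⟩ := hW.exists_le_mass_Ioc ((le_max_right _ _).trans_lt ha) hb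
  have h1 := hmass a b le_rfl hab.le le_rfl
  have h2 := levelGain_one_zero_antitone (μ := μ) ((le_max_left _ _).trans_lt ha).le
  rw [levelGain_one_zero a] at h2
  have h3 : μ.fst.real {x | topProb μ x ∈ Ioc a b} ≤ μ.fst.real {x | a < topProb μ x} :=
    measureReal_mono fun x hx => hx.1
  nlinarith

variable {A : ℝ}

/-- Beyond A every selected point contributes negatively. An intermediate level r makes the
inequality strict: h(q) ≤ h(r) ≤ (A - r) P(W > r), and W exceeds r with positive probability. -/
theorem levelGain_neg (hW : TopProbDensity μ κ Bstar) {q : ℝ} (hAq : A ≤ q) (hq : q < Bstar) :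
    levelGain μ A (-1) q < 0 := by
  obtain ⟨r, hr, hrB⟩ := exists_between hq
  have h1 := levelGain_sub_le (μ := μ) A hr.le
  have h2 := levelGain_le (μ := μ) A r
  have h3 := hW.levelGain_one_zero_pos hrB
  have h4 : 0 ≤ μ.fst.real {x | topProb μ x ∈ Ioc q r} := measureReal_nonneg
  nlinarith

theorem levelGain_kappa_pos (hW : TopProbDensity μ κ Bstar)
    (hA : ∫ x, topProb μ x ∂μ.fst < A) : 0 < levelGain μ A (-1) κ := by
  -- At the level -1 everything is selected and h equals A - E[W]; no mass lies between -1 and κ, so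
  -- h(κ) is at least this value.
  have h1 := levelGain_sub_le (μ := μ) A (show (-1 : ℝ) ≤ κ by linarith [hW.nonneg])
  rw [hW.mass_Ioc_eq_zero, levelGain_of_neg A (by norm_num : (-1 : ℝ) < 0)] at h1
  linarith

theorem levelGain_lt (hW : TopProbDensity μ κ Bstar) (hAB : A < Bstar) {q q' : ℝ}
    (hq : κ < q) (h : q < q') (hq' : q' < A) :
    levelGain μ A (-1) q' < levelGain μ A (-1) q := by
  obtain ⟨m, hm, hmass⟩ := hW.exists_le_mass_Ioc hq (hq'.trans hAB)
  have h1 := hmass q q' le_rfl h.le le_rfl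
  have h2 := le_levelGain_sub (μ := μ) A h.le
  have h3 : 0 < m * (q' - q) := mul_pos hm (sub_pos.2 h)
  nlinarith

/-- Intermediate values between h(κ) > 0 and h(A) < 0. The first of these also forces κ < A, since
h(κ) ≤ (A - κ) P(W > κ). -/
theorem exists_root (hW : TopProbDensity μ κ Bstar) (hAB : A < Bstar) (hA1 : |A| ≤ 1)
    (hA2 : |A + -1| ≤ 1) (hA : ∫ x, topProb μ x ∂μ.fst < A) :
    ∃ q₀ ∈ Ioo κ A, levelGain μ A (-1) q₀ = 0 := by
  obtain ⟨L, -, hL⟩ := hW.exists_mass_Icc_le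
  have h1 := hW.levelGain_kappa_pos hA
  have h2 := hW.levelGain_neg le_rfl hAB
  have hκA : κ < A := by
    by_contra hc
    have := levelGain_le (μ := μ) A κ
    have := levelGain_one_zero_nonneg (μ := μ) κ
    nlinarith
  exact intermediate_value_Ioo' hκA.le (continuous_levelGain hL hA1 hA2).continuousOn ⟨h2, h1⟩

/-- A conditional mean equal to A is the same as h(q) = 0, because the conditioning event has
positive probability; h is strictly decreasing on (κ, A). -/
theorem meanAbove_eq_iff (hW : TopProbDensity μ κ Bstar) (hAB : A < Bstar) {q₀ : ℝ}
    (hq₀ : q₀ ∈ Ioo κ A) (h0 : levelGain μ A (-1) q₀ = 0) {q : ℝ} (hq : q ∈ Ioo κ A) :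
    meanAbove μ q = A ↔ q = q₀ := by
  have hG := hW.levelGain_one_zero_pos (hq.2.trans hAB)
  have h1 : meanAbove μ q = A ↔ levelGain μ A (-1) q = 0 := by
    rw [meanAbove_eq, inv_mul_eq_iff_eq_mul₀ hG.ne', levelGain_eq A (-1)]
    constructor <;> intro h <;> linarith
  rw [h1]
  constructor
  · intro h
    rcases lt_trichotomy q q₀ with hlt | heq | hlt
    · linarith [hW.levelGain_lt hAB hq.1 hlt hq₀.2]
    · exact heq
    · linarith [hW.levelGain_lt hAB hq₀.1 hlt hq.2]
  · rintro rfl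
    exact h0

theorem levelGain_nonpos {q₀ : ℝ} (hq₀ : q₀ ≤ A) (h0 : levelGain μ A (-1) q₀ = 0) {q : ℝ}
    (hq : q₀ ≤ q) : levelGain μ A (-1) q ≤ 0 := by
  rcases le_total q A with h | h
  · rw [← h0]
    exact levelGain_antitoneOn A hq₀ h hq
  · have := levelGain_le (μ := μ) A q
    have := levelGain_one_zero_nonneg (μ := μ) q
    nlinarith

theorem levelGain_pos (hW : TopProbDensity μ κ Bstar) (hAB : A < Bstar) {q₀ : ℝ}
    (hq₀ : q₀ ∈ Ioo κ A) (h0 : levelGain μ A (-1) q₀ = 0) {q : ℝ} (hq : q < q₀) :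
    0 < levelGain μ A (-1) q := by
  -- The level q may lie below κ, where h is merely monotone; strictness comes from passing through
  -- r in (κ, q₀).
  obtain ⟨r, hr, hr'⟩ := exists_between (max_lt hq hq₀.1)
  have h1 := hW.levelGain_lt hAB ((le_max_right _ _).trans_lt hr) hr' hq₀.2
  have h2 : q < r := (le_max_left _ _).trans_lt hr
  have h3 := levelGain_antitoneOn (μ := μ) A (show q ∈ Iic A from (hq.trans hq₀.2).le)
    (show r ∈ Iic A from (hr'.trans hq₀.2).le) h2.le
  linarith

/-- The drift points to `q₀`, with a strength at least proportional to the distance. -/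
theorem exists_drift_le (hW : TopProbDensity μ κ Bstar) (hAB : A < Bstar) {q₀ : ℝ}
    (hq₀ : q₀ ∈ Ioo κ A) (h0 : levelGain μ A (-1) q₀ = 0) {qbar : ℝ} (hqA : A < qbar)
    (hqB : qbar < Bstar) (M : ℝ) :
    ∃ c > (0 : ℝ), ∀ q ∈ Icc (-M) qbar,
      (q - q₀) * levelGain μ A (-1) q ≤ -c * (q - q₀) ^ 2 := by
  -- On the window [a, b] around q₀ the density is at least m, so h changes at least linearly.
  -- Outside it, h keeps a distance m' from zero while |q - q₀| is at most R, so the slope m'/R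
  -- suffices.
  obtain ⟨a, ha, haq⟩ := exists_between hq₀.1
  obtain ⟨b, hqb, hbA⟩ := exists_between hq₀.2
  obtain ⟨m, hm, hmass⟩ := hW.exists_le_mass_Ioc ha (hbA.trans hAB)
  have hm0 : 0 < (A - b) * m := mul_pos (sub_pos.2 hbA) hm
  have hha := hW.levelGain_pos hAB hq₀ h0 haq
  have hhb : levelGain μ A (-1) b < 0 := by
    rw [← h0]
    exact hW.levelGain_lt hAB hq₀.1 hqb hbA
  have hhq := hW.levelGain_neg hqA.le hqB
  set R : ℝ := |M| + |q₀| + |qbar| + 1 with hR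
  have hR0 : 0 < R := by positivity
  set m' : ℝ := min (levelGain μ A (-1) a)
    (min (-levelGain μ A (-1) b) (-levelGain μ A (-1) qbar)) with hm'
  have hm'0 : 0 < m' := lt_min hha (lt_min (neg_pos.2 hhb) (neg_pos.2 hhq))
  have e1 : m' ≤ levelGain μ A (-1) a := min_le_left _ _
  have e2 : m' ≤ -levelGain μ A (-1) b := (min_le_right _ _).trans (min_le_left _ _)
  have e3 : m' ≤ -levelGain μ A (-1) qbar := (min_le_right _ _).trans (min_le_right _ _)
  refine ⟨min ((A - b) * m) (m' / R), lt_min hm0 (div_pos hm'0 hR0), fun q hq => ?_⟩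
  set c := min ((A - b) * m) (m' / R) with hc
  have hc0 : 0 < c := lt_min hm0 (div_pos hm'0 hR0)
  have hc1 : c ≤ (A - b) * m := min_le_left _ _
  have hc2 : c * R ≤ m' := (le_div_iff₀ hR0).1 (min_le_right _ _)
  have hdist : |q - q₀| ≤ R := by
    have := abs_sub q q₀
    have : |q| ≤ |M| + |qbar| := abs_le.2
      ⟨by linarith [hq.1, le_abs_self M, abs_nonneg qbar],
        by linarith [hq.2, le_abs_self qbar, abs_nonneg M]⟩
    linarith
  rcases le_total q q₀ with hle | hle
  · have hgoal : c * (q₀ - q) ≤ levelGain μ A (-1) q := by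
      rcases le_total q a with hqa | hqa
      · have := levelGain_antitoneOn (μ := μ) A (show q ∈ Iic A from hle.trans hq₀.2.le)
          (show a ∈ Iic A from (haq.trans hq₀.2).le) hqa
        rw [abs_sub_comm, abs_of_nonneg (sub_nonneg.2 hle)] at hdist
        have := mul_le_mul_of_nonneg_left hdist hc0.le
        linarith
      · have h1 := hmass q q₀ hqa hle hqb.le
        have h2 := le_levelGain_sub (μ := μ) A hle
        have h3 : (A - b) * (m * (q₀ - q)) ≤
            (A - q₀) * μ.fst.real {x | topProb μ x ∈ Ioc q q₀} :=
          mul_le_mul (by linarith) h1 (mul_nonneg hm.le (sub_nonneg.2 hle))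
            (sub_nonneg.2 hq₀.2.le)
        have h4 := mul_le_mul_of_nonneg_right hc1 (sub_nonneg.2 hle)
        linarith
    nlinarith [mul_le_mul_of_nonneg_left hgoal (sub_nonneg.2 hle)]
  · have hgoal : levelGain μ A (-1) q ≤ -(c * (q - q₀)) := by
      have hcd : c * (q - q₀) ≤ m' := by
        rw [abs_of_nonneg (sub_nonneg.2 hle)] at hdist
        exact (mul_le_mul_of_nonneg_left hdist hc0.le).trans hc2
      rcases le_total q b with hqb' | hqb'
      · have h1 := hmass q₀ q haq.le hle hqb'
        have h2 := le_levelGain_sub (μ := μ) A hle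
        have h3 : (A - b) * (m * (q - q₀)) ≤
            (A - q) * μ.fst.real {x | topProb μ x ∈ Ioc q₀ q} :=
          mul_le_mul (by linarith) h1 (mul_nonneg hm.le (sub_nonneg.2 hle))
            (by linarith)
        have h4 := mul_le_mul_of_nonneg_right hc1 (sub_nonneg.2 hle)
        linarith
      · rcases le_total q A with hqA' | hqA'
        · have := levelGain_antitoneOn (μ := μ) A (show b ∈ Iic A from hbA.le)
            (show q ∈ Iic A from hqA') hqb'
          linarith
        -- Beyond A the function h increases, so its value at q is compared with the negative value
        -- at the right end qbar.
        · have h1 := levelGain_sub_le (μ := μ) A hq.2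
          have h2 : 0 ≤ μ.fst.real {x | topProb μ x ∈ Ioc q qbar} := measureReal_nonneg
          nlinarith
    nlinarith [mul_le_mul_of_nonneg_left hgoal (sub_nonneg.2 hle)]

end TopProbDensity

end Density

/-! ### Integrating out a variable independent of the past. -/

section Freezing

theorem integral_comp_prodMk_of_indepFun {Ω Ω' β : Type*} [MeasurableSpace Ω] [MeasurableSpace Ω']
    [MeasurableSpace β] {P : Measure Ω} [IsProbabilityMeasure P] {U : Ω → Ω'} {Z : Ω → β}
    (hU : Measurable U) (hZ : Measurable Z) (hUZ : IndepFun U Z P) {f : Ω' × β → ℝ}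
    (hf : Measurable f) {C : ℝ} (hC : ∀ z, |f z| ≤ C) :
    ∫ ω, f (U ω, Z ω) ∂P = ∫ ω, ∫ z, f (U ω, z) ∂P.map Z ∂P := by
  have := Measure.isProbabilityMeasure_map (μ := P) hU.aemeasurable
  have := Measure.isProbabilityMeasure_map (μ := P) hZ.aemeasurable
  rw [← integral_map (φ := fun ω => (U ω, Z ω)) (hU.prodMk hZ).aemeasurable
    hf.aestronglyMeasurable, (indepFun_iff_map_prod_eq_prod_map_map hU.aemeasurable
    hZ.aemeasurable).1 hUZ, integral_prod _ (integrable_of_measurable_of_bound hf hC),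
    integral_map hU.aemeasurable]
  exact (StronglyMeasurable.integral_prod_right (f := fun x y => f (x, y))
    hf.stronglyMeasurable).aestronglyMeasurable

theorem integral_freeze {Ω β : Type*} {m m0 : MeasurableSpace Ω} (hm : m ≤ m0)
    [MeasurableSpace β] {P : Measure Ω} [IsProbabilityMeasure P] {Z : Ω → β} (hZ : Measurable Z)
    (hind : Indep m (MeasurableSpace.comap Z inferInstance) P) {f : Ω × β → ℝ}
    (hf : Measurable[m.prod inferInstance] f) {C : ℝ} (hC : ∀ z, |f z| ≤ C) :
    ∫ ω, f (ω, Z ω) ∂P = ∫ ω, ∫ z, f (ω, z) ∂P.map Z ∂P := by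
  -- The whole past is treated as one random variable: the identity into Ω equipped with the smaller
  -- σ-algebra.
  have hind' : @IndepFun Ω Ω β m0 m _ id Z P := (@IndepFun_iff_Indep Ω Ω β m0 m _ id Z P).2 (by
      rw [MeasurableSpace.comap_id]
      exact hind)
  exact @integral_comp_prodMk_of_indepFun Ω Ω β m0 m _ P _ id Z (measurable_id'' hm) hZ hind' f hf
    C hC

theorem measurable_integral_freeze {Ω β : Type*} {m : MeasurableSpace Ω} [MeasurableSpace β]
    {ν : Measure β} [SFinite ν] {f : Ω × β → ℝ} (hf : Measurable[m.prod inferInstance] f) :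
    Measurable[m] fun ω => ∫ z, f (ω, z) ∂ν :=
  (StronglyMeasurable.integral_prod_right (f := fun x y => f (x, y))
    hf.stronglyMeasurable).measurable

end Freezing

/-! ### The filtration, and the independence of a new pair from the past. -/

section Past

variable {Ω : Type*} {d K n : ℕ} {D₀ : Ω → Fin n → Feature d × Fin K} {X : ℕ → Ω → Feature d}
  {Y : ℕ → Ω → Fin K}

theorem past_mono : Monotone (past D₀ X Y) := fun _ _ h =>
  sup_le_sup le_rfl (biSup_mono fun _ hk => ⟨hk.1, hk.2.trans h⟩)

theorem measurable_pair_past {k t : ℕ} (h1 : 1 ≤ k) (h2 : k ≤ t) :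
    Measurable[past D₀ X Y t] fun ω => (X k ω, Y k ω) := by
  refine measurable_iff_comap_le.2 (le_sup_of_le_right ?_)
  exact le_biSup (fun k => MeasurableSpace.comap (fun ω => (X k ω, Y k ω)) inferInstance)
    (show k ∈ Icc 1 t from ⟨h1, h2⟩)

variable [MeasurableSpace Ω] {P : Measure Ω} {μ : Measure (Feature d × Fin K)}

namespace IIDModel

theorem measurable_pair (h : IIDModel P μ D₀ X Y) {t : ℕ} (ht : 1 ≤ t) :
    Measurable fun ω => (X t ω, Y t ω) :=
  (h.measurable_X t ht).prodMk (h.measurable_Y t ht)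

theorem past_le (h : IIDModel P μ D₀ X Y) (t : ℕ) : past D₀ X Y t ≤ ‹MeasurableSpace Ω› :=
  sup_le h.measurable_holdout.comap_le (iSup₂_le fun _ hk => (h.measurable_pair hk.1).comap_le)

/-- With B the earlier pairs and Z the new one, D₀ is independent of (B, Z), and B of Z, so the
joint law of the three is a product. Reassociating the product makes (D₀, B) independent of Z. The
pairs are reindexed from 0, which produces the shift by one. -/
theorem indep_past [IsProbabilityMeasure P] (h : IIDModel P μ D₀ X Y) {t : ℕ} (ht : 1 ≤ t) :
    Indep (past D₀ X Y (t - 1))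
      (MeasurableSpace.comap (fun ω => (X t ω, Y t ω)) inferInstance) P := by
  obtain ⟨s, rfl⟩ := Nat.exists_eq_add_of_le' ht
  rw [Nat.add_sub_cancel]
  set Z : ℕ → Ω → Feature d × Fin K := fun k ω => (X (k + 1) ω, Y (k + 1) ω) with hZ
  have hZm : ∀ k, Measurable (Z k) := fun k => h.measurable_pair (Nat.le_add_left 1 k)
  let B : Ω → (Finset.range s → Feature d × Fin K) := fun ω k => Z k ω
  have hBm : Measurable B := measurable_pi_lambda _ fun k => hZm k
  have hBC : IndepFun B (Z s) P := by
    have h1 := h.indep.indepFun_finset (Finset.range s) {s} (by simp) hZm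
    exact h1.comp (φ := id) measurable_id
      (ψ := fun v : ({s} : Finset ℕ) → Feature d × Fin K => v ⟨s, Finset.mem_singleton_self s⟩)
      (measurable_pi_apply _)
  have hD : IndepFun D₀ (fun ω => (B ω, Z s ω)) P :=
    h.indep_holdout.comp (φ := id)
      (ψ := fun v : ℕ → Feature d × Fin K => ((fun k : Finset.range s => v k), v s)) measurable_id
      ((measurable_pi_lambda _ fun k => measurable_pi_apply _).prodMk (measurable_pi_apply _))
  have hDB : IndepFun D₀ B P := hD.comp measurable_id measurable_fst
  have hDm := h.measurable_holdout
  have := Measure.isProbabilityMeasure_map (μ := P) hDm.aemeasurable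
  have := Measure.isProbabilityMeasure_map (μ := P) hBm.aemeasurable
  have := Measure.isProbabilityMeasure_map (μ := P) (hZm s).aemeasurable
  have key : IndepFun (fun ω => (D₀ ω, B ω)) (Z s) P := by
    rw [indepFun_iff_map_prod_eq_prod_map_map (hDm.prodMk hBm).aemeasurable
      (hZm s).aemeasurable, (indepFun_iff_map_prod_eq_prod_map_map hDm.aemeasurable
      hBm.aemeasurable).1 hDB]
    have h1 := (indepFun_iff_map_prod_eq_prod_map_map hDm.aemeasurable
      (hBm.prodMk (hZm s)).aemeasurable).1 hD
    rw [(indepFun_iff_map_prod_eq_prod_map_map hBm.aemeasurable (hZm s).aemeasurable).1 hBC,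
      ← Measure.prodAssoc_prod] at h1
    have h2 := congrArg (Measure.map MeasurableEquiv.prodAssoc.symm) h1
    rwa [Measure.map_map (by fun_prop) (hDm.prodMk (hBm.prodMk (hZm s))),
      Measure.map_map (MeasurableEquiv.measurable _) (MeasurableEquiv.measurable _),
      MeasurableEquiv.symm_comp_self, Measure.map_id] at h2
  rw [IndepFun_iff_Indep] at key
  refine indep_of_indep_of_le_left key (sup_le ?_ (iSup₂_le fun k hk => ?_))
  · exact measurable_iff_comap_le.1
      (measurable_fst.comp (comap_measurable fun ω => (D₀ ω, B ω)))
  · obtain ⟨j, rfl⟩ := Nat.exists_eq_add_of_le' hk.1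
    have hj : j ∈ Finset.range s := Finset.mem_range.2 (by have := hk.2; omega)
    exact measurable_iff_comap_le.1 ((measurable_pi_apply (⟨j, hj⟩ : Finset.range s)).comp
      (measurable_snd.comp (comap_measurable fun ω => (D₀ ω, B ω))))

theorem integral_freeze [IsProbabilityMeasure P] (h : IIDModel P μ D₀ X Y) {t : ℕ} (ht : 1 ≤ t)
    {f : Ω × (Feature d × Fin K) → ℝ}
    (hf : Measurable[(past D₀ X Y (t - 1)).prod inferInstance] f) {C : ℝ} (hC : ∀ z, |f z| ≤ C) :
    ∫ ω, f (ω, (X t ω, Y t ω)) ∂P = ∫ ω, ∫ z, f (ω, z) ∂μ ∂P := by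
  have := OnlineSCI.integral_freeze (h.past_le (t - 1)) (h.measurable_pair ht) (h.indep_past ht)
    hf hC
  rwa [h.law t ht] at this

end IIDModel

end Past

/-! ### Conditional mean rewards of procedures measurable in the past. -/

section Rewards

theorem abs_indicator_le {α : Type*} (s : Set α) {f : α → ℝ} {C : ℝ} {x : α} (hf : |f x| ≤ C) :
    |s.indicator f x| ≤ C :=
  (norm_indicator_le_norm_self f x).trans hf

variable {Ω : Type*} {d K n : ℕ} [NeZero K]

/-- The mean estimation error `E[max_y |p_t(X, y) - P(Y = y | X)|]` for frozen scores `p_t`. -/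
noncomputable def meanError (μ : Measure (Feature d × Fin K)) [IsProbabilityMeasure μ]
    (p : ℕ → Ω → Feature d → Fin K → ℝ) (t : ℕ) (ω : Ω) : ℝ :=
  ∫ x, maxScore (fun y => |p t ω x y - classProb μ x y|) ∂μ.fst

/-- The reward `a + b 1{Y_t = Ŷ_t(X_t)}`, if there is a selection at time `t`. -/
noncomputable def SelectiveClassifier.reward (R : SelectiveClassifier Ω d K)
    (X : ℕ → Ω → Feature d) (Y : ℕ → Ω → Fin K) (a b : ℝ) (t : ℕ) : Ω → ℝ :=
  {ω | R.select t ω (X t ω)}.indicator fun ω =>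
    a + b * {ω | Y t ω = R.predict t ω (X t ω)}.indicator 1 ω

theorem SelectiveClassifier.abs_reward_le (R : SelectiveClassifier Ω d K)
    (X : ℕ → Ω → Feature d) (Y : ℕ → Ω → Fin K) {a b : ℝ} (h0 : |a| ≤ 1) (h1 : |a + b| ≤ 1) (t : ℕ) (ω : Ω) : |R.reward X Y a b t ω| ≤ 1 := by
  refine abs_indicator_le _ (abs_affine_le h0 h1 ?_)
  simp only [indicator]
  split_ifs <;> simp

/-- The mean reward of a selective classifier at time `t` given the past. -/
noncomputable def SelectiveClassifier.gain (R : SelectiveClassifier Ω d K)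
    (μ : Measure (Feature d × Fin K)) [IsProbabilityMeasure μ] (a b : ℝ) (t : ℕ) (ω : Ω) : ℝ :=
  ruleGain μ a b {x | R.select t ω x} (R.predict t ω)

variable {D₀ : Ω → Fin n → Feature d × Fin K} {X : ℕ → Ω → Feature d}
  {Y : ℕ → Ω → Fin K} {μ : Measure (Feature d × Fin K)} [IsProbabilityMeasure μ]

theorem measurable_section {m : MeasurableSpace Ω} {β γ : Type*} [MeasurableSpace β]
    [MeasurableSpace γ] {f : Ω × β → γ} (hf : Measurable[m.prod inferInstance] f) (ω : Ω) :
    Measurable fun x => f (ω, x) :=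
  hf.comp measurable_prodMk_left

theorem SelectiveClassifier.IsOnline.measurable_gain {R : SelectiveClassifier Ω d K}
    {ℱ : ℕ → MeasurableSpace Ω} (hR : R.IsOnline ℱ) (a b : ℝ) {t : ℕ} (ht : 1 ≤ t) :
    Measurable[ℱ (t - 1)] (R.gain μ a b t) := by
  have hs := hR.select t ht
  have hp := hR.predict t ht
  let := ℱ (t - 1)
  refine measurable_integral_freeze (ν := μ.fst) (f := {z : Ω × Feature d |
    R.select t z.1 z.2}.indicator fun z => a + b * classProb μ z.2 (R.predict t z.1 z.2)) ?_
  exact (measurable_const.add (measurable_const.mul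
    ((measurable_classProb_prod μ).comp (measurable_snd.prodMk hp)))).indicator hs

variable [MeasurableSpace Ω] {P : Measure Ω} [IsProbabilityMeasure P]

/-- The mean of a reward with a weight that is known at time `t - 1`. -/
theorem SelectiveClassifier.IsOnline.integral_mul_reward {R : SelectiveClassifier Ω d K}
    (hR : R.IsOnline (past D₀ X Y)) (h : IIDModel P μ D₀ X Y) {a b : ℝ} (h0 : |a| ≤ 1)
    (h1 : |a + b| ≤ 1) {t : ℕ} (ht : 1 ≤ t) {w : Ω → ℝ} (hw : Measurable[past D₀ X Y (t - 1)] w)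
    {C : ℝ} (hC : ∀ ω, |w ω| ≤ C) :
    ∫ ω, w ω * R.reward X Y a b t ω ∂P = ∫ ω, w ω * R.gain μ a b t ω ∂P := by
  let f : Ω × (Feature d × Fin K) → ℝ := fun z => w z.1 *
    {z : Ω × (Feature d × Fin K) | R.select t z.1 z.2.1}.indicator (fun z => a + b *
      {z : Ω × (Feature d × Fin K) | z.2.2 = R.predict t z.1 z.2.1}.indicator 1 z) z
  have hs := hR.select t ht
  have hp := hR.predict t ht
  have hf : Measurable[(past D₀ X Y (t - 1)).prod inferInstance] f := by
    let := past D₀ X Y (t - 1)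
    have hg : Measurable fun z : Ω × (Feature d × Fin K) => (z.1, z.2.1) := by fun_prop
    refine (hw.comp measurable_fst).mul (Measurable.indicator ?_ (hg hs))
    exact measurable_const.add (measurable_const.mul (measurable_one.indicator
      (measurableSet_eq_fun (measurable_snd.comp measurable_snd) (hp.comp hg))))
  have hfC : ∀ z, |f z| ≤ C := by
    intro z
    rw [abs_mul]
    refine (mul_le_of_le_one_right (abs_nonneg _) ?_).trans (hC z.1)
    refine abs_indicator_le _ (abs_affine_le h0 h1 ?_)
    simp only [indicator]
    split_ifs <;> simp
  have key := h.integral_freeze ht hf hfC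
  calc ∫ ω, w ω * R.reward X Y a b t ω ∂P = ∫ ω, f (ω, (X t ω, Y t ω)) ∂P := rfl
    _ = ∫ ω, ∫ z, f (ω, z) ∂μ ∂P := key
    _ = ∫ ω, w ω * R.gain μ a b t ω ∂P := by
      refine integral_congr_ae (ae_of_all _ fun ω => ?_)
      have hsω : MeasurableSet {x | R.select t ω x} :=
        @measurable_prodMk_left _ _ (past D₀ X Y (t - 1)) _ ω _ hs
      have hpω : Measurable (R.predict t ω) :=
        measurable_section (m := past D₀ X Y (t - 1)) hp ω
      dsimp only
      rw [SelectiveClassifier.gain, ruleGain, ← integral_indicator_label μ hsω hpω,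
        ← integral_const_mul]
      rfl

/-- Freezing the scores and integrating over a fresh feature gives a version of the conditional
expectation, as one sees by freezing against the indicator of an event of the past. The estimation
hypothesis thereby becomes a statement about an explicit adapted function. -/
theorem meanError_ae_eq (h : IIDModel P μ D₀ X Y) {p : ℕ → Ω → Feature d → Fin K → ℝ}
    (hp : IsOnlineEstimator (past D₀ X Y) p) {t : ℕ} (ht : 1 ≤ t) :
    meanError μ p t =ᵐ[P] P[fun ω => maxScore fun y => |p t ω (X t ω) y - classProb μ (X t ω) y| |
      past D₀ X Y (t - 1)] := by
  let g : Ω × Feature d → ℝ := fun z => maxScore fun y => |p t z.1 z.2 y - classProb μ z.2 y|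
  have hg : Measurable[(past D₀ X Y (t - 1)).prod inferInstance] g := by
    have hpm := hp.measurable t ht
    let := past D₀ X Y (t - 1)
    exact measurable_maxScore fun y =>
      ((hpm y).sub ((measurable_classProb μ y).comp measurable_snd)).abs
  have hg1 : ∀ z, |g z| ≤ 1 := fun z => by
    rw [abs_of_nonneg (maxScore_abs_nonneg _)]
    refine maxScore_le fun y => ?_
    have h1 := hp.mem_Icc t ht z.1 z.2 y
    have h2 := classProb_mem_Icc μ z.2 y
    simp only [mem_Icc] at *
    rw [abs_le]
    constructor <;> linarith
  have hm := h.past_le (t - 1)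
  have hEm : Measurable[past D₀ X Y (t - 1)] (meanError μ p t) :=
    measurable_integral_freeze (ν := μ.fst) (f := g) hg
  have hE1 : ∀ ω, |meanError μ p t ω| ≤ 1 := fun ω => by
    have := norm_integral_le_of_norm_le_const (μ := μ.fst) (C := 1)
      (f := fun x => g (ω, x)) (ae_of_all _ fun x => hg1 (ω, x))
    simpa [meanError] using this
  have hgX : Measurable fun ω => g (ω, X t ω) := by
    have hpair : @Measurable Ω (Ω × Feature d) _ ((past D₀ X Y (t - 1)).prod inferInstance)
        fun ω => (ω, X t ω) :=
      @Measurable.prodMk _ _ _ _ (past D₀ X Y (t - 1)) _ _ _ (measurable_id'' hm)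
        (h.measurable_X t ht)
    exact hg.comp hpair
  refine ae_eq_condExp_of_forall_setIntegral_eq hm (f := fun ω => g (ω, X t ω))
    (integrable_of_measurable_of_bound hgX fun ω => hg1 _)
    (fun s _ _ => (integrable_of_measurable_of_bound (hEm.mono hm le_rfl) hE1).integrableOn)
    (fun s hs _ => ?_) hEm.stronglyMeasurable.aestronglyMeasurable
  have key := h.integral_freeze ht (C := 1) (f := fun z => s.indicator 1 z.1 * g (z.1, z.2.1))
    (by
      let := past D₀ X Y (t - 1)
      exact ((measurable_one.indicator hs).comp measurable_fst).mul
        (hg.comp (measurable_fst.prodMk (measurable_fst.comp measurable_snd))))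
    (fun z => by
      rw [abs_mul]
      refine mul_le_one₀ ?_ (abs_nonneg _) (hg1 _)
      simp only [indicator]
      split_ifs <;> simp)
  rw [← integral_indicator (hm s hs), ← integral_indicator (hm s hs)]
  calc ∫ ω, s.indicator (meanError μ p t) ω ∂P
      = ∫ ω, ∫ z, s.indicator 1 ω * g (ω, z.1) ∂μ ∂P := by
        refine integral_congr_ae (ae_of_all _ fun ω => ?_)
        dsimp only
        have hgω : Measurable fun x => g (ω, x) :=
          measurable_section (m := past D₀ X Y (t - 1)) hg ω
        have hmE : meanError μ p t ω = ∫ z, g (ω, z.1) ∂μ := by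
          rw [← integral_map measurable_fst.aemeasurable hgω.aestronglyMeasurable]
          rfl
        rw [integral_const_mul, ← hmE]
        by_cases hω : ω ∈ s <;> simp [hω]
    _ = _ := by
        rw [← key]
        refine integral_congr_ae (ae_of_all _ fun ω => ?_)
        by_cases hω : ω ∈ s <;> simp [hω]

theorem EstimationRate.exists_meanError (h : IIDModel P μ D₀ X Y)
    {p : ℕ → Ω → Feature d → Fin K → ℝ} (hp : IsOnlineEstimator (past D₀ X Y) p) {ν₀ ν : ℝ}
    (hr : EstimationRate P μ (past D₀ X Y) X p ν₀ ν) :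
    ∃ C₁ > (0 : ℝ), ∀ᶠ t : ℕ in atTop,
      P.real {ω | C₁ * Real.log t ^ ν₀ * (t : ℝ) ^ (-ν) ≤ meanError μ p t ω} ≤
        3 / (Real.pi ^ 2 * (t : ℝ) ^ 3) := by
  obtain ⟨C₁, hC₁, hev⟩ := hr
  refine ⟨C₁, hC₁, ?_⟩
  filter_upwards [hev, eventually_ge_atTop 1] with t ht ht1
  refine le_of_eq_of_le (measureReal_congr ?_) ht
  filter_upwards [meanError_ae_eq h hp ht1] with ω hω
  refine propext ?_
  change _ ≤ _ ↔ _ ≤ _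
  rw [hω]

end Rewards

/-! ### Two deterministic recursions. -/

section Recursions

/-- A Chung-type induction. Half of the contraction aγ absorbs the source term once C ≥ 2A/a; the
other half dominates 1/t and so pays for the decrease of b from t to t + 1. -/
theorem exists_le_mul_of_recursion {γ u b : ℕ → ℝ} {a A : ℝ} (ha : 0 < a) {N : ℕ}
    (hb : ∀ t ≥ N, 0 < b t) (hγ : ∀ t ≥ N, 0 ≤ γ t)
    (hb1 : ∀ t ≥ N, (1 - 1 / (t : ℝ)) * b t ≤ b (t + 1))
    (hγ1 : ∀ t ≥ N, a * γ t ≤ 1) (hγ2 : ∀ t ≥ N, 1 / (t : ℝ) ≤ a / 2 * γ t)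
    (hu : ∀ t ≥ N, u (t + 1) ≤ (1 - a * γ t) * u t + A * γ t * b t) :
    ∃ C > 0, ∀ t ≥ N, u t ≤ C * b t := by
  refine ⟨max (u N / b N) (max (2 * A / a) 1), lt_max_of_lt_right (lt_max_of_lt_right one_pos),
    fun t ht => ?_⟩
  set C := max (u N / b N) (max (2 * A / a) 1) with hC
  have hC1 : u N / b N ≤ C := le_max_left _ _
  have hC2 : 2 * A / a ≤ C := (le_max_left _ _).trans (le_max_right _ _)
  have hC0 : 0 ≤ C := zero_le_one.trans ((le_max_right _ _).trans (le_max_right _ _))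
  rw [div_le_iff₀ ha] at hC2
  induction t, ht using Nat.le_induction with
  | base => exact (div_le_iff₀ (hb N le_rfl)).1 hC1
  | succ t ht ih =>
    have h1 := mul_le_mul_of_nonneg_left ih (sub_nonneg.2 (hγ1 t ht))
    have hγb : 0 ≤ γ t * b t := mul_nonneg (hγ t ht) (hb t ht).le
    have h2 : A * (γ t * b t) ≤ C * a / 2 * (γ t * b t) :=
      mul_le_mul_of_nonneg_right (by linarith) hγb
    have h3 : 1 / (t : ℝ) * (C * b t) ≤ a / 2 * γ t * (C * b t) :=
      mul_le_mul_of_nonneg_right (hγ2 t ht) (mul_nonneg hC0 (hb t ht).le)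
    have h4 := mul_le_mul_of_nonneg_left (hb1 t ht) hC0
    calc u (t + 1) ≤ (1 - a * γ t) * u t + A * γ t * b t := hu t ht
      _ ≤ C * ((1 - 1 / (t : ℝ)) * b t) := by linarith
      _ ≤ C * b (t + 1) := h4

/-- If x stayed above ε/2, the summed recursion would bound the divergent sum of γ; so x falls below
ε/2 at some late time. From then on it can rise by no more than the tail of b, which is below ε/2 as
well. -/
theorem tendsto_zero_of_recursion {γ x b : ℕ → ℝ} {a : ℝ} (ha : 0 < a) {N : ℕ}
    (hx : ∀ t, 0 ≤ x t) (hγ : ∀ t, 0 ≤ γ t) (hγs : ¬ Summable γ) (hb : ∀ t, 0 ≤ b t)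
    (hbs : Summable b) (hrec : ∀ t ≥ N, x (t + 1) ≤ x t - a * γ t * x t + b t) :
    Tendsto x atTop (𝓝 0) := by
  have htail : ∀ s ≥ N, ∀ k, x (s + k) + ∑ i ∈ Finset.range k, a * γ (s + i) * x (s + i) ≤
      x s + ∑ i ∈ Finset.range k, b (s + i) := by
    intro s hs k
    induction k with
    | zero => simp
    | succ k ih =>
      rw [Finset.sum_range_succ, Finset.sum_range_succ, ← add_assoc]
      have := hrec (s + k) (by omega)
      rw [← add_assoc]
      linarith
  have hnn : ∀ s k, 0 ≤ ∑ i ∈ Finset.range k, a * γ (s + i) * x (s + i) := fun s k =>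
    Finset.sum_nonneg fun i _ => mul_nonneg (mul_nonneg ha.le (hγ _)) (hx _)
  rw [Metric.tendsto_atTop]
  intro ε hε
  have hts := tendsto_sum_nat_add b
  obtain ⟨N₁, hN₁⟩ := (Metric.tendsto_atTop.1 hts) (ε / 2) (half_pos hε)
  set M := max N N₁ with hM
  have htl : ∀ s ≥ M, ∀ k, ∑ i ∈ Finset.range k, b (s + i) < ε / 2 := by
    intro s hs k
    have h1 := hN₁ s ((le_max_right _ _).trans hs)
    rw [Real.dist_eq, sub_zero] at h1
    have h2 := Summable.sum_le_tsum (f := fun i => b (i + s)) (Finset.range k)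
      (fun i _ => hb _) ((summable_nat_add_iff s).2 hbs)
    have h3 : ∑ i ∈ Finset.range k, b (s + i) = ∑ i ∈ Finset.range k, b (i + s) :=
      Finset.sum_congr rfl fun i _ => by rw [add_comm]
    linarith [le_abs_self (∑' k, b (k + s))]
  obtain ⟨s, hs, hxs⟩ : ∃ s ≥ M, x s < ε / 2 := by
    by_contra! hcon
    refine hγs ((summable_nat_add_iff M).1 (summable_of_sum_range_le
      (c := (x M + ε / 2) / (a * (ε / 2))) (fun i => hγ _) fun k => ?_))
    rw [le_div_iff₀ (by positivity), Finset.sum_mul]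
    have h1 := htail M (le_max_left _ _) k
    have h2 := htl M le_rfl k
    have h3 : ∑ i ∈ Finset.range k, γ (i + M) * (a * (ε / 2)) ≤
        ∑ i ∈ Finset.range k, a * γ (M + i) * x (M + i) := by
      refine Finset.sum_le_sum fun i _ => ?_
      have := mul_le_mul_of_nonneg_left (hcon (M + i) (by omega))
        (mul_nonneg ha.le (hγ (M + i)))
      rw [add_comm i M]
      linarith
    linarith [hx (M + k)]
  refine ⟨s, fun t ht => ?_⟩
  obtain ⟨k, rfl⟩ := Nat.exists_eq_add_of_le ht
  rw [Real.dist_eq, sub_zero, abs_of_nonneg (hx _)]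
  linarith [htail s ((le_max_left _ _).trans hs) k, hnn s k, htl s hs k]

end Recursions

/-! ### Powers of t and log t. -/

section Rates

theorem one_sub_inv_mul_rpow_le {s : ℝ} (hs1 : s ≤ 1) {t : ℕ} (ht : 1 ≤ t) :
    (1 - 1 / (t : ℝ)) * (t : ℝ) ^ (-s) ≤ ((t + 1 : ℕ) : ℝ) ^ (-s) := by
  have ht0 : (0 : ℝ) < t := by exact_mod_cast ht
  have h1 : (0 : ℝ) < (t : ℝ) / (t + 1) := by positivity
  have h2 : (t : ℝ) / (t + 1) ≤ 1 := (div_le_one (by positivity)).2 (by linarith)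
  have h3 : (t : ℝ) / (t + 1) ≤ ((t : ℝ) / (t + 1)) ^ s := by
    simpa using Real.rpow_le_rpow_of_exponent_ge h1 h2 hs1
  have h4 : 1 - 1 / (t : ℝ) ≤ (t : ℝ) / (t + 1) := by
    rw [le_div_iff₀ (by positivity)]
    have : (1 - 1 / (t : ℝ)) * (t + 1) = t - 1 / t := by
      field_simp
      ring
    rw [this]
    linarith [one_div_pos.2 ht0]
  calc (1 - 1 / (t : ℝ)) * (t : ℝ) ^ (-s) ≤ ((t : ℝ) / (t + 1)) ^ s * (t : ℝ) ^ (-s) :=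
        mul_le_mul_of_nonneg_right (h4.trans h3) (by positivity)
    _ = ((t + 1 : ℕ) : ℝ) ^ (-s) := by
        rw [Real.div_rpow ht0.le (by positivity), Real.rpow_neg ht0.le,
          Real.rpow_neg (by positivity)]
        have : (t : ℝ) ^ s ≠ 0 := (Real.rpow_pos_of_pos ht0 s).ne'
        push_cast
        field_simp

theorem one_sub_inv_mul_log_rpow_le {ν₀ s : ℝ} (hν₀ : 0 ≤ ν₀) (hs1 : s ≤ 1) {t : ℕ}
    (ht : 1 ≤ t) : (1 - 1 / (t : ℝ)) * (Real.log t ^ ν₀ * (t : ℝ) ^ (-s)) ≤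
      Real.log (t + 1 : ℕ) ^ ν₀ * ((t + 1 : ℕ) : ℝ) ^ (-s) := by
  have ht0 : (0 : ℝ) < t := by exact_mod_cast ht
  have ht1 : (1 : ℝ) ≤ t := by exact_mod_cast ht
  have h1 : Real.log t ^ ν₀ ≤ Real.log (t + 1 : ℕ) ^ ν₀ :=
    Real.rpow_le_rpow (Real.log_nonneg ht1)
      (Real.log_le_log ht0 (by push_cast; linarith)) hν₀
  calc (1 - 1 / (t : ℝ)) * (Real.log t ^ ν₀ * (t : ℝ) ^ (-s))
      = Real.log t ^ ν₀ * ((1 - 1 / (t : ℝ)) * (t : ℝ) ^ (-s)) := by ring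
    _ ≤ Real.log t ^ ν₀ * ((t + 1 : ℕ) : ℝ) ^ (-s) :=
        mul_le_mul_of_nonneg_left (one_sub_inv_mul_rpow_le hs1 ht)
          (Real.rpow_nonneg (Real.log_nonneg ht1) _)
    _ ≤ _ := mul_le_mul_of_nonneg_right h1 (by positivity)

theorem tendsto_rpow_neg_nat {s : ℝ} (hs : 0 < s) :
    Tendsto (fun t : ℕ => (t : ℝ) ^ (-s)) atTop (𝓝 0) :=
  (tendsto_rpow_neg_atTop hs).comp tendsto_natCast_atTop_atTop

theorem tendsto_log_rpow_mul_rpow_neg (ν₀ : ℝ) {ν : ℝ} (hν : 0 < ν) :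
    Tendsto (fun t : ℕ => Real.log t ^ ν₀ * (t : ℝ) ^ (-ν)) atTop (𝓝 0) := by
  have h := ((isLittleO_log_rpow_rpow_atTop ν₀ hν).tendsto_div_nhds_zero).comp
    (tendsto_natCast_atTop_atTop (R := ℝ))
  refine h.congr fun t => ?_
  simp only [Function.comp_apply]
  rw [Real.rpow_neg (Nat.cast_nonneg t), div_eq_mul_inv]

theorem eventually_inv_le_mul_rpow_neg {β : ℝ} (hβ : β < 1) {a : ℝ} (ha : 0 < a) :
    ∀ᶠ t : ℕ in atTop, 1 / (t : ℝ) ≤ a * (t : ℝ) ^ (-β) := by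
  filter_upwards [(tendsto_rpow_neg_nat (sub_pos.2 hβ)).eventually_le_const ha,
    eventually_ge_atTop 1] with t ht ht1
  have ht0 : (0 : ℝ) < t := by exact_mod_cast ht1
  calc 1 / (t : ℝ) = (t : ℝ) ^ (-(1 - β)) * (t : ℝ) ^ (-β) := by
        rw [← Real.rpow_add ht0, one_div, ← Real.rpow_neg_one]
        congr 1
        ring
    _ ≤ a * (t : ℝ) ^ (-β) := mul_le_mul_of_nonneg_right ht (by positivity)

theorem sqrt_add_le_add_sqrt {x y : ℝ} (hx : 0 ≤ x) (hy : 0 ≤ y) : √(x + y) ≤ √x + √y :=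
  Real.sqrt_le_iff.2 ⟨by positivity, by
    nlinarith [Real.sq_sqrt hx, Real.sq_sqrt hy, mul_nonneg (Real.sqrt_nonneg x) (Real.sqrt_nonneg y)]⟩

theorem sqrt_rpow_mul {ν₀ ν x y : ℝ} (hx : 0 ≤ x) (hy : 0 ≤ y) :
    √(x ^ ν₀ * y ^ (-ν)) = x ^ (ν₀ / 2) * y ^ (-ν / 2) := by
  rw [Real.sqrt_mul (Real.rpow_nonneg hx _), Real.sqrt_eq_rpow, Real.sqrt_eq_rpow,
    ← Real.rpow_mul hx, ← Real.rpow_mul hy]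
  ring_nf

theorem one_le_log {t : ℕ} (ht : 3 ≤ t) : 1 ≤ Real.log t := by
  rw [Real.le_log_iff_exp_le (by positivity)]
  have : (3 : ℝ) ≤ t := by exact_mod_cast ht
  linarith [Real.exp_one_lt_d9]

theorem rate_nonneg (β ν₀ ν : ℝ) {t : ℕ} (ht : 3 ≤ t) : 0 ≤ rate β ν₀ ν t := by
  have := one_le_log ht
  rw [rate]
  positivity

theorem sqrt_log_rpow_le_rate (β ν₀ ν : ℝ) {t : ℕ} (ht : 3 ≤ t) :
    √(Real.log t ^ ν₀ * (t : ℝ) ^ (-ν)) ≤ rate β ν₀ ν t := by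
  have := one_le_log ht
  rw [sqrt_rpow_mul (by linarith) (by positivity), rate]
  exact le_add_of_nonneg_left (by positivity)

/-- The square root is subadditive, and -β/2 ≤ 1/2 - β because β ≤ 1. The logarithm is at least 1
from t = 3 on, so its powers can be inserted freely. -/
theorem sqrt_add_le_rate {β : ℝ} (hβ : β ≤ 1) (ν₀ ν : ℝ) {t : ℕ} (ht : 3 ≤ t) :
    √((t : ℝ) ^ (-β) + Real.log t ^ ν₀ * (t : ℝ) ^ (-ν)) ≤ rate β ν₀ ν t := by
  have hl := one_le_log ht
  have ht1 : (1 : ℝ) ≤ t := by exact_mod_cast (by omega : 1 ≤ t)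
  refine (sqrt_add_le_add_sqrt (by positivity) (by positivity)).trans ?_
  rw [sqrt_rpow_mul (by linarith) (by positivity), rate]
  refine add_le_add ?_ le_rfl
  refine le_trans ?_ (le_add_of_nonneg_right (by positivity))
  rw [Real.sqrt_eq_rpow, ← Real.rpow_mul (by positivity)]
  calc (t : ℝ) ^ (-β * (1 / 2)) ≤ (t : ℝ) ^ (1 / 2 - β) :=
        Real.rpow_le_rpow_of_exponent_le ht1 (by linarith)
    _ ≤ _ := le_mul_of_one_le_left (by positivity) (Real.one_le_rpow hl (by norm_num))

end Rates

/-! ### Pathwise behaviour of the threshold and of the step index. -/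

section Dynamics

variable {Ω : Type*} {d K n : ℕ} [NeZero K]

/-- The step index `J(t)` of online selective classification. -/
noncomputable def stepIndex (γ : ℕ → ℝ) (α q₁ : ℝ) (X : ℕ → Ω → Feature d) (Y : ℕ → Ω → Fin K)
    (p : ℕ → Ω → Feature d → Fin K → ℝ) (t : ℕ) (ω : Ω) : ℕ :=
  (sciState γ α q₁ (fun s q => q < maxScore (p s ω (X s ω)))
    (fun s => Y s ω ≠ argmaxLabel (p s ω (X s ω))) t).2

/-- The increment of the threshold at time `t` in units of the step size. -/
noncomputable def increment (γ : ℕ → ℝ) (α q₁ : ℝ) (X : ℕ → Ω → Feature d) (Y : ℕ → Ω → Fin K)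
    (p : ℕ → Ω → Feature d → Fin K → ℝ) (t : ℕ) (ω : Ω) : ℝ :=
  {ω | (sci γ α q₁ X Y p).select t ω (X t ω)}.indicator (fun ω =>
    react (Y t ω ≠ argmaxLabel (p t ω (X t ω))) (threshold γ α q₁ X Y p t ω) - α) ω

variable {γ : ℕ → ℝ} {α q₁ : ℝ} {X : ℕ → Ω → Feature d} {Y : ℕ → Ω → Fin K}
  {p : ℕ → Ω → Feature d → Fin K → ℝ}

theorem threshold_one (ω : Ω) : threshold γ α q₁ X Y p 1 ω = q₁ := rfl

theorem stepIndex_one (ω : Ω) : stepIndex γ α q₁ X Y p 1 ω = 1 := rfl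

theorem threshold_succ {t : ℕ} (ht : 1 ≤ t) (ω : Ω) :
    threshold γ α q₁ X Y p (t + 1) ω = threshold γ α q₁ X Y p t ω +
      γ (stepIndex γ α q₁ X Y p t ω) * increment γ α q₁ X Y p t ω := by
  obtain ⟨s, rfl⟩ := Nat.exists_eq_add_of_le' ht
  rw [increment]
  by_cases h : threshold γ α q₁ X Y p (s + 1) ω < maxScore (p (s + 1) ω (X (s + 1) ω))
  · rw [indicator_of_mem (by exact h)]
    exact congrArg Prod.fst (if_pos h)
  · rw [indicator_of_notMem (by exact h), mul_zero, add_zero]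
    exact congrArg Prod.fst (if_neg h)

open Classical in
theorem stepIndex_succ {t : ℕ} (ht : 1 ≤ t) (ω : Ω) :
    stepIndex γ α q₁ X Y p (t + 1) ω = stepIndex γ α q₁ X Y p t ω +
      if (sci γ α q₁ X Y p).select t ω (X t ω) then 1 else 0 := by
  obtain ⟨s, rfl⟩ := Nat.exists_eq_add_of_le' ht
  by_cases h : (sci γ α q₁ X Y p).select (s + 1) ω (X (s + 1) ω)
  · rw [if_pos h]
    exact congrArg Prod.snd (if_pos h)
  · rw [if_neg h]
    exact congrArg Prod.snd (if_neg h)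

theorem one_le_stepIndex {t : ℕ} (ht : 1 ≤ t) (ω : Ω) : 1 ≤ stepIndex γ α q₁ X Y p t ω := by
  induction t, ht using Nat.le_induction with
  | base => exact le_rfl
  | succ t ht ih =>
    rw [stepIndex_succ ht]
    omega

theorem stepIndex_le {t : ℕ} (ht : 1 ≤ t) (ω : Ω) : stepIndex γ α q₁ X Y p t ω ≤ t := by
  induction t, ht using Nat.le_induction with
  | base => exact le_rfl
  | succ t ht ih =>
    rw [stepIndex_succ ht]
    split_ifs <;> omega

theorem react_mem_Icc (err : Prop) (q : ℝ) : react err q ∈ Icc (0 : ℝ) 1 := by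
  rw [react]
  split_ifs <;> simp

theorem abs_increment_le (hα : α ∈ Ioo (0 : ℝ) 1) (t : ℕ) (ω : Ω) :
    |increment γ α q₁ X Y p t ω| ≤ 1 := by
  have := react_mem_Icc (Y t ω ≠ argmaxLabel (p t ω (X t ω))) (threshold γ α q₁ X Y p t ω)
  exact abs_indicator_le _ (abs_le.2 ⟨by linarith [this.1, hα.2], by linarith [this.2, hα.1]⟩)

/-- A move requires a selection, hence a threshold below 1, so one step cannot pass 1 + c. A
negative threshold triggers the reaction 1 and only rises, so one step down from a nonnegative value
ends above -c. -/
theorem threshold_mem_Icc {c : ℝ} (hc : 0 ≤ c) (hγ0 : ∀ j, 0 ≤ γ j) (hγc : ∀ j ≥ 1, γ j ≤ c)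
    (hα : α ∈ Ioo (0 : ℝ) 1) (hq₁ : q₁ ∈ Icc 0 (1 - α))
    (hp : ∀ t, 1 ≤ t → ∀ ω x y, p t ω x y ∈ Icc (0 : ℝ) 1) {t : ℕ} (ht : 1 ≤ t) (ω : Ω) :
    threshold γ α q₁ X Y p t ω ∈ Icc (-c) (1 + c) := by
  induction t, ht using Nat.le_induction with
  | base => exact ⟨by rw [threshold_one]; linarith [hq₁.1],
      by rw [threshold_one]; linarith [hq₁.2, hα.1]⟩
  | succ t ht ih =>
    rw [threshold_succ ht]
    set q := threshold γ α q₁ X Y p t ω with hq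
    have hj0 := hγ0 (stepIndex γ α q₁ X Y p t ω)
    have hjc := hγc _ (one_le_stepIndex (γ := γ) (α := α) (q₁ := q₁) (X := X) (Y := Y) (p := p)
      ht ω)
    set g := γ (stepIndex γ α q₁ X Y p t ω)
    by_cases h : q < maxScore (p t ω (X t ω))
    · have hm := maxScore_mem_Icc (hp t ht ω (X t ω))
      have hi : increment γ α q₁ X Y p t ω = react (Y t ω ≠ argmaxLabel (p t ω (X t ω))) q - α :=
        indicator_of_mem (by exact h) _
      have ha := abs_le.1 (abs_increment_le (γ := γ) (q₁ := q₁) (X := X) (Y := Y) (p := p) hα t ω)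
      refine ⟨?_, by nlinarith [hm.2]⟩
      by_cases hq0 : q < 0
      · have : react (Y t ω ≠ argmaxLabel (p t ω (X t ω))) q = 1 := by
          rw [react, if_pos (Or.inl hq0)]
        rw [hi, this]
        have := mul_nonneg hj0 (sub_nonneg.2 hα.2.le)
        linarith [ih.1]
      · push Not at hq0
        nlinarith
    · have hi : increment γ α q₁ X Y p t ω = 0 := indicator_of_notMem (by exact h) _
      rw [hi]
      simpa using ih

/-- Each selection uses one step size and advances the index by one, so along every trajectory the
steps actually used are γ 1, γ 2, … without repetition. -/
theorem sum_sq_step {N : ℕ} (ω : Ω) :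
    ∑ s ∈ Finset.range N, γ (stepIndex γ α q₁ X Y p (s + 1) ω) ^ 2 *
        (sci γ α q₁ X Y p).reward X Y 1 0 (s + 1) ω =
      ∑ j ∈ Finset.Ico 1 (stepIndex γ α q₁ X Y p (N + 1) ω), γ j ^ 2 := by
  induction N with
  | zero => simp [stepIndex_one]
  | succ N ih =>
    rw [Finset.sum_range_succ, ih, stepIndex_succ (t := N + 1) (by omega)]
    have h1 := one_le_stepIndex (γ := γ) (α := α) (q₁ := q₁) (X := X) (Y := Y) (p := p)
      (t := N + 1) (by omega) ω
    by_cases h : (sci γ α q₁ X Y p).select (N + 1) ω (X (N + 1) ω)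
    · rw [if_pos h, Finset.sum_Ico_succ_top h1, SelectiveClassifier.reward,
        indicator_of_mem (by exact h)]
      simp
    · rw [if_neg h, SelectiveClassifier.reward, indicator_of_notMem (by exact h)]
      simp

/-- Below zero a selection is certain, because scores are nonnegative, and the reaction is 1. From
zero on, the reaction minus α is 1 - α - 1{correct}. -/
theorem increment_eq (hp : ∀ t, 1 ≤ t → ∀ ω x y, p t ω x y ∈ Icc (0 : ℝ) 1) {t : ℕ} (ht : 1 ≤ t)
    (ω : Ω) : increment γ α q₁ X Y p t ω =
      (Ici 0).indicator 1 (threshold γ α q₁ X Y p t ω) *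
          (sci γ α q₁ X Y p).reward X Y (1 - α) (-1) t ω +
        (Iio 0).indicator 1 (threshold γ α q₁ X Y p t ω) * (1 - α) := by
  rw [increment, SelectiveClassifier.reward]
  set S := {ω | (sci γ α q₁ X Y p).select t ω (X t ω)}
  by_cases hq : threshold γ α q₁ X Y p t ω < 0
  · have hm := maxScore_mem_Icc (hp t ht ω (X t ω))
    have hs : ω ∈ S := lt_of_lt_of_le hq hm.1
    rw [indicator_of_mem hs, react, if_pos (Or.inl hq)]
    simp [hq]
  · have h0 : 0 ≤ threshold γ α q₁ X Y p t ω := not_lt.1 hq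
    by_cases hs : ω ∈ S
    · rw [indicator_of_mem hs, indicator_of_mem hs, react]
      by_cases he : Y t ω = argmaxLabel (p t ω (X t ω))
      · have he' : Y t ω = (sci γ α q₁ X Y p).predict t ω (X t ω) := he
        rw [if_neg (by tauto)]
        simp only [mem_Ici, h0, indicator_of_mem, Pi.one_apply, mem_Iio, hq, not_false_eq_true,
          indicator_of_notMem, mem_ofPred_eq, he']
        ring
      · have he' : ¬ Y t ω = (sci γ α q₁ X Y p).predict t ω (X t ω) := he
        rw [if_pos (Or.inr he)]
        simp [h0, hq, he']
    · rw [indicator_of_notMem hs, indicator_of_notMem hs]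
      simp [hq]

/-- Keeping the selection indicator, instead of the bound 1, is what makes the squared steps
summable without any lower bound on J. -/
theorem increment_sq_le (hα : α ∈ Ioo (0 : ℝ) 1) (t : ℕ) (ω : Ω) :
    increment γ α q₁ X Y p t ω ^ 2 ≤ (sci γ α q₁ X Y p).reward X Y 1 0 t ω := by
  by_cases hs : (sci γ α q₁ X Y p).select t ω (X t ω)
  · rw [SelectiveClassifier.reward, indicator_of_mem (by exact hs)]
    have := abs_increment_le (γ := γ) (q₁ := q₁) (X := X) (Y := Y) (p := p) hα t ω
    simpa using this
  · rw [SelectiveClassifier.reward, indicator_of_notMem (by exact hs), increment,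
      indicator_of_notMem (by exact hs)]
    simp

section Measurability

variable {D₀ : Ω → Fin n → Feature d × Fin K}

theorem IsOnlineEstimator.measurable_comp (hp : IsOnlineEstimator (past D₀ X Y) p) {t : ℕ}
    (ht : 1 ≤ t) (y : Fin K) : Measurable[past D₀ X Y t] fun ω => p t ω (X t ω) y := by
  have hle : past D₀ X Y (t - 1) ≤ past D₀ X Y t := past_mono (Nat.sub_le t 1)
  have hX : Measurable[past D₀ X Y t] (X t) :=
    measurable_fst.comp (measurable_pair_past (D₀ := D₀) (X := X) (Y := Y) ht le_rfl)
  have hpair : @Measurable Ω (Ω × Feature d) (past D₀ X Y t)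
      ((past D₀ X Y (t - 1)).prod inferInstance) fun ω => (ω, X t ω) :=
    @Measurable.prodMk _ (past D₀ X Y t) _ _ (past D₀ X Y (t - 1)) _ _ _ (measurable_id'' hle) hX
  exact (hp.measurable t ht y).comp hpair

theorem IsOnlineEstimator.measurable_state (hp : IsOnlineEstimator (past D₀ X Y) p) {t : ℕ}
    (ht : 1 ≤ t) : Measurable[past D₀ X Y (t - 1)] (threshold γ α q₁ X Y p t) ∧
      Measurable[past D₀ X Y (t - 1)] (stepIndex γ α q₁ X Y p t) := by
  classical
  induction t, ht using Nat.le_induction with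
  | base => exact ⟨measurable_const, measurable_const⟩
  | succ t ht ih =>
    have hle : past D₀ X Y (t - 1) ≤ past D₀ X Y t := past_mono (Nat.sub_le t 1)
    have hY : Measurable[past D₀ X Y t] (Y t) :=
      measurable_snd.comp (measurable_pair_past (D₀ := D₀) (X := X) (Y := Y) ht le_rfl)
    have hq := ih.1.mono hle le_rfl
    have hJ := ih.2.mono hle le_rfl
    have hpt := hp.measurable_comp ht
    rw [Nat.add_sub_cancel]
    let := past D₀ X Y t
    have hS : MeasurableSet {ω | (sci γ α q₁ X Y p).select t ω (X t ω)} :=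
      measurableSet_lt hq (measurable_maxScore hpt)
    have he : MeasurableSet {ω | threshold γ α q₁ X Y p t ω < 0 ∨
        Y t ω ≠ argmaxLabel (p t ω (X t ω))} :=
      (measurableSet_lt hq measurable_const).union
        (measurableSet_eq_fun hY (measurable_argmaxLabel hpt)).compl
    constructor
    · have : threshold γ α q₁ X Y p (t + 1) = fun ω => threshold γ α q₁ X Y p t ω +
          γ (stepIndex γ α q₁ X Y p t ω) * increment γ α q₁ X Y p t ω :=
        funext fun ω => threshold_succ ht ω
      rw [this]
      refine hq.add (((measurable_from_top (f := γ)).comp hJ).mul ?_)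
      refine Measurable.indicator (Measurable.sub ?_ measurable_const) hS
      unfold react
      exact Measurable.ite he measurable_const measurable_const
    · have : stepIndex γ α q₁ X Y p (t + 1) = fun ω => stepIndex γ α q₁ X Y p t ω +
          if (sci γ α q₁ X Y p).select t ω (X t ω) then 1 else 0 :=
        funext fun ω => stepIndex_succ ht ω
      rw [this]
      exact hJ.add (Measurable.ite hS measurable_const measurable_const)

theorem IsOnlineEstimator.sci_isOnline (hp : IsOnlineEstimator (past D₀ X Y) p) :
    (sci γ α q₁ X Y p).IsOnline (past D₀ X Y) where
  select t ht := by
    have hq := (hp.measurable_state (γ := γ) (α := α) (q₁ := q₁) ht).1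
    have hpt := hp.measurable t ht
    let := past D₀ X Y (t - 1)
    exact measurableSet_lt (hq.comp measurable_fst) (measurable_maxScore hpt)
  predict t ht := by
    have hpt := hp.measurable t ht
    let := past D₀ X Y (t - 1)
    exact measurable_argmaxLabel hpt

theorem oracle_isOnline (μ : Measure (Feature d × Fin K)) [IsProbabilityMeasure μ] (q₀ : ℝ) :
    (oracle Ω μ q₀).IsOnline (past D₀ X Y) where
  select t _ := by
    let := past D₀ X Y (t - 1)
    exact measurableSet_lt measurable_const ((measurable_topProb μ).comp measurable_snd)
  predict t _ := by
    let := past D₀ X Y (t - 1)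
    exact measurable_argmaxLabel fun y => (measurable_classProb μ y).comp measurable_snd

end Measurability

end Dynamics

/-! ### The conditional mean increment of the threshold. -/

section Drift

variable {Ω : Type*} {d K n : ℕ} [NeZero K] [MeasurableSpace Ω]

/-- The standing assumptions on a run of online selective classification. -/
structure IsRun (P : Measure Ω) (μ : Measure (Feature d × Fin K))
    (D₀ : Ω → Fin n → Feature d × Fin K) (X : ℕ → Ω → Feature d) (Y : ℕ → Ω → Fin K)
    (p : ℕ → Ω → Feature d → Fin K → ℝ) (γ : ℕ → ℝ) (α q₁ : ℝ) : Prop where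
  model : IIDModel P μ D₀ X Y
  estimator : IsOnlineEstimator (past D₀ X Y) p
  level_mem : α ∈ Ioo (0 : ℝ) 1
  start_mem : q₁ ∈ Icc 0 (1 - α)
  step_nonneg : ∀ j, 0 ≤ γ j
  step_anti : ∀ i j, 1 ≤ i → i ≤ j → γ j ≤ γ i

/-- The mean increment of the threshold at time `t` given the past. -/
noncomputable def drift (μ : Measure (Feature d × Fin K)) [IsProbabilityMeasure μ] (γ : ℕ → ℝ)
    (α q₁ : ℝ) (X : ℕ → Ω → Feature d) (Y : ℕ → Ω → Fin K)
    (p : ℕ → Ω → Feature d → Fin K → ℝ) (t : ℕ) (ω : Ω) : ℝ :=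
  (Ici 0).indicator 1 (threshold γ α q₁ X Y p t ω) * (sci γ α q₁ X Y p).gain μ (1 - α) (-1) t ω +
    (Iio 0).indicator 1 (threshold γ α q₁ X Y p t ω) * (1 - α)

variable {P : Measure Ω} [IsProbabilityMeasure P] {μ : Measure (Feature d × Fin K)}
  [IsProbabilityMeasure μ] {D₀ : Ω → Fin n → Feature d × Fin K} {X : ℕ → Ω → Feature d}
  {Y : ℕ → Ω → Fin K} {p : ℕ → Ω → Feature d → Fin K → ℝ} {γ : ℕ → ℝ} {α q₁ : ℝ}

local notation "𝔮" => threshold γ α q₁ X Y p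
local notation "𝔍" => stepIndex γ α q₁ X Y p
local notation "𝔯" => sci γ α q₁ X Y p
local notation "𝔡" => drift μ γ α q₁ X Y p
local notation "𝔦" => increment γ α q₁ X Y p
local notation "ℙ" => past D₀ X Y

theorem drift_of_neg {t : ℕ} {ω : Ω} (h : 𝔮 t ω < 0) : 𝔡 t ω = 1 - α := by
  simp [drift, h]

theorem drift_of_nonneg {t : ℕ} {ω : Ω} (h : 0 ≤ 𝔮 t ω) :
    𝔡 t ω = (𝔯).gain μ (1 - α) (-1) t ω := by
  simp [drift, h]

namespace IsRun

theorem abs_one_sub_level_le (hr : IsRun P μ D₀ X Y p γ α q₁) : |1 - α| ≤ 1 :=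
  abs_le.2 ⟨by linarith [hr.level_mem.2], by linarith [hr.level_mem.1]⟩

theorem abs_one_sub_level_add_le (hr : IsRun P μ D₀ X Y p γ α q₁) : |1 - α + -1| ≤ 1 :=
  abs_le.2 ⟨by linarith [hr.level_mem.2], by linarith [hr.level_mem.1]⟩

theorem abs_drift_le (hr : IsRun P μ D₀ X Y p γ α q₁) (t : ℕ) (ω : Ω) : |𝔡 t ω| ≤ 1 := by
  rcases lt_or_ge (𝔮 t ω) 0 with h | h
  · rw [drift_of_neg h]
    exact hr.abs_one_sub_level_le
  · rw [drift_of_nonneg h]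
    exact abs_ruleGain_le hr.abs_one_sub_level_le hr.abs_one_sub_level_add_le _ _

theorem measurable_threshold (hr : IsRun P μ D₀ X Y p γ α q₁) {t : ℕ} (ht : 1 ≤ t) :
    Measurable[ℙ (t - 1)] (𝔮 t) :=
  (hr.estimator.measurable_state ht).1

theorem measurable_step (hr : IsRun P μ D₀ X Y p γ α q₁) {t : ℕ} (ht : 1 ≤ t) (f : ℕ → ℝ) :
    Measurable[ℙ (t - 1)] fun ω => f (𝔍 t ω) :=
  (measurable_from_top (f := f)).comp (hr.estimator.measurable_state ht).2

theorem measurable_gain (hr : IsRun P μ D₀ X Y p γ α q₁) (a b : ℝ) {t : ℕ} (ht : 1 ≤ t) :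
    Measurable[ℙ (t - 1)] ((𝔯).gain μ a b t) :=
  hr.estimator.sci_isOnline.measurable_gain a b ht

theorem measurable_drift (hr : IsRun P μ D₀ X Y p γ α q₁) {t : ℕ} (ht : 1 ≤ t) :
    Measurable[ℙ (t - 1)] (𝔡 t) := by
  have hq := hr.measurable_threshold ht
  have hg := hr.measurable_gain (1 - α) (-1) ht
  exact (((measurable_one.indicator measurableSet_Ici).comp hq).mul hg).add
    (((measurable_one.indicator measurableSet_Iio).comp hq).mul measurable_const)

theorem measurable_meanError (hr : IsRun P μ D₀ X Y p γ α q₁) {t : ℕ} (ht : 1 ≤ t) :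
    Measurable[ℙ (t - 1)] (meanError μ p t) := by
  have hpm := hr.estimator.measurable t ht
  let := past D₀ X Y (t - 1)
  exact measurable_integral_freeze (ν := μ.fst)
    (f := fun z => maxScore fun y => |p t z.1 z.2 y - classProb μ z.2 y|)
    (measurable_maxScore fun y =>
      ((hpm y).sub ((measurable_classProb μ y).comp measurable_snd)).abs)

theorem integrable_past (hr : IsRun P μ D₀ X Y p γ α q₁) {t : ℕ} {f : Ω → ℝ}
    (hf : Measurable[ℙ t] f) {C : ℝ} (hC : ∀ ω, |f ω| ≤ C) : Integrable f P :=
  integrable_of_measurable_of_bound (hf.mono (hr.model.past_le t) le_rfl) hC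

theorem measurable_reward (hr : IsRun P μ D₀ X Y p γ α q₁) (a b : ℝ) {t : ℕ} (ht : 1 ≤ t) :
    Measurable[ℙ t] ((𝔯).reward X Y a b t) := by
  have hle : past D₀ X Y (t - 1) ≤ past D₀ X Y t := past_mono (Nat.sub_le t 1)
  have hq := (hr.measurable_threshold ht).mono hle le_rfl
  have hY : Measurable[past D₀ X Y t] (Y t) :=
    measurable_snd.comp (measurable_pair_past (D₀ := D₀) (X := X) (Y := Y) ht le_rfl)
  have hpt := hr.estimator.measurable_comp ht
  let := past D₀ X Y t
  refine Measurable.indicator ?_ (measurableSet_lt hq (measurable_maxScore hpt))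
  exact measurable_const.add (measurable_const.mul (measurable_one.indicator
    (measurableSet_eq_fun hY (measurable_argmaxLabel hpt))))

theorem measurable_increment (hr : IsRun P μ D₀ X Y p γ α q₁) {t : ℕ} (ht : 1 ≤ t) :
    Measurable[ℙ t] (𝔦 t) := by
  have hle : past D₀ X Y (t - 1) ≤ past D₀ X Y t := past_mono (Nat.sub_le t 1)
  have hq := (hr.measurable_threshold ht).mono hle le_rfl
  have hg := hr.measurable_reward (1 - α) (-1) ht
  have : 𝔦 t = _ := funext fun ω => increment_eq hr.estimator.mem_Icc ht ω
  rw [this]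
  exact (((measurable_one.indicator measurableSet_Ici).comp hq).mul hg).add
    (((measurable_one.indicator measurableSet_Iio).comp hq).mul measurable_const)

/-- By `increment_eq` the increment is a reward on nonnegative thresholds and already known from the
past on negative ones. The sign of the threshold is absorbed into the weight, and only the first
part is averaged. -/
theorem integral_mul_increment (hr : IsRun P μ D₀ X Y p γ α q₁) {t : ℕ} (ht : 1 ≤ t)
    {w : Ω → ℝ} (hw : Measurable[ℙ (t - 1)] w) {C : ℝ} (hC : ∀ ω, |w ω| ≤ C) :
    ∫ ω, w ω * 𝔦 t ω ∂P = ∫ ω, w ω * 𝔡 t ω ∂P := by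
  have hle : past D₀ X Y (t - 1) ≤ past D₀ X Y t := past_mono (Nat.sub_le t 1)
  have hq := hr.measurable_threshold ht
  set w1 : Ω → ℝ := fun ω => w ω * (Ici 0).indicator 1 (𝔮 t ω) with hw1
  set w2 : Ω → ℝ := fun ω => w ω * ((Iio 0).indicator 1 (𝔮 t ω) * (1 - α)) with hw2
  have hw1m : Measurable[ℙ (t - 1)] w1 :=
    hw.mul ((measurable_one.indicator measurableSet_Ici).comp hq)
  have hw2m : Measurable[ℙ (t - 1)] w2 :=
    hw.mul (((measurable_one.indicator measurableSet_Iio).comp hq).mul measurable_const)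
  have hw1C : ∀ ω, |w1 ω| ≤ C := fun ω => by
    rw [hw1, abs_mul]
    exact (mul_le_of_le_one_right (abs_nonneg _) (abs_indicator_le _ (by simp))).trans (hC ω)
  have hw2C : ∀ ω, |w2 ω| ≤ C := fun ω => by
    rw [hw2, abs_mul, abs_mul]
    exact (mul_le_of_le_one_right (abs_nonneg _) (mul_le_one₀ (abs_indicator_le _ (by simp))
      (abs_nonneg _) hr.abs_one_sub_level_le)).trans (hC ω)
  have hrew := (𝔯).abs_reward_le X Y hr.abs_one_sub_level_le hr.abs_one_sub_level_add_le t
  have hgain : ∀ ω, |(𝔯).gain μ (1 - α) (-1) t ω| ≤ 1 := fun ω =>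
    abs_ruleGain_le hr.abs_one_sub_level_le hr.abs_one_sub_level_add_le _ _
  have hi1 : Integrable (fun ω => w1 ω * (𝔯).reward X Y (1 - α) (-1) t ω) P :=
    hr.integrable_past (t := t) (C := C) ((hw1m.mono hle le_rfl).mul
      (hr.measurable_reward _ _ ht)) fun ω => by
      rw [abs_mul]
      exact (mul_le_of_le_one_right (abs_nonneg _) (hrew ω)).trans (hw1C ω)
  have hi2 : Integrable (fun ω => w1 ω * (𝔯).gain μ (1 - α) (-1) t ω) P :=
    hr.integrable_past (t := t - 1) (C := C) (hw1m.mul (hr.measurable_gain _ _ ht)) fun ω => by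
      rw [abs_mul]
      exact (mul_le_of_le_one_right (abs_nonneg _) (hgain ω)).trans (hw1C ω)
  have hi3 : Integrable w2 P := hr.integrable_past hw2m hw2C
  calc ∫ ω, w ω * 𝔦 t ω ∂P
      = ∫ ω, w1 ω * (𝔯).reward X Y (1 - α) (-1) t ω + w2 ω ∂P := by
        refine integral_congr_ae (ae_of_all _ fun ω => ?_)
        dsimp only [w1, w2]
        rw [increment_eq hr.estimator.mem_Icc ht]
        ring
    _ = ∫ ω, w1 ω * (𝔯).gain μ (1 - α) (-1) t ω + w2 ω ∂P := by
        rw [integral_add hi1 hi3, integral_add hi2 hi3,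
          hr.estimator.sci_isOnline.integral_mul_reward hr.model hr.abs_one_sub_level_le
            hr.abs_one_sub_level_add_le ht hw1m hw1C]
    _ = ∫ ω, w ω * 𝔡 t ω ∂P := by
        refine integral_congr_ae (ae_of_all _ fun ω => ?_)
        dsimp only [w1, w2, drift]
        ring

theorem abs_gain_sub_le (hr : IsRun P μ D₀ X Y p γ α q₁) {L : ℝ}
    (hL : ∀ u v, u ≤ v → μ.fst.real {x | topProb μ x ∈ Icc u v} ≤ L * (v - u))
    {a b : ℝ} (h0 : |a| ≤ 1) (h1 : |a + b| ≤ 1) (hb : |b| ≤ 1) {t : ℕ} (ht : 1 ≤ t) {ω : Ω}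
    {η : ℝ} (hη : 0 < η) (hη1 : η ≤ 1) (hD : meanError μ p t ω ≤ η) :
    |(𝔯).gain μ a b t ω - levelGain μ a b (𝔮 t ω)| ≤ (2 * L + 3) * √η :=
  abs_ruleGain_sub_levelGain_le hL (p := p t ω)
    (fun y => measurable_section (m := past D₀ X Y (t - 1)) (hr.estimator.measurable t ht y) ω)
    (hr.estimator.mem_Icc t ht ω) h0 h1 hb _ hη hη1 hD

theorem step_le (hr : IsRun P μ D₀ X Y p γ α q₁) {t : ℕ} (ht : 1 ≤ t) (ω : Ω) :
    γ (𝔍 t ω) ≤ γ 1 := hr.step_anti _ _ le_rfl (one_le_stepIndex ht ω)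

theorem le_step (hr : IsRun P μ D₀ X Y p γ α q₁) {t : ℕ} (ht : 1 ≤ t) (ω : Ω) :
    γ t ≤ γ (𝔍 t ω) := hr.step_anti _ _ (one_le_stepIndex ht ω) (stepIndex_le ht ω)

theorem abs_step_le (hr : IsRun P μ D₀ X Y p γ α q₁) {t : ℕ} (ht : 1 ≤ t) (ω : Ω) :
    |γ (𝔍 t ω)| ≤ γ 1 := by
  rw [abs_of_nonneg (hr.step_nonneg _)]
  exact hr.step_le ht ω

theorem threshold_mem (hr : IsRun P μ D₀ X Y p γ α q₁) {t : ℕ} (ht : 1 ≤ t) (ω : Ω) :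
    𝔮 t ω ∈ Icc (-γ 1) (1 + γ 1) :=
  threshold_mem_Icc (hr.step_nonneg 1) hr.step_nonneg (fun j hj => hr.step_anti 1 j le_rfl hj)
    hr.level_mem hr.start_mem hr.estimator.mem_Icc ht ω

end IsRun

end Drift

/-! ### Mean-square recursions for the threshold and growth of the step index. -/

section Recursion

variable {Ω : Type*} {d K n : ℕ} [NeZero K] [MeasurableSpace Ω]
  {P : Measure Ω} [IsProbabilityMeasure P] {μ : Measure (Feature d × Fin K)}
  [IsProbabilityMeasure μ] {D₀ : Ω → Fin n → Feature d × Fin K} {X : ℕ → Ω → Feature d}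
  {Y : ℕ → Ω → Fin K} {p : ℕ → Ω → Feature d → Fin K → ℝ} {γ : ℕ → ℝ} {α q₁ : ℝ}

local notation "𝔮" => threshold γ α q₁ X Y p
local notation "𝔍" => stepIndex γ α q₁ X Y p
local notation "𝔯" => sci γ α q₁ X Y p
local notation "𝔡" => drift μ γ α q₁ X Y p
local notation "𝔦" => increment γ α q₁ X Y p
local notation "ℙ" => past D₀ X Y

theorem measurable_indicator_one {α : Type*} {m : MeasurableSpace α} {A : Set α}
    (hA : MeasurableSet[m] A) : Measurable[m] (A.indicator (1 : α → ℝ)) :=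
  measurable_one.indicator hA

theorem max_sub_sq_le (y Δ : ℝ) : max (y - Δ) 0 ^ 2 ≤ max y 0 ^ 2 - 2 * max y 0 * Δ + Δ ^ 2 := by
  have h : max (y - Δ) 0 ^ 2 ≤ (max y 0 - Δ) ^ 2 := by
    rw [sq_le_sq, abs_of_nonneg (le_max_right _ _)]
    exact max_le ((sub_le_sub_right (le_max_left y 0) Δ).trans (le_abs_self _)) (abs_nonneg _)
  linarith [h, sq_nonneg Δ, sub_sq (max y 0) Δ]

theorem reward_one_zero_eq (t : ℕ) (ω : Ω) :
    (𝔯).reward X Y 1 0 t ω = {ω | (𝔯).select t ω (X t ω)}.indicator 1 ω := by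
  simp [SelectiveClassifier.reward, indicator]

theorem reward_one_zero_nonneg (t : ℕ) (ω : Ω) : 0 ≤ (𝔯).reward X Y 1 0 t ω := by
  rw [reward_one_zero_eq]
  exact indicator_nonneg (by simp) _

namespace IsRun

/-- The bound by the sum of all squared steps holds along each trajectory, so it survives taking
means. -/
theorem summable_integral_sq_step (hr : IsRun P μ D₀ X Y p γ α q₁)
    (hγ2 : Summable fun j => γ j ^ 2) :
    Summable fun t => ∫ ω, γ (𝔍 t ω) ^ 2 * (𝔯).reward X Y 1 0 t ω ∂P := by
  rw [← summable_nat_add_iff 1]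
  have hnn : ∀ t ω, 0 ≤ γ (𝔍 t ω) ^ 2 * (𝔯).reward X Y 1 0 t ω := fun t ω =>
    mul_nonneg (sq_nonneg _) (reward_one_zero_nonneg t ω)
  have hint : ∀ t, Integrable (fun ω => γ (𝔍 (t + 1) ω) ^ 2 *
      (𝔯).reward X Y 1 0 (t + 1) ω) P := fun t => by
    have hle : past D₀ X Y t ≤ past D₀ X Y (t + 1) := past_mono (Nat.le_succ t)
    refine hr.integrable_past (t := t + 1) (C := γ 1 ^ 2 * 1)
      (((hr.measurable_step (t := t + 1) (by omega) fun j => γ j ^ 2).mono hle le_rfl).mul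
        (hr.measurable_reward 1 0 (by omega))) fun ω => ?_
    rw [abs_mul, abs_of_nonneg (sq_nonneg _)]
    exact mul_le_mul (pow_le_pow_left₀ (hr.step_nonneg _) (hr.step_le (by omega) ω) 2)
      ((𝔯).abs_reward_le X Y (by simp) (by simp) _ ω) (abs_nonneg _) (sq_nonneg _)
  refine summable_of_sum_range_le (c := ∑' j, γ j ^ 2)
    (fun t => integral_nonneg fun ω => hnn _ ω) fun N => ?_
  rw [← integral_finsetSum _ fun t _ => hint t]
  have hb : ∀ ω, ∑ t ∈ Finset.range N, γ (𝔍 (t + 1) ω) ^ 2 * (𝔯).reward X Y 1 0 (t + 1) ω ≤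
      ∑' j, γ j ^ 2 := fun ω => by
    rw [sum_sq_step ω]
    exact hγ2.sum_le_tsum _ fun j _ => sq_nonneg _
  refine (integral_mono (integrable_finsetSum _ fun t _ => hint t) (integrable_const _)
    hb).trans ?_
  simp

/-- The threshold cannot stay below a level under which its drift is bounded away from zero. -/
theorem tendsto_integral_max_sub_sq (hr : IsRun P μ D₀ X Y p γ α q₁) (hγs : ¬ Summable γ)
    (hγ2 : Summable fun j => γ j ^ 2) {r k : ℝ} (hk : 0 < k) {B : ℕ → Set Ω} {N : ℕ}
    (hB : ∀ t ≥ N, MeasurableSet[ℙ (t - 1)] (B t))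
    (hBs : Summable fun t => P.real (B t)ᶜ)
    (hdrift : ∀ t ≥ N, ∀ ω ∈ B t, 𝔮 t ω < r → k ≤ 𝔡 t ω) :
    Tendsto (fun t => ∫ ω, max (r - 𝔮 t ω) 0 ^ 2 ∂P) atTop (𝓝 0) := by
  set M : ℝ := |r| + 1 + γ 1 with hM
  have hM0 : 0 < M := by
    have := hr.step_nonneg 1
    positivity
  have hyM : ∀ t, 1 ≤ t → ∀ ω, max (r - 𝔮 t ω) 0 ≤ M := fun t ht ω =>
    max_le (by linarith [(hr.threshold_mem ht ω).1, le_abs_self r]) hM0.le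
  -- The drift gives a decrease linear in the shortfall y; as y ≤ M, it is at least y²/M, which
  -- closes the recursion for y². The perturbation collects the failures of B and the squared steps.
  refine tendsto_zero_of_recursion (γ := γ) (a := 2 * k / M) (N := max N 1)
    (b := fun t => (2 + 2 * k) * γ 1 * M * P.real (B t)ᶜ +
      ∫ ω, γ (𝔍 t ω) ^ 2 * (𝔯).reward X Y 1 0 t ω ∂P) (by positivity)
    (fun t => integral_nonneg fun ω => sq_nonneg _) hr.step_nonneg hγs
    (fun t => add_nonneg (by have := hr.step_nonneg 1; positivity)
      (integral_nonneg fun ω => mul_nonneg (sq_nonneg _) (reward_one_zero_nonneg t ω)))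
    ((hBs.mul_left _).add (hr.summable_integral_sq_step hγ2)) fun t ht => ?_
  have ht1 : 1 ≤ t := (le_max_right _ _).trans ht
  have htN : N ≤ t := (le_max_left _ _).trans ht
  have hle : past D₀ X Y (t - 1) ≤ past D₀ X Y t := past_mono (Nat.sub_le t 1)
  have hq := hr.measurable_threshold ht1
  have hJ := hr.measurable_step ht1 γ
  have hBm := hB t htN
  have hBm' : MeasurableSet (B t) := hr.model.past_le _ _ hBm
  set y : Ω → ℝ := fun ω => max (r - 𝔮 t ω) 0 with hy
  have hy0 : ∀ ω, 0 ≤ y ω := fun ω => le_max_right _ _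
  have hym : Measurable[ℙ (t - 1)] y := (measurable_const.sub hq).max measurable_const
  have hyC : ∀ ω, |y ω| ≤ M := fun ω => by
    rw [abs_of_nonneg (hy0 ω)]
    exact hyM t ht1 ω
  have hwm : Measurable[ℙ (t - 1)] fun ω => γ (𝔍 t ω) * y ω := hJ.mul hym
  have hwC : ∀ ω, |γ (𝔍 t ω) * y ω| ≤ γ 1 * M := fun ω => by
    rw [abs_mul]
    exact mul_le_mul (hr.abs_step_le ht1 ω) (hyC ω) (abs_nonneg _) (hr.step_nonneg 1)
  have hw0 : ∀ ω, 0 ≤ γ (𝔍 t ω) * y ω := fun ω => mul_nonneg (hr.step_nonneg _) (hy0 ω)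
  have hinc := abs_increment_le (γ := γ) (q₁ := q₁) (X := X) (Y := Y) (p := p) hr.level_mem t
  have i1 : Integrable (fun ω => y ω ^ 2) P :=
    hr.integrable_past (C := M ^ 2) (hym.pow_const 2) fun ω => by
      rw [abs_pow]
      exact pow_le_pow_left₀ (abs_nonneg _) (hyC ω) 2
  have i2 : Integrable (fun ω => γ (𝔍 t ω) * y ω * 𝔦 t ω) P :=
    hr.integrable_past (t := t) (C := γ 1 * M * 1) ((hwm.mono hle le_rfl).mul
      (hr.measurable_increment ht1)) fun ω => by
        rw [abs_mul]
        exact mul_le_mul (hwC ω) (hinc ω) (abs_nonneg _) ((abs_nonneg _).trans (hwC ω))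
  have i3 : Integrable (fun ω => γ (𝔍 t ω) ^ 2 * (𝔯).reward X Y 1 0 t ω) P :=
    hr.integrable_past (t := t) (C := γ 1 ^ 2 * 1) (((hJ.pow_const 2).mono hle le_rfl).mul
      (hr.measurable_reward 1 0 ht1)) fun ω => by
        rw [abs_mul, abs_pow]
        exact mul_le_mul (pow_le_pow_left₀ (abs_nonneg _) (hr.abs_step_le ht1 ω) 2)
          ((𝔯).abs_reward_le X Y (by simp) (by simp) _ ω) (abs_nonneg _) (sq_nonneg _)
  have i4 : Integrable (fun ω => γ (𝔍 t ω) * y ω * 𝔡 t ω) P :=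
    hr.integrable_past (t := t - 1) (C := γ 1 * M * 1) (hwm.mul (hr.measurable_drift ht1))
      fun ω => by
        rw [abs_mul]
        exact mul_le_mul (hwC ω) (hr.abs_drift_le t ω) (abs_nonneg _)
          ((abs_nonneg _).trans (hwC ω))
  have i5 : Integrable ((B t)ᶜ.indicator (1 : Ω → ℝ)) P :=
    (integrable_const (1 : ℝ)).indicator hBm'.compl
  have i0 : Integrable (fun ω => max (r - 𝔮 (t + 1) ω) 0 ^ 2) P :=
    hr.integrable_past (t := t) (C := M ^ 2) (((measurable_const.sub
      (hr.measurable_threshold (t := t + 1) (by omega))).max measurable_const).pow_const 2)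
      fun ω => by
        rw [abs_pow, abs_of_nonneg (le_max_right _ _)]
        exact pow_le_pow_left₀ (le_max_right _ _) (hyM _ (by omega) ω) 2
  have hstep : ∀ ω, max (r - 𝔮 (t + 1) ω) 0 ^ 2 ≤ y ω ^ 2 - 2 * (γ (𝔍 t ω) * y ω * 𝔦 t ω) +
      γ (𝔍 t ω) ^ 2 * (𝔯).reward X Y 1 0 t ω := fun ω => by
    have h1 := max_sub_sq_le (r - 𝔮 t ω) (γ (𝔍 t ω) * 𝔦 t ω)
    have h2 := mul_le_mul_of_nonneg_left (increment_sq_le (γ := γ) (q₁ := q₁) (X := X) (Y := Y)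
      (p := p) hr.level_mem t ω) (sq_nonneg (γ (𝔍 t ω)))
    rw [threshold_succ ht1, ← sub_sub]
    dsimp only [y]
    linarith
  -- Replacing the random step by γ t is legitimate because J ≤ t and the steps decrease. Off B, the
  -- 2 in 2 + 2k pays for a drift of size up to 1 and the 2k for the contraction claimed there too.
  have hdr : ∀ ω, -2 * (γ (𝔍 t ω) * y ω * 𝔡 t ω) ≤ -(2 * k / M * γ t) * y ω ^ 2 +
      (2 + 2 * k) * γ 1 * M * (B t)ᶜ.indicator 1 ω := fun ω => by
    have hyy : 2 * k / M * γ t * y ω ^ 2 ≤ 2 * k * (γ (𝔍 t ω) * y ω) := by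
      have h1 : γ t * (y ω / M * y ω) ≤ γ (𝔍 t ω) * (1 * y ω) :=
        mul_le_mul (hr.le_step ht1 ω) (mul_le_mul_of_nonneg_right
          ((div_le_one hM0).2 (hyM t ht1 ω)) (hy0 ω))
          (mul_nonneg (div_nonneg (hy0 ω) hM0.le) (hy0 ω)) (hr.step_nonneg _)
      calc 2 * k / M * γ t * y ω ^ 2 = 2 * k * (γ t * (y ω / M * y ω)) := by ring
        _ ≤ 2 * k * (γ (𝔍 t ω) * (1 * y ω)) := mul_le_mul_of_nonneg_left h1 (by positivity)
        _ = _ := by ring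
    by_cases hω : ω ∈ B t
    · rw [indicator_of_notMem (by simpa using hω)]
      have : k * (γ (𝔍 t ω) * y ω) ≤ γ (𝔍 t ω) * y ω * 𝔡 t ω := by
        by_cases hlt : 𝔮 t ω < r
        · have := mul_le_mul_of_nonneg_left (hdrift t htN ω hω hlt) (hw0 ω)
          linarith
        · have : y ω = 0 := max_eq_right (by linarith [not_lt.1 hlt])
          simp [this]
      linarith
    · rw [indicator_of_mem (by simpa using hω)]
      have h1 := mul_le_mul_of_nonneg_left (abs_le.1 (hr.abs_drift_le t ω)).1 (hw0 ω)
      have h2 := (le_abs_self _).trans (hwC ω)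
      have h3 := mul_le_mul_of_nonneg_left h2 (by positivity : 0 ≤ 2 + 2 * k)
      simp only [Pi.one_apply, mul_one]
      linarith
  have e1 : ∫ ω, max (r - 𝔮 (t + 1) ω) 0 ^ 2 ∂P ≤ ∫ ω, y ω ^ 2 ∂P -
      2 * ∫ ω, γ (𝔍 t ω) * y ω * 𝔦 t ω ∂P +
      ∫ ω, γ (𝔍 t ω) ^ 2 * (𝔯).reward X Y 1 0 t ω ∂P := by
    have i12 : Integrable (fun ω => y ω ^ 2 - 2 * (γ (𝔍 t ω) * y ω * 𝔦 t ω)) P :=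
      i1.sub (i2.const_mul 2)
    rw [← integral_const_mul, ← integral_sub i1 (i2.const_mul 2), ← integral_add i12 i3]
    exact integral_mono i0 (i12.add i3) hstep
  have e2 : -2 * ∫ ω, γ (𝔍 t ω) * y ω * 𝔡 t ω ∂P ≤ -(2 * k / M * γ t) * ∫ ω, y ω ^ 2 ∂P +
      (2 + 2 * k) * γ 1 * M * P.real (B t)ᶜ := by
    rw [← integral_const_mul, ← integral_const_mul, ← integral_indicator_one hBm'.compl,
      ← integral_const_mul, ← integral_add (i1.const_mul _) (i5.const_mul _)]
    exact integral_mono (i4.const_mul _) ((i1.const_mul _).add (i5.const_mul _)) hdr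
  rw [hr.integral_mul_increment ht1 hwm hwC] at e1
  linarith

/-- On events where selection has probability at least `s`, the step index grows linearly. -/
theorem integral_exp_neg_stepIndex_le (hr : IsRun P μ D₀ X Y p γ α q₁) {A : ℕ → Set Ω} {N : ℕ}
    (hN : 1 ≤ N) (hA : ∀ t ≥ N, MeasurableSet[ℙ (t - 1)] (A t))
    (hanti : ∀ t ≥ N, A (t + 1) ⊆ A t) {s : ℝ} (hs1 : s ≤ 1)
    (hsel : ∀ t ≥ N, ∀ ω ∈ A t, s ≤ (𝔯).gain μ 1 0 t ω) {t : ℕ} (ht : N ≤ t) :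
    ∫ ω, (A t).indicator 1 ω * Real.exp (-(𝔍 t ω : ℝ)) ∂P ≤
      (1 - (1 - Real.exp (-1)) * s) ^ (t - N) := by
  set ρ := 1 - Real.exp (-1) with hρ
  have hρ0 : 0 ≤ ρ := sub_nonneg.2 (Real.exp_le_one_iff.2 (by norm_num))
  have hρ1 : ρ ≤ 1 := by linarith [Real.exp_pos (-1)]
  have hρs : 0 ≤ 1 - ρ * s := by nlinarith
  have hw0 : ∀ t ω, 0 ≤ (A t).indicator 1 ω * Real.exp (-(𝔍 t ω : ℝ)) := fun t ω =>
    mul_nonneg (indicator_nonneg (by simp) _) (Real.exp_pos _).le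
  have hw1 : ∀ t ω, |(A t).indicator 1 ω * Real.exp (-(𝔍 t ω : ℝ))| ≤ 1 := fun t ω => by
    rw [abs_mul, abs_of_pos (Real.exp_pos _)]
    exact mul_le_one₀ (abs_indicator_le _ (by simp)) (Real.exp_pos _).le
      (Real.exp_le_one_iff.2 (by simp))
  have hwm : ∀ t ≥ N, Measurable[ℙ (t - 1)] fun ω =>
      (A t).indicator 1 ω * Real.exp (-(𝔍 t ω : ℝ)) := fun t ht =>
    (measurable_indicator_one (hA t ht)).mul
      (hr.measurable_step (hN.trans ht) fun j => Real.exp (-(j : ℝ)))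
  induction t, ht using Nat.le_induction with
  | base =>
    rw [Nat.sub_self, pow_zero]
    refine (integral_mono (hr.integrable_past (hwm N le_rfl) (hw1 N)) (integrable_const 1)
      fun ω => (le_abs_self _).trans (hw1 N ω)).trans ?_
    simp
  | succ t ht ih =>
    have ht1 : 1 ≤ t := hN.trans ht
    have hle : past D₀ X Y (t - 1) ≤ past D₀ X Y t := past_mono (Nat.sub_le t 1)
    set w : Ω → ℝ := fun ω => (A t).indicator 1 ω * Real.exp (-(𝔍 t ω : ℝ)) with hw
    have hrew : ∀ ω, |(𝔯).reward X Y 1 0 t ω| ≤ 1 :=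
      (𝔯).abs_reward_le X Y (by simp) (by simp) t
    have i1 : Integrable w P := hr.integrable_past (hwm t ht) (hw1 t)
    have i2 : Integrable (fun ω => w ω * (𝔯).reward X Y 1 0 t ω) P :=
      hr.integrable_past (t := t) (C := 1) (((hwm t ht).mono hle le_rfl).mul
        (hr.measurable_reward 1 0 ht1)) fun ω => by
          rw [abs_mul]
          exact mul_le_one₀ (hw1 t ω) (abs_nonneg _) (hrew ω)
    have i3 : Integrable (fun ω => w ω * (𝔯).gain μ 1 0 t ω) P :=
      hr.integrable_past (t := t - 1) (C := 1) ((hwm t ht).mul (hr.measurable_gain 1 0 ht1))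
        fun ω => by
          rw [abs_mul]
          exact mul_le_one₀ (hw1 t ω) (abs_nonneg _)
            (abs_ruleGain_le (by simp) (by simp) _ _)
    have hpt : ∀ ω, (A (t + 1)).indicator 1 ω * Real.exp (-(𝔍 (t + 1) ω : ℝ)) ≤
        w ω - ρ * (w ω * (𝔯).reward X Y 1 0 t ω) := fun ω => by
      have h1 : (A (t + 1)).indicator (1 : Ω → ℝ) ω ≤ (A t).indicator 1 ω :=
        indicator_le_indicator_of_subset (hanti t ht) (by simp) ω
      -- A selection multiplies exp(-J) by exp(-1) = 1 - ρ, so averaging yields a factor at most 1 -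
      -- ρs.
      have h2 : Real.exp (-(𝔍 (t + 1) ω : ℝ)) =
          Real.exp (-(𝔍 t ω : ℝ)) * (1 - ρ * (𝔯).reward X Y 1 0 t ω) := by
        rw [stepIndex_succ ht1, reward_one_zero_eq]
        by_cases hS : (𝔯).select t ω (X t ω)
        · rw [if_pos hS, indicator_of_mem (by exact hS)]
          push_cast
          rw [neg_add, Real.exp_add, hρ]
          simp
        · rw [if_neg hS, indicator_of_notMem (by exact hS)]
          simp
      calc _ ≤ (A t).indicator 1 ω * Real.exp (-(𝔍 (t + 1) ω : ℝ)) :=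
            mul_le_mul_of_nonneg_right h1 (Real.exp_pos _).le
        _ = _ := by
            rw [h2]
            dsimp only [w]
            ring
    have hgain : ∀ ω, s * w ω ≤ w ω * (𝔯).gain μ 1 0 t ω := fun ω => by
      by_cases hω : ω ∈ A t
      · have := mul_le_mul_of_nonneg_left (hsel t ht ω hω) (hw0 t ω)
        linarith
      · simp [w, hω]
    calc _ ≤ ∫ ω, (w ω - ρ * (w ω * (𝔯).reward X Y 1 0 t ω)) ∂P :=
          integral_mono (hr.integrable_past (hwm (t + 1) (by omega)) (hw1 _))
            (i1.sub (i2.const_mul ρ)) hpt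
      _ = ∫ ω, w ω ∂P - ρ * ∫ ω, w ω * (𝔯).gain μ 1 0 t ω ∂P := by
          rw [integral_sub i1 (i2.const_mul ρ), integral_const_mul,
            hr.estimator.sci_isOnline.integral_mul_reward hr.model (by simp) (by simp) ht1
              (hwm t ht) (hw1 t)]
      _ ≤ ∫ ω, w ω ∂P - ρ * (s * ∫ ω, w ω ∂P) := by
          rw [← integral_const_mul s]
          exact sub_le_sub_left (mul_le_mul_of_nonneg_left
            (integral_mono (i1.const_mul s) i3 hgain) hρ0) _
      _ = (1 - ρ * s) * ∫ ω, w ω ∂P := by ring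
      _ ≤ (1 - ρ * s) * (1 - ρ * s) ^ (t - N) := mul_le_mul_of_nonneg_left ih hρs
      _ = _ := by rw [← pow_succ', Nat.sub_add_comm ht]

/-- A Chernoff argument: either J ≥ εt, which gives the power of t, or exp(εt - J) ≥ 1, and the mean
of this exponential decays geometrically. -/
theorem exists_integral_stepIndex_rpow_le (hr : IsRun P μ D₀ X Y p γ α q₁) {A : ℕ → Set Ω}
    {N : ℕ} (hN : 1 ≤ N) (hA : ∀ t ≥ N, MeasurableSet[ℙ (t - 1)] (A t))
    (hanti : ∀ t ≥ N, A (t + 1) ⊆ A t) {s : ℝ} (hs0 : 0 < s) (hs1 : s ≤ 1)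
    (hsel : ∀ t ≥ N, ∀ ω ∈ A t, s ≤ (𝔯).gain μ 1 0 t ω) {v : ℝ} (hv0 : 0 ≤ v) (hv2 : v ≤ 2) :
    ∃ C > (0 : ℝ), ∀ t ≥ N,
      ∫ ω, (A t).indicator 1 ω * (𝔍 t ω : ℝ) ^ (-v) ∂P ≤ C * (t : ℝ) ^ (-v) := by
  set ρ := 1 - (1 - Real.exp (-1)) * s with hρ
  have he1 : Real.exp (-1) < 1 := by
    rw [Real.exp_lt_one_iff]
    norm_num
  have hρ0 : 0 < ρ := by nlinarith [Real.exp_pos (-1)]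
  have hρ1 : ρ < 1 := by nlinarith
  -- With this ε the factor exp(ε)ρ is still below 1, so its t-th power is O(t⁻²), which suffices
  -- since v ≤ 2.
  set ε := -Real.log ρ / 2 with hε
  have hlog := Real.log_neg hρ0 hρ1
  have hε0 : 0 < ε := by linarith
  set r := Real.exp ε * ρ with hrdef
  have hr0 : 0 < r := mul_pos (Real.exp_pos _) hρ0
  have hr1 : r < 1 := by
    have : r = Real.exp (ε + Real.log ρ) := by rw [Real.exp_add, Real.exp_log hρ0]
    rw [this, Real.exp_lt_one_iff]
    linarith
  obtain ⟨C', hC'⟩ := (tendsto_pow_const_mul_const_pow_of_abs_lt_one 2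
    (abs_lt.2 ⟨by linarith, hr1⟩)).bddAbove_range
  have hC'' : ∀ t : ℕ, (t : ℝ) ^ 2 * r ^ t ≤ C' := fun t => hC' ⟨t, rfl⟩
  have hC'0 : 0 ≤ C' := by simpa using hC'' 0
  refine ⟨ε ^ (-v) + C' / ρ ^ N, by positivity, fun t ht => ?_⟩
  have ht1 : 1 ≤ t := hN.trans ht
  have ht0 : (0 : ℝ) < t := by exact_mod_cast ht1
  have ht1' : (1 : ℝ) ≤ t := by exact_mod_cast ht1
  have hpt : ∀ ω, (A t).indicator 1 ω * (𝔍 t ω : ℝ) ^ (-v) ≤ (ε * t) ^ (-v) +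
      Real.exp (ε * t) * ((A t).indicator 1 ω * Real.exp (-(𝔍 t ω : ℝ))) := fun ω => by
    by_cases hω : ω ∈ A t
    · have hJ1 : (1 : ℝ) ≤ 𝔍 t ω := by exact_mod_cast one_le_stepIndex ht1 ω
      simp only [indicator_of_mem hω, Pi.one_apply, one_mul]
      rw [← Real.exp_add]
      rcases le_total (ε * t) (𝔍 t ω) with h | h
      · have := Real.rpow_le_rpow_of_nonpos (by positivity) h (neg_nonpos.2 hv0)
        linarith [Real.exp_pos (ε * t + -(𝔍 t ω : ℝ))]
      · have h1 := Real.rpow_le_one_of_one_le_of_nonpos hJ1 (neg_nonpos.2 hv0)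
        have h2 : 1 ≤ Real.exp (ε * t + -(𝔍 t ω : ℝ)) := Real.one_le_exp (by linarith)
        have h3 : 0 ≤ (ε * t) ^ (-v) := by positivity
        linarith
    · simp only [indicator_of_notMem hω, zero_mul, mul_zero, add_zero]
      positivity
  have hm := hr.measurable_step ht1 fun j => (j : ℝ) ^ (-v)
  have hme := hr.measurable_step ht1 fun j => Real.exp (-(j : ℝ))
  have hAm : Measurable[ℙ (t - 1)] ((A t).indicator (1 : Ω → ℝ)) :=
    measurable_indicator_one (hA t ht)
  have i1 : Integrable (fun ω => (A t).indicator 1 ω * (𝔍 t ω : ℝ) ^ (-v)) P :=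
    hr.integrable_past (C := 1) (hAm.mul hm) fun ω => by
      rw [abs_mul, abs_of_nonneg (by positivity : (0 : ℝ) ≤ (𝔍 t ω : ℝ) ^ (-v))]
      exact mul_le_one₀ (abs_indicator_le _ (by simp)) (by positivity)
        (Real.rpow_le_one_of_one_le_of_nonpos (by exact_mod_cast one_le_stepIndex ht1 ω)
          (neg_nonpos.2 hv0))
  have i2 : Integrable (fun ω => (A t).indicator 1 ω * Real.exp (-(𝔍 t ω : ℝ))) P :=
    hr.integrable_past (C := 1) (hAm.mul hme) fun ω => by
      rw [abs_mul, abs_of_pos (Real.exp_pos _)]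
      exact mul_le_one₀ (abs_indicator_le _ (by simp)) (Real.exp_pos _).le
        (Real.exp_le_one_iff.2 (by simp))
  have hexp := hr.integral_exp_neg_stepIndex_le hN hA hanti hs1 hsel ht
  calc _ ≤ ∫ ω, ((ε * t) ^ (-v) +
        Real.exp (ε * t) * ((A t).indicator 1 ω * Real.exp (-(𝔍 t ω : ℝ)))) ∂P :=
        integral_mono i1 ((integrable_const _).add (i2.const_mul _)) hpt
    _ ≤ (ε * t) ^ (-v) + Real.exp (ε * t) * ρ ^ (t - N) := by
        rw [integral_add (integrable_const _) (i2.const_mul _), integral_const_mul]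
        simp only [integral_const, probReal_univ, one_smul]
        exact add_le_add le_rfl (mul_le_mul_of_nonneg_left hexp (Real.exp_pos _).le)
    _ = ε ^ (-v) * (t : ℝ) ^ (-v) + r ^ t / ρ ^ N := by
        rw [Real.mul_rpow hε0.le ht0.le, hrdef, mul_pow, ← Real.exp_nat_mul, mul_comm ε,
          pow_sub₀ _ hρ0.ne' ht]
        ring
    _ ≤ ε ^ (-v) * (t : ℝ) ^ (-v) + C' * (t : ℝ) ^ (-v) / ρ ^ N := by
        have h1 : r ^ t ≤ C' * (t : ℝ) ^ (-(2 : ℝ)) := by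
          rw [Real.rpow_neg ht0.le, Real.rpow_two, ← div_eq_mul_inv, le_div_iff₀ (by positivity),
            mul_comm]
          exact hC'' t
        have h2 : (t : ℝ) ^ (-(2 : ℝ)) ≤ (t : ℝ) ^ (-v) :=
          Real.rpow_le_rpow_of_exponent_le ht1' (by linarith)
        have h3 := h1.trans (mul_le_mul_of_nonneg_left h2 hC'0)
        gcongr
    _ = _ := by ring

/-- Expand the square and average the cross term given the past, which is possible since A is known
then; shrinking A to A' only decreases the left side. The contraction uses γ t ≤ γ(J), whereas the
error terms keep γ(J), whose means on A are bounded separately. -/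
theorem integral_sq_sub_succ_le (hr : IsRun P μ D₀ X Y p γ α q₁) {t : ℕ} (ht : 1 ≤ t)
    {A A' : Set Ω} (hA : MeasurableSet[ℙ (t - 1)] A) (hA' : MeasurableSet[ℙ t] A')
    (hsub : A' ⊆ A) {q₀ k E : ℝ} (hk : 0 ≤ k)
    (hdrift : ∀ ω ∈ A, 2 * ((𝔮 t ω - q₀) * 𝔡 t ω) ≤ -k * (𝔮 t ω - q₀) ^ 2 + E) :
    ∫ ω, A'.indicator 1 ω * (𝔮 (t + 1) ω - q₀) ^ 2 ∂P ≤
      (1 - k * γ t) * ∫ ω, A.indicator 1 ω * (𝔮 t ω - q₀) ^ 2 ∂P +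
      E * ∫ ω, A.indicator 1 ω * γ (𝔍 t ω) ∂P + ∫ ω, A.indicator 1 ω * γ (𝔍 t ω) ^ 2 ∂P := by
  have hle : past D₀ X Y (t - 1) ≤ past D₀ X Y t := past_mono (Nat.sub_le t 1)
  set M : ℝ := |q₀| + 1 + γ 1 with hM
  have hM0 : 0 ≤ M := by
    have := hr.step_nonneg 1
    positivity
  have hqM : ∀ t, 1 ≤ t → ∀ ω, |𝔮 t ω - q₀| ≤ M := fun t ht ω => by
    have := hr.threshold_mem ht ω
    have h2 := hr.step_nonneg 1
    exact abs_le.2 ⟨by linarith [this.1, le_abs_self q₀], by linarith [this.2, neg_abs_le q₀]⟩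
  have h1A : ∀ (B : Set Ω) ω, |B.indicator (1 : Ω → ℝ) ω| ≤ 1 := fun B ω =>
    abs_indicator_le _ (by simp)
  have h0A : ∀ (B : Set Ω) ω, 0 ≤ B.indicator (1 : Ω → ℝ) ω := fun B ω =>
    indicator_nonneg (by simp) _
  have hAm : Measurable[ℙ (t - 1)] (A.indicator (1 : Ω → ℝ)) := measurable_indicator_one hA
  have hA'm : Measurable[ℙ t] (A'.indicator (1 : Ω → ℝ)) := measurable_indicator_one hA'
  have hq := (hr.measurable_threshold ht).sub_const q₀
  have hq' := (hr.measurable_threshold (t := t + 1) (by omega)).sub_const q₀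
  have hJ := hr.measurable_step ht γ
  have hinc := abs_increment_le (γ := γ) (q₁ := q₁) (X := X) (Y := Y) (p := p) hr.level_mem t
  set w : Ω → ℝ := fun ω => A.indicator 1 ω * γ (𝔍 t ω) * (𝔮 t ω - q₀) with hw
  have hwm : Measurable[ℙ (t - 1)] w := (hAm.mul hJ).mul hq
  have hAJ : ∀ ω, |A.indicator 1 ω * γ (𝔍 t ω)| ≤ γ 1 := fun ω => by
    rw [abs_mul]
    exact (mul_le_of_le_one_left (abs_nonneg _) (h1A A ω)).trans (hr.abs_step_le ht ω)
  have hwC : ∀ ω, |w ω| ≤ γ 1 * M := fun ω => by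
    rw [hw, abs_mul]
    exact mul_le_mul (hAJ ω) (hqM t ht ω) (abs_nonneg _) (hr.step_nonneg 1)
  have i0 : Integrable (fun ω => A'.indicator 1 ω * (𝔮 (t + 1) ω - q₀) ^ 2) P :=
    hr.integrable_past (t := t) (C := 1 * M ^ 2) (hA'm.mul (hq'.pow_const 2)) fun ω => by
      rw [abs_mul, abs_pow]
      exact mul_le_mul (h1A A' ω) (pow_le_pow_left₀ (abs_nonneg _) (hqM _ (by omega) ω) 2)
        (by positivity) zero_le_one
  have i1 : Integrable (fun ω => A.indicator 1 ω * (𝔮 t ω - q₀) ^ 2) P :=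
    hr.integrable_past (t := t - 1) (C := 1 * M ^ 2) (hAm.mul (hq.pow_const 2)) fun ω => by
      rw [abs_mul, abs_pow]
      exact mul_le_mul (h1A A ω) (pow_le_pow_left₀ (abs_nonneg _) (hqM t ht ω) 2)
        (by positivity) zero_le_one
  have i2 : Integrable (fun ω => w ω * 𝔦 t ω) P :=
    hr.integrable_past (t := t) (C := γ 1 * M * 1) ((hwm.mono hle le_rfl).mul
      (hr.measurable_increment ht)) fun ω => by
        rw [abs_mul]
        exact mul_le_mul (hwC ω) (hinc ω) (abs_nonneg _) ((abs_nonneg _).trans (hwC ω))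
  have i3 : Integrable (fun ω => A.indicator 1 ω * γ (𝔍 t ω) ^ 2) P :=
    hr.integrable_past (t := t - 1) (C := 1 * γ 1 ^ 2) (hAm.mul (hJ.pow_const 2)) fun ω => by
      rw [abs_mul, abs_pow]
      exact mul_le_mul (h1A A ω) (pow_le_pow_left₀ (abs_nonneg _) (hr.abs_step_le ht ω) 2)
        (by positivity) zero_le_one
  have i4 : Integrable (fun ω => w ω * 𝔡 t ω) P :=
    hr.integrable_past (t := t - 1) (C := γ 1 * M * 1) (hwm.mul (hr.measurable_drift ht))
      fun ω => by
        rw [abs_mul]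
        exact mul_le_mul (hwC ω) (hr.abs_drift_le t ω) (abs_nonneg _)
          ((abs_nonneg _).trans (hwC ω))
  have i5 : Integrable (fun ω => A.indicator 1 ω * γ (𝔍 t ω)) P :=
    hr.integrable_past (t := t - 1) (hAm.mul hJ) hAJ
  have hstep : ∀ ω, A'.indicator 1 ω * (𝔮 (t + 1) ω - q₀) ^ 2 ≤
      A.indicator 1 ω * (𝔮 t ω - q₀) ^ 2 + 2 * (w ω * 𝔦 t ω) +
        A.indicator 1 ω * γ (𝔍 t ω) ^ 2 := fun ω => by
    have h1 : A'.indicator (1 : Ω → ℝ) ω ≤ A.indicator 1 ω :=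
      indicator_le_indicator_of_subset hsub (by simp) ω
    have h2 := mul_le_mul_of_nonneg_right h1 (sq_nonneg (𝔮 (t + 1) ω - q₀))
    have h3 : 𝔦 t ω ^ 2 ≤ 1 := by simpa using hinc ω
    have h4 := mul_le_mul_of_nonneg_left h3
      (mul_nonneg (h0A A ω) (sq_nonneg (γ (𝔍 t ω))))
    refine h2.trans ?_
    rw [threshold_succ ht]
    dsimp only [w]
    linarith
  have hdr : ∀ ω, 2 * (w ω * 𝔡 t ω) ≤ -(k * γ t) * (A.indicator 1 ω * (𝔮 t ω - q₀) ^ 2) +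
      E * (A.indicator 1 ω * γ (𝔍 t ω)) := fun ω => by
    by_cases hω : ω ∈ A
    · dsimp only [w]
      simp only [indicator_of_mem hω, Pi.one_apply, one_mul]
      have h1 := mul_le_mul_of_nonneg_left (hdrift ω hω) (hr.step_nonneg (𝔍 t ω))
      have h2 := mul_le_mul_of_nonneg_right (hr.le_step ht ω)
        (mul_nonneg hk (sq_nonneg (𝔮 t ω - q₀)))
      linarith
    · simp [w, hω]
  have e1 : ∫ ω, A'.indicator 1 ω * (𝔮 (t + 1) ω - q₀) ^ 2 ∂P ≤
      ∫ ω, A.indicator 1 ω * (𝔮 t ω - q₀) ^ 2 ∂P + 2 * ∫ ω, w ω * 𝔦 t ω ∂P +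
        ∫ ω, A.indicator 1 ω * γ (𝔍 t ω) ^ 2 ∂P := by
    have i12 : Integrable (fun ω => A.indicator 1 ω * (𝔮 t ω - q₀) ^ 2 + 2 * (w ω * 𝔦 t ω)) P :=
      i1.add (i2.const_mul 2)
    rw [← integral_const_mul, ← integral_add i1 (i2.const_mul 2), ← integral_add i12 i3]
    exact integral_mono i0 (i12.add i3) hstep
  have e2 : 2 * ∫ ω, w ω * 𝔡 t ω ∂P ≤
      -(k * γ t) * ∫ ω, A.indicator 1 ω * (𝔮 t ω - q₀) ^ 2 ∂P +
        E * ∫ ω, A.indicator 1 ω * γ (𝔍 t ω) ∂P := by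
    rw [← integral_const_mul, ← integral_const_mul, ← integral_const_mul,
      ← integral_add (i1.const_mul _) (i5.const_mul _)]
    exact integral_mono (i4.const_mul _) ((i1.const_mul _).add (i5.const_mul _)) hdr
  rw [hr.integral_mul_increment ht hwm hwC] at e1
  linarith

end IsRun

end Recursion

/-! ### Comparison with the oracle, and the good events. -/

section Comparison

variable {Ω : Type*} {d K n : ℕ} [NeZero K] [MeasurableSpace Ω]
  {P : Measure Ω} [IsProbabilityMeasure P] {μ : Measure (Feature d × Fin K)}
  [IsProbabilityMeasure μ] {D₀ : Ω → Fin n → Feature d × Fin K} {X : ℕ → Ω → Feature d}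
  {Y : ℕ → Ω → Fin K} {p : ℕ → Ω → Feature d → Fin K → ℝ} {γ : ℕ → ℝ} {α q₁ : ℝ}

local notation "𝔮" => threshold γ α q₁ X Y p
local notation "ℙ" => past D₀ X Y

/-! ### Unconditional error and power, and the Lagrangian bound. -/

section Totals

theorem ruleGain_eq (a b : ℝ) {s : Set (Feature d)} (hs : MeasurableSet s)
    {pred : Feature d → Fin K} (hpred : Measurable pred) :
    ruleGain μ a b s pred = a * ruleGain μ 1 0 s pred + b * ruleGain μ 0 1 s pred := by
  simp only [ruleGain]
  rw [← integral_const_mul, ← integral_const_mul, ← integral_add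
    ((integrable_ruleGain_integrand 1 0 hs hpred).const_mul a)
    ((integrable_ruleGain_integrand 0 1 hs hpred).const_mul b)]
  refine integral_congr_ae (ae_of_all _ fun x => ?_)
  simp only [indicator]
  split_ifs <;> ring

/-- A rule for which the class probability of the prediction replaces `W` is worse than thresholding
`W`, when rewards are measured by `(1 + l) W - l A`. -/
theorem ruleGain_le_levelGain {l A q₀ : ℝ} (hl : 0 ≤ l) (hq₀ : (1 + l) * q₀ = l * A)
    {s : Set (Feature d)} (hs : MeasurableSet s) {pred : Feature d → Fin K}
    (hpred : Measurable pred) :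
    ruleGain μ (-(l * A)) (1 + l) s pred ≤ levelGain μ (-(l * A)) (1 + l) q₀ := by
  refine integral_mono (integrable_ruleGain_integrand _ _ hs hpred)
    (integrable_levelGain_integrand _ _ _) fun x => ?_
  have hVW : classProb μ x (pred x) ≤ topProb μ x := le_maxScore _ _
  -- By `hq₀` the penalized reward (1 + l)w - lA is positive exactly for w > q₀, so selecting above
  -- q₀ is optimal pointwise.
  have h1 := mul_le_mul_of_nonneg_left hVW (by linarith : 0 ≤ 1 + l)
  simp only [indicator, mem_ofPred_eq]
  split_ifs with hx hy hy
  · linarith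
  · have := mul_le_mul_of_nonneg_left (not_lt.1 hy) (by linarith : 0 ≤ 1 + l)
    linarith
  · have := mul_le_mul_of_nonneg_left hy.le (by linarith : 0 ≤ 1 + l)
    linarith
  · exact le_rfl

theorem oracle_gain (q₀ a b : ℝ) (t : ℕ) (ω : Ω) :
    (oracle Ω μ q₀).gain μ a b t ω = levelGain μ a b q₀ := by
  simp only [SelectiveClassifier.gain, ruleGain, levelGain, oracle, apply_argmaxLabel]
  rfl

namespace SelectiveClassifier.IsOnline

variable {R : SelectiveClassifier Ω d K}

theorem measurableSet_select (hR : R.IsOnline ℙ) (h : IIDModel P μ D₀ X Y) {t : ℕ} (ht : 1 ≤ t) :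
    MeasurableSet {ω | R.select t ω (X t ω)} := by
  have hpair : @Measurable Ω (Ω × Feature d) _ ((past D₀ X Y (t - 1)).prod inferInstance)
      fun ω => (ω, X t ω) :=
    @Measurable.prodMk _ _ _ _ (past D₀ X Y (t - 1)) _ _ _ (measurable_id'' (h.past_le (t - 1)))
      (h.measurable_X t ht)
  exact hpair (hR.select t ht)

theorem measurableSet_correct (hR : R.IsOnline ℙ) (h : IIDModel P μ D₀ X Y) {t : ℕ}
    (ht : 1 ≤ t) : MeasurableSet {ω | Y t ω = R.predict t ω (X t ω)} := by
  have hpair : @Measurable Ω (Ω × Feature d) _ ((past D₀ X Y (t - 1)).prod inferInstance)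
      fun ω => (ω, X t ω) :=
    @Measurable.prodMk _ _ _ _ (past D₀ X Y (t - 1)) _ _ _ (measurable_id'' (h.past_le (t - 1)))
      (h.measurable_X t ht)
  exact measurableSet_eq_fun (h.measurable_Y t ht) ((hR.predict t ht).comp hpair)

theorem integral_reward (hR : R.IsOnline ℙ) (h : IIDModel P μ D₀ X Y) {a b : ℝ} (h0 : |a| ≤ 1)
    (h1 : |a + b| ≤ 1) {t : ℕ} (ht : 1 ≤ t) :
    ∫ ω, R.reward X Y a b t ω ∂P = ∫ ω, R.gain μ a b t ω ∂P := by
  simpa using hR.integral_mul_reward h h0 h1 ht (w := fun _ => 1) (C := 1) measurable_const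
    (by simp)

theorem integrable_gain (hR : R.IsOnline ℙ) (h : IIDModel P μ D₀ X Y) {a b : ℝ} (h0 : |a| ≤ 1)
    (h1 : |a + b| ≤ 1) {t : ℕ} (ht : 1 ≤ t) : Integrable (R.gain μ a b t) P :=
  integrable_of_measurable_of_bound ((hR.measurable_gain a b ht).mono (h.past_le _) le_rfl)
    fun _ => abs_ruleGain_le h0 h1 _ _

theorem power_eq (hR : R.IsOnline ℙ) (h : IIDModel P μ D₀ X Y) {t : ℕ} (ht : 1 ≤ t) :
    R.power P X Y t = ∫ ω, R.gain μ 0 1 t ω ∂P := by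
  rw [← hR.integral_reward h (by simp) (by simp) ht, SelectiveClassifier.power]
  have hm : MeasurableSet {ω | Y t ω = R.predict t ω (X t ω) ∧ R.select t ω (X t ω)} :=
    (hR.measurableSet_correct h ht).inter (hR.measurableSet_select h ht)
  rw [← integral_indicator_one hm]
  refine integral_congr_ae (ae_of_all _ fun ω => ?_)
  simp only [SelectiveClassifier.reward, indicator, mem_ofPred_eq, Pi.one_apply]
  split_ifs <;> simp_all

/-- The product form needs no positive selection probability: when that vanishes, so does the right
side. -/
theorem errorRate_mul (hR : R.IsOnline ℙ) (h : IIDModel P μ D₀ X Y) {t : ℕ} (ht : 1 ≤ t) :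
    R.errorRate P X Y t * ∫ ω, R.gain μ 1 0 t ω ∂P = ∫ ω, R.gain μ 1 (-1) t ω ∂P := by
  have hs := hR.measurableSet_select h ht
  have hc := hR.measurableSet_correct h ht
  rw [← hR.integral_reward h (by simp) (by simp) ht, ← hR.integral_reward h (by simp) (by simp) ht]
  have e1 : ∫ ω, R.reward X Y 1 0 t ω ∂P = P.real {ω | R.select t ω (X t ω)} := by
    rw [← integral_indicator_one hs]
    refine integral_congr_ae (ae_of_all _ fun ω => ?_)
    simp [SelectiveClassifier.reward, indicator]
  have e2 : ∫ ω, R.reward X Y 1 (-1) t ω ∂P =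
      P.real ({ω | R.select t ω (X t ω)} ∩ {ω | Y t ω ≠ R.predict t ω (X t ω)}) := by
    have hm : MeasurableSet ({ω | R.select t ω (X t ω)} ∩ {ω | Y t ω ≠ R.predict t ω (X t ω)}) :=
      hs.inter hc.compl
    rw [← integral_indicator_one hm]
    refine integral_congr_ae (ae_of_all _ fun ω => ?_)
    simp only [SelectiveClassifier.reward, indicator, mem_ofPred_eq, Pi.one_apply, mem_inter_iff,
      ne_eq]
    split_ifs <;> simp_all
  rw [e1, e2, SelectiveClassifier.errorRate, measureReal_def, cond_apply hs, ENNReal.toReal_mul,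
    ENNReal.toReal_inv, ← measureReal_def, ← measureReal_def]
  by_cases h0 : P.real {ω | R.select t ω (X t ω)} = 0
  · rw [h0, mul_zero]
    exact (measureReal_mono_null inter_subset_left h0).symm
  · field_simp

theorem integral_gain_eq (hR : R.IsOnline ℙ) (h : IIDModel P μ D₀ X Y) {a b : ℝ} {t : ℕ}
    (ht : 1 ≤ t) : ∫ ω, R.gain μ a b t ω ∂P =
      a * ∫ ω, R.gain μ 1 0 t ω ∂P + b * ∫ ω, R.gain μ 0 1 t ω ∂P := by
  rw [← integral_const_mul, ← integral_const_mul, ← integral_add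
    ((hR.integrable_gain h (by simp) (by simp) ht).const_mul a)
    ((hR.integrable_gain h (by simp) (by simp) ht).const_mul b)]
  refine integral_congr_ae (ae_of_all _ fun ω => ?_)
  exact ruleGain_eq a b (@measurable_prodMk_left _ _ (past D₀ X Y (t - 1)) _ ω _ (hR.select t ht))
    (measurable_section (m := past D₀ X Y (t - 1)) (hR.predict t ht) ω)

theorem integral_gain_one_zero_le (hR : R.IsOnline ℙ) (h : IIDModel P μ D₀ X Y) {t : ℕ}
    (ht : 1 ≤ t) : ∫ ω, R.gain μ 1 0 t ω ∂P ∈ Icc (0 : ℝ) 1 := by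
  constructor
  · refine integral_nonneg fun ω => integral_nonneg fun x => indicator_nonneg (by simp) _
  · refine (integral_mono (hR.integrable_gain h (by simp) (by simp) ht) (integrable_const 1)
      fun ω => (le_abs_self _).trans (abs_ruleGain_le (by simp) (by simp) _ _)).trans ?_
    simp

/-- A procedure with error rate at most `α + a` has at most the power of the oracle, up to a
multiple of `a`. -/
theorem power_le (hR : R.IsOnline ℙ) (h : IIDModel P μ D₀ X Y) {l α q₀ a : ℝ} (hl : 0 ≤ l)
    (hq₀ : (1 + l) * q₀ = l * (1 - α)) (h0 : levelGain μ (1 - α) (-1) q₀ = 0) (ha : 0 ≤ a) {t : ℕ}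
    (ht : 1 ≤ t) (herr : R.errorRate P X Y t ≤ α + a) :
    R.power P X Y t ≤ levelGain μ 0 1 q₀ + l * a := by
  have hp := hR.integral_gain_one_zero_le h ht
  have h1 : ∫ ω, R.gain μ (-(l * (1 - α))) (1 + l) t ω ∂P ≤
      levelGain μ (-(l * (1 - α))) (1 + l) q₀ := by
    have hle : ∀ ω, R.gain μ (-(l * (1 - α))) (1 + l) t ω ≤
        levelGain μ (-(l * (1 - α))) (1 + l) q₀ := fun ω => ruleGain_le_levelGain hl hq₀
      (@measurable_prodMk_left _ _ (past D₀ X Y (t - 1)) _ ω _ (hR.select t ht))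
      (measurable_section (m := past D₀ X Y (t - 1)) (hR.predict t ht) ω)
    -- The coefficients of the Lagrangian need not be bounded by 1, so it is split into selection
    -- probability and power.
    have hi : Integrable (fun ω => R.gain μ (-(l * (1 - α))) (1 + l) t ω) P := by
      refine (((hR.integrable_gain h (a := 1) (b := 0) (by simp) (by simp) ht).const_mul
        (-(l * (1 - α)))).add ((hR.integrable_gain h (a := 0) (b := 1) (by simp) (by simp)
        ht).const_mul (1 + l))).congr (ae_of_all _ fun ω => ?_)
      exact (ruleGain_eq _ _
        (@measurable_prodMk_left _ _ (past D₀ X Y (t - 1)) _ ω _ (hR.select t ht))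
        (measurable_section (m := past D₀ X Y (t - 1)) (hR.predict t ht) ω)).symm
    refine (integral_mono hi (integrable_const _) hle).trans ?_
    simp
  rw [hR.integral_gain_eq h ht, levelGain_eq] at h1
  rw [levelGain_eq] at h0
  have h2 := hR.errorRate_mul h ht
  rw [hR.integral_gain_eq h (a := 1) (b := -1) ht] at h2
  rw [hR.power_eq h ht]
  set p0 := ∫ ω, R.gain μ 1 0 t ω ∂P
  set p1 := ∫ ω, R.gain μ 0 1 t ω ∂P
  have h3 := mul_le_mul_of_nonneg_right herr hp.1
  -- The excess error probability (1 - α) p0 - p1 is at most a p0 ≤ a; for the oracle it vanishes.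
  have h4 : l * ((1 - α) * p0 - p1) ≤ l * (a * 1) := by
    refine mul_le_mul_of_nonneg_left ?_ hl
    have := mul_le_mul_of_nonneg_left hp.2 ha
    linarith
  have h5 : l * ((1 - α) * levelGain μ 1 0 q₀ + -1 * levelGain μ 0 1 q₀) = 0 := by
    rw [h0, mul_zero]
  linarith

end SelectiveClassifier.IsOnline

end Totals

/-! ### Events with bounded thresholds and small estimation errors. -/

section GoodEvents

/-- A level and a starting time nearly attaining the infima are chosen. Raising the level towards
`Bstar` shrinks the event, so it may be taken above any prescribed a. -/
theorem exists_of_failureProb_lt {Bstar δ : ℝ} {qseq : ℕ → Ω → ℝ} (hB : 0 < Bstar)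
    (h : failureProb P Bstar qseq < δ) {a : ℝ} (ha : a < Bstar) :
    ∃ q ∈ Ioo a Bstar, ∃ N, P.real {ω | ∃ T ≥ N, q < qseq T ω} < δ := by
  have : Nonempty (Ico (0 : ℝ) Bstar) := ⟨⟨0, le_rfl, hB⟩⟩
  have : Nonempty (Ici (1 : ℕ)) := ⟨⟨1, self_mem_Ici⟩⟩
  obtain ⟨q, hq⟩ := exists_lt_of_ciInf_lt h
  obtain ⟨N, hN⟩ := exists_lt_of_ciInf_lt hq
  obtain ⟨r, hr, hrB⟩ := exists_between (max_lt ha q.2.2)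
  refine ⟨r, ⟨(le_max_left _ _).trans_lt hr, hrB⟩, N, lt_of_le_of_lt (measureReal_mono ?_) hN⟩
  rintro ω ⟨T, hT, hlt⟩
  change ((q : ℝ) : EReal) < ⨆ T : Ici (N : ℕ), (qseq T ω : EReal)
  refine lt_iSup_iff.2 ⟨⟨T, hT⟩, ?_⟩
  exact EReal.coe_lt_coe_iff.2 (((le_max_right _ _).trans_lt hr).trans hlt)

/-- From time `N` to time `t`, the thresholds stay below `q` and the estimation errors stay small. -/
def goodEvent (q : ℝ) (err : ℕ → Ω → ℝ) (η : ℕ → ℝ) (qseq : ℕ → Ω → ℝ) (N t : ℕ) : Set Ω :=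
  {ω | ∀ T ∈ Icc N t, qseq T ω ≤ q ∧ err T ω ≤ η T}

theorem IsRun.measurableSet_goodEvent (hr : IsRun P μ D₀ X Y p γ α q₁) (q : ℝ) (η : ℕ → ℝ) {N : ℕ}
    (hN : 1 ≤ N) (t : ℕ) :
    MeasurableSet[ℙ (t - 1)] (goodEvent q (meanError μ p) η 𝔮 N t) := by
  have hm : ∀ T ∈ Icc N t, MeasurableSet[ℙ (t - 1)]
      {ω | 𝔮 T ω ≤ q ∧ meanError μ p T ω ≤ η T} := fun T hT => by
    have hle : past D₀ X Y (T - 1) ≤ past D₀ X Y (t - 1) :=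
      past_mono (Nat.sub_le_sub_right hT.2 1)
    have h1 := (hr.measurable_threshold (hN.trans hT.1)).mono hle le_rfl
    have h2 := (hr.measurable_meanError (hN.trans hT.1)).mono hle le_rfl
    let := past D₀ X Y (t - 1)
    exact (measurableSet_le h1 measurable_const).inter (measurableSet_le h2 measurable_const)
  have : goodEvent q (meanError μ p) η 𝔮 N t =
      ⋂ T ∈ Icc N t, {ω | 𝔮 T ω ≤ q ∧ meanError μ p T ω ≤ η T} := by
    ext ω
    simp [goodEvent]
  rw [this]
  let := past D₀ X Y (t - 1)
  exact MeasurableSet.biInter (Set.to_countable _) hm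

theorem goodEvent_anti (q : ℝ) (err : ℕ → Ω → ℝ) (η : ℕ → ℝ) (qseq : ℕ → Ω → ℝ) (N t : ℕ) :
    goodEvent q err η qseq N (t + 1) ⊆ goodEvent q err η qseq N t :=
  fun _ h T hT => h T ⟨hT.1, hT.2.trans (Nat.le_succ t)⟩

/-- The strict inequality for the thresholds leaves room for the tail of a convergent series, which
bounds all later estimation failures, uniformly in t. -/
theorem exists_measureReal_compl_goodEvent_le {q δ : ℝ} {err : ℕ → Ω → ℝ} {η : ℕ → ℝ}
    {qseq : ℕ → Ω → ℝ} {N₀ : ℕ} (h : P.real {ω | ∃ T ≥ N₀, q < qseq T ω} < δ)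
    (hs : Summable fun T => P.real {ω | η T < err T ω}) :
    ∀ᶠ N in atTop, ∀ t, P.real (goodEvent q err η qseq N t)ᶜ ≤ δ := by
  have htail := (tendsto_sum_nat_add fun T => P.real {ω | η T < err T ω}).eventually_le_const
    (sub_pos.2 h)
  filter_upwards [htail, eventually_ge_atTop N₀] with N hN hN₀ t
  have hsub : (goodEvent q err η qseq N t)ᶜ ⊆ {ω | ∃ T ≥ N₀, q < qseq T ω} ∪
      ⋃ k ∈ Finset.range (t + 1), {ω | η (k + N) < err (k + N) ω} := by
    intro ω hω
    simp only [goodEvent, mem_compl_iff, mem_ofPred_eq, not_forall] at hω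
    obtain ⟨T, hT, hnot⟩ := hω
    by_cases hq : qseq T ω ≤ q
    · refine Or.inr (mem_iUnion₂.2 ⟨T - N, Finset.mem_range.2 ?_, ?_⟩)
      · have := hT.2
        omega
      · have : T - N + N = T := Nat.sub_add_cancel hT.1
        simp only [mem_ofPred_eq, this]
        exact not_le.1 fun hle => hnot ⟨hq, hle⟩
    · exact Or.inl ⟨T, hN₀.trans hT.1, not_le.1 hq⟩
  have h3 := measureReal_biUnion_finset_le (μ := P) (Finset.range (t + 1))
    (fun k => {ω | η (k + N) < err (k + N) ω})
  have h4 := (summable_nat_add_iff N).2 hs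
  have h5 := h4.sum_le_tsum (Finset.range (t + 1)) fun i _ => measureReal_nonneg
  have h6 : P.real (goodEvent q err η qseq N t)ᶜ ≤ _ := measureReal_mono hsub
  have h7 := h6.trans (measureReal_union_le _ _)
  exact h7.trans (by linarith only [h3, h5, hN])

end GoodEvents

end Comparison

/-! ### Convergence of the threshold to q₀. -/

section Convergence

variable {Ω : Type*} {d K n : ℕ} [NeZero K] [MeasurableSpace Ω]
  {P : Measure Ω} [IsProbabilityMeasure P] {μ : Measure (Feature d × Fin K)}
  [IsProbabilityMeasure μ] {D₀ : Ω → Fin n → Feature d × Fin K} {X : ℕ → Ω → Feature d}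
  {Y : ℕ → Ω → Fin K} {p : ℕ → Ω → Feature d → Fin K → ℝ} {γ : ℕ → ℝ} {α q₁ : ℝ}

local notation "𝔮" => threshold γ α q₁ X Y p
local notation "𝔡" => drift μ γ α q₁ X Y p
local notation "ℙ" => past D₀ X Y

theorem summable_measureReal_lt_meanError {ν₀ ν C₁ : ℝ}
    (h : ∀ᶠ t : ℕ in atTop,
      P.real {ω | C₁ * Real.log t ^ ν₀ * (t : ℝ) ^ (-ν) ≤ meanError μ p t ω} ≤
        3 / (Real.pi ^ 2 * (t : ℝ) ^ 3)) :
    Summable fun t : ℕ =>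
      P.real {ω | C₁ * (Real.log t ^ ν₀ * (t : ℝ) ^ (-ν)) < meanError μ p t ω} := by
  have hs : Summable fun t : ℕ => 3 / Real.pi ^ 2 * (1 / (t : ℝ) ^ 3) :=
    (Real.summable_one_div_nat_pow.2 (by norm_num)).mul_left _
  refine Summable.of_norm_bounded_eventually_nat hs ?_
  filter_upwards [h] with t ht
  rw [Real.norm_of_nonneg measureReal_nonneg]
  have h2 : 3 / (Real.pi ^ 2 * (t : ℝ) ^ 3) = 3 / Real.pi ^ 2 * (1 / (t : ℝ) ^ 3) := by
    rw [div_mul_div_comm, mul_one]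
  rw [← h2]
  refine le_trans (measureReal_mono fun ω hω => ?_) ht
  have hω' : C₁ * (Real.log t ^ ν₀ * (t : ℝ) ^ (-ν)) < meanError μ p t ω := hω
  rw [← mul_assoc] at hω'
  exact hω'.le

/-- If the mean squared distance on an event is at most `V`, then the mean distance is at most
`√V`. -/
theorem integral_indicator_abs_le_sqrt {A : Set Ω} {f : Ω → ℝ} {V : ℝ} (hV : 0 < V)
    (h1 : Integrable (fun ω => A.indicator 1 ω * |f ω|) P)
    (h2 : Integrable (fun ω => A.indicator 1 ω * f ω ^ 2) P)
    (h : ∫ ω, A.indicator 1 ω * f ω ^ 2 ∂P ≤ V) :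
    ∫ ω, A.indicator 1 ω * |f ω| ∂P ≤ √V := by
  have hs : 0 < √V := Real.sqrt_pos.2 hV
  have hsq : √V * √V = V := Real.mul_self_sqrt hV.le
  -- The inequality of means: |f| ≤ f²/(2√V) + √V/2.
  have hpt : ∀ ω, A.indicator 1 ω * |f ω| ≤
      A.indicator 1 ω * f ω ^ 2 * (1 / (2 * √V)) + √V / 2 := fun ω => by
    by_cases hω : ω ∈ A
    · simp only [indicator_of_mem hω, Pi.one_apply, one_mul]
      have h3 : 0 ≤ (|f ω| - √V) ^ 2 / (2 * √V) := by positivity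
      have h4 : (|f ω| - √V) ^ 2 / (2 * √V) = f ω ^ 2 * (1 / (2 * √V)) + √V / 2 - |f ω| := by
        rw [sub_sq, sq_abs]
        field_simp
        ring
      linarith
    · simp only [indicator_of_notMem hω, zero_mul, zero_add]
      positivity
  refine (integral_mono h1 ((h2.mul_const _).add (integrable_const _)) hpt).trans ?_
  simp only [Pi.add_apply]
  rw [integral_add (h2.mul_const _) (integrable_const _), integral_mul_const]
  simp only [integral_const, probReal_univ, one_smul]
  have h5 : (∫ ω, A.indicator 1 ω * f ω ^ 2 ∂P) * (1 / (2 * √V)) ≤ V * (1 / (2 * √V)) :=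
    mul_le_mul_of_nonneg_right h (by positivity)
  have h6 : V * (1 / (2 * √V)) = √V / 2 := by
    nth_rewrite 1 [← hsq]
    field_simp
  linarith

namespace IsRun

/-- On an event with small estimation error, the drift is close to its limit. -/
theorem drift_ge (hr : IsRun P μ D₀ X Y p γ α q₁) {L : ℝ}
    (hL : ∀ u v, u ≤ v → μ.fst.real {x | topProb μ x ∈ Icc u v} ≤ L * (v - u)) (hL0 : 0 ≤ L)
    {t : ℕ} (ht : 1 ≤ t) {ω : Ω} {η : ℝ} (hη : 0 < η) (hη1 : η ≤ 1)
    (hD : meanError μ p t ω ≤ η) :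
    levelGain μ (1 - α) (-1) (𝔮 t ω) - (2 * L + 3) * √η ≤ 𝔡 t ω := by
  rcases lt_or_ge (𝔮 t ω) 0 with h | h
  -- Below zero the drift 1 - α exceeds its limit 1 - α - E[W], so only a lower bound is available
  -- there; it is the direction needed to the left of q₀.
  · rw [drift_of_neg h, levelGain_of_neg _ h]
    have h1 : 0 ≤ ∫ x, topProb μ x ∂μ.fst := integral_nonneg fun x => (topProb_mem_Icc μ x).1
    have h2 : 0 ≤ (2 * L + 3) * √η := by positivity
    linarith
  · rw [drift_of_nonneg h]
    have := abs_le.1 (hr.abs_gain_sub_le hL hr.abs_one_sub_level_le hr.abs_one_sub_level_add_le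
      (by norm_num) ht hη hη1 hD)
    linarith [this.1]

/-- To the left of q₀ only a lower bound on the drift matters; to the right the threshold is
nonnegative and the two-sided estimate applies. Young's inequality spends half of the contraction 2k
on the estimation error. -/
theorem two_mul_drift_le (hr : IsRun P μ D₀ X Y p γ α q₁) {L : ℝ}
    (hL : ∀ u v, u ≤ v → μ.fst.real {x | topProb μ x ∈ Icc u v} ≤ L * (v - u)) (hL0 : 0 ≤ L)
    {t : ℕ} (ht : 1 ≤ t) {ω : Ω} {η : ℝ} (hη : 0 < η) (hη1 : η ≤ 1)
    (hD : meanError μ p t ω ≤ η) {q₀ k : ℝ} (hq₀ : 0 ≤ q₀) (hk : 0 < k)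
    (hkq : (𝔮 t ω - q₀) * levelGain μ (1 - α) (-1) (𝔮 t ω) ≤ -k * (𝔮 t ω - q₀) ^ 2) :
    2 * ((𝔮 t ω - q₀) * 𝔡 t ω) ≤ -k * (𝔮 t ω - q₀) ^ 2 + (2 * L + 3) ^ 2 * η / k := by
  set e := (2 * L + 3) * √η with he
  have he0 : 0 ≤ e := by positivity
  have hge := hr.drift_ge hL hL0 ht hη hη1 hD
  have hmain : (𝔮 t ω - q₀) * 𝔡 t ω ≤
      (𝔮 t ω - q₀) * levelGain μ (1 - α) (-1) (𝔮 t ω) + e * |𝔮 t ω - q₀| := by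
    rcases lt_or_ge (𝔮 t ω) q₀ with h | h
    · rw [abs_of_neg (sub_neg.2 h)]
      have := mul_le_mul_of_nonneg_left hge (by linarith : 0 ≤ -(𝔮 t ω - q₀))
      linarith
    · rw [abs_of_nonneg (sub_nonneg.2 h), drift_of_nonneg (hq₀.trans h)]
      have := abs_le.1 (hr.abs_gain_sub_le hL hr.abs_one_sub_level_le
        hr.abs_one_sub_level_add_le (by norm_num) ht hη hη1 hD)
      have := mul_le_mul_of_nonneg_left this.2 (sub_nonneg.2 h)
      linarith
  have hE : (2 * L + 3) ^ 2 * η / k = e ^ 2 / k := by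
    rw [he, mul_pow, Real.sq_sqrt hη.le]
  have hy : 2 * (e * |𝔮 t ω - q₀|) ≤ k * (𝔮 t ω - q₀) ^ 2 + e ^ 2 / k := by
    have h1 : 0 ≤ (k * |𝔮 t ω - q₀| - e) ^ 2 / k := by positivity
    have h2 : (k * |𝔮 t ω - q₀| - e) ^ 2 / k =
        k * (𝔮 t ω - q₀) ^ 2 + e ^ 2 / k - 2 * (e * |𝔮 t ω - q₀|) := by
      rw [← sq_abs (𝔮 t ω - q₀)]
      field_simp
      ring
    linarith
  rw [hE]
  linarith

/-- The mean distance of the threshold from `q₀` on the good events. -/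
theorem exists_integral_abs_sub_le {c β ν₀ ν C₁ : ℝ}
    (hr : IsRun P μ D₀ X Y p (fun j => c * (j : ℝ) ^ (-β)) α q₁) (hc : 0 < c)
    (hβ : β ∈ Ioo (1 / 2 : ℝ) 1) (hν₀ : 0 < ν₀) (hν : ν ∈ Ioc (0 : ℝ) (1 / 2)) (hC₁ : 0 < C₁)
    {L : ℝ} (hL : ∀ u v, u ≤ v → μ.fst.real {x | topProb μ x ∈ Icc u v} ≤ L * (v - u))
    (hL0 : 0 ≤ L) {q₀ qbar k s : ℝ} (hq₀ : 0 ≤ q₀) (hk : 0 < k)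
    (hkq : ∀ q ∈ Icc (-(c * ((1 : ℕ) : ℝ) ^ (-β))) qbar,
      (q - q₀) * levelGain μ (1 - α) (-1) q ≤ -k * (q - q₀) ^ 2)
    {η : ℕ → ℝ} (hη : ∀ t, η t = C₁ * (Real.log t ^ ν₀ * (t : ℝ) ^ (-ν))) {N : ℕ} (hN : 3 ≤ N)
    (hη1 : ∀ t ≥ N, η t ≤ 1) (hγ1 : ∀ t ≥ N, k * (c * (t : ℝ) ^ (-β)) ≤ 1)
    (hγ2 : ∀ t ≥ N, 1 / (t : ℝ) ≤ k / 2 * (c * (t : ℝ) ^ (-β))) (hs0 : 0 < s) (hs1 : s ≤ 1)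
    (hsel : ∀ t ≥ N, ∀ ω ∈ goodEvent qbar (meanError μ p) η
      (threshold (fun j => c * (j : ℝ) ^ (-β)) α q₁ X Y p) N t,
      s ≤ (sci (fun j => c * (j : ℝ) ^ (-β)) α q₁ X Y p).gain μ 1 0 t ω) :
    ∃ C > (0 : ℝ), ∀ t ≥ N, ∫ ω, (goodEvent qbar (meanError μ p) η
      (threshold (fun j => c * (j : ℝ) ^ (-β)) α q₁ X Y p) N t).indicator 1 ω *
      |threshold (fun j => c * (j : ℝ) ^ (-β)) α q₁ X Y p t ω - q₀| ∂P ≤ C * rate β ν₀ ν t := by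
  set γ : ℕ → ℝ := fun j => c * (j : ℝ) ^ (-β) with hγ
  set A : ℕ → Set Ω := goodEvent qbar (meanError μ p) η (threshold γ α q₁ X Y p) N with hAdef
  have hN1 : 1 ≤ N := by omega
  have hA : ∀ t ≥ N, MeasurableSet[ℙ (t - 1)] (A t) := fun t _ =>
    hr.measurableSet_goodEvent qbar η hN1 t
  have hanti : ∀ t ≥ N, A (t + 1) ⊆ A t := fun t _ => goodEvent_anti _ _ _ _ _ _
  obtain ⟨K₁, hK₁, hJ₁⟩ := hr.exists_integral_stepIndex_rpow_le hN1 hA hanti hs0 hs1 hsel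
    (v := β) (by linarith [hβ.1]) (by linarith [hβ.2])
  obtain ⟨K₂, hK₂, hJ₂⟩ := hr.exists_integral_stepIndex_rpow_le hN1 hA hanti hs0 hs1 hsel
    (v := 2 * β) (by linarith [hβ.1]) (by linarith [hβ.2])
  set b : ℕ → ℝ := fun t => (t : ℝ) ^ (-β) + Real.log t ^ ν₀ * (t : ℝ) ^ (-ν) with hb
  have hlog : ∀ t ≥ N, 0 < Real.log (t : ℝ) := fun t ht =>
    zero_lt_one.trans_le (one_le_log (hN.trans ht))
  have ht0 : ∀ t ≥ N, (0 : ℝ) < t := fun t ht => by exact_mod_cast (by omega : 0 < t)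
  have hb0 : ∀ t ≥ N, 0 < b t := fun t ht => by
    have := hlog t ht
    have := ht0 t ht
    positivity
  set u : ℕ → ℝ := fun t => ∫ ω, (A t).indicator 1 ω * (threshold γ α q₁ X Y p t ω - q₀) ^ 2 ∂P
    with hu
  -- The source has a drift error of order η(t) t^(-β) and a squared step of order t^(-2β); both are
  -- multiples of γ t times b t, with the two constants added in `A`.
  obtain ⟨C, hC, huC⟩ := exists_le_mul_of_recursion (γ := γ) (u := u) (b := b) (a := k)
    (A := (2 * L + 3) ^ 2 * C₁ / k * K₁ + c * K₂) hk hb0 (fun t _ => hr.step_nonneg t)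
    (fun t ht => by
      have h1 := one_sub_inv_mul_rpow_le hβ.2.le (by omega : 1 ≤ t)
      have h2 := one_sub_inv_mul_log_rpow_le hν₀.le (by linarith [hν.2] : ν ≤ 1)
        (by omega : 1 ≤ t)
      dsimp only [b]
      linarith) hγ1 hγ2 (fun t ht => by
      have htpos := ht0 t ht
      have hlogt := hlog t ht
      have hηt : 0 < η t := by
        rw [hη]
        positivity
      have hstep := hr.integral_sq_sub_succ_le (t := t) (by omega) (hA t ht)
        (hA (t + 1) (by omega)) (hanti t ht) hk.le (q₀ := q₀) (E := (2 * L + 3) ^ 2 * η t / k)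
        fun ω hω => by
          have hω' := hω t ⟨ht, le_rfl⟩
          exact hr.two_mul_drift_le hL hL0 (by omega) hηt (hη1 t ht) hω'.2 hq₀ hk
            (hkq _ ⟨(hr.threshold_mem (by omega) ω).1, hω'.1⟩)
      have e1 : ∫ ω, (A t).indicator 1 ω * γ (stepIndex γ α q₁ X Y p t ω) ∂P ≤
          c * (K₁ * (t : ℝ) ^ (-β)) := by
        refine le_trans (le_of_eq ?_) (mul_le_mul_of_nonneg_left (hJ₁ t ht) hc.le)
        rw [← integral_const_mul]
        refine integral_congr_ae (ae_of_all _ fun ω => ?_)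
        dsimp only [γ]
        ring
      have e2 : ∫ ω, (A t).indicator 1 ω * γ (stepIndex γ α q₁ X Y p t ω) ^ 2 ∂P ≤
          c ^ 2 * (K₂ * (t : ℝ) ^ (-(2 * β))) := by
        refine le_trans (le_of_eq ?_) (mul_le_mul_of_nonneg_left (hJ₂ t ht) (sq_nonneg c))
        rw [← integral_const_mul]
        refine integral_congr_ae (ae_of_all _ fun ω => ?_)
        dsimp only [γ]
        rw [mul_pow, ← Real.rpow_natCast (_ ^ (-β)), ← Real.rpow_mul (Nat.cast_nonneg _)]
        push_cast
        rw [show -β * 2 = -(2 * β) by ring]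
        ring
      have e3 : (t : ℝ) ^ (-(2 * β)) = (t : ℝ) ^ (-β) * (t : ℝ) ^ (-β) := by
        rw [← Real.rpow_add htpos]
        congr 1
        ring
      have e4 : (2 * L + 3) ^ 2 * η t / k *
          ∫ ω, (A t).indicator 1 ω * γ (stepIndex γ α q₁ X Y p t ω) ∂P ≤
          (2 * L + 3) ^ 2 * η t / k * (c * (K₁ * (t : ℝ) ^ (-β))) :=
        mul_le_mul_of_nonneg_left e1 (by positivity)
      have e5 : (2 * L + 3) ^ 2 * η t / k * (c * (K₁ * (t : ℝ) ^ (-β))) +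
          c ^ 2 * (K₂ * (t : ℝ) ^ (-(2 * β))) ≤
          ((2 * L + 3) ^ 2 * C₁ / k * K₁ + c * K₂) * γ t * b t := by
        have h1 : 0 ≤ (2 * L + 3) ^ 2 * C₁ / k * K₁ * γ t * (t : ℝ) ^ (-β) := by
          have := hr.step_nonneg t
          positivity
        have h2 : 0 ≤ c * K₂ * γ t * (Real.log t ^ ν₀ * (t : ℝ) ^ (-ν)) := by
          have := hr.step_nonneg t
          positivity
        rw [e3, hη]
        dsimp only [b, γ] at h1 h2 ⊢
        refine le_of_sub_nonneg (le_of_le_of_eq (add_nonneg h1 h2) ?_)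
        ring
      have hγt : γ t = c * (t : ℝ) ^ (-β) := rfl
      refine hstep.trans ?_
      linarith)
  refine ⟨√C, Real.sqrt_pos.2 hC, fun t ht => ?_⟩
  have ht1 : 1 ≤ t := by omega
  have hCb : 0 < C * b t := mul_pos hC (hb0 t ht)
  have hq := (hr.measurable_threshold ht1).sub_const q₀
  have hAm := measurable_indicator_one (hA t ht)
  set M : ℝ := |q₀| + 1 + γ 1 with hM
  have hM0 : 0 ≤ M := by
    have := hr.step_nonneg 1
    positivity
  have hqM : ∀ ω, |threshold γ α q₁ X Y p t ω - q₀| ≤ M := fun ω => by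
    have := hr.threshold_mem ht1 ω
    have h2 := hr.step_nonneg 1
    exact abs_le.2 ⟨by linarith [this.1, le_abs_self q₀], by linarith [this.2, neg_abs_le q₀]⟩
  refine (integral_indicator_abs_le_sqrt hCb ?_ ?_ (huC t ht)).trans ?_
  · refine hr.integrable_past (C := 1 * M) (hAm.mul (continuous_abs.measurable.comp hq)) fun ω => ?_
    rw [abs_mul, abs_abs]
    exact mul_le_mul (abs_indicator_le _ (by simp)) (hqM ω) (abs_nonneg _) zero_le_one
  · refine hr.integrable_past (C := 1 * M ^ 2) (hAm.mul (hq.pow_const 2)) fun ω => ?_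
    rw [abs_mul, abs_pow]
    exact mul_le_mul (abs_indicator_le _ (by simp)) (pow_le_pow_left₀ (abs_nonneg _) (hqM ω) 2)
      (by positivity) zero_le_one
  · rw [Real.sqrt_mul hC.le]
    exact mul_le_mul_of_nonneg_left (sqrt_add_le_rate hβ.2.le ν₀ ν (hN.trans ht))
      (Real.sqrt_nonneg C)

/-- The negative part of the distance from `q₀` vanishes in the limit, on the whole space. -/
theorem tendsto_integral_max_sub_sq_of_lt (hr : IsRun P μ D₀ X Y p γ α q₁) (hγs : ¬ Summable γ)
    (hγ2 : Summable fun j => γ j ^ 2) {L : ℝ}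
    (hL : ∀ u v, u ≤ v → μ.fst.real {x | topProb μ x ∈ Icc u v} ≤ L * (v - u)) (hL0 : 0 ≤ L)
    {η : ℕ → ℝ} (hη : ∀ᶠ t in atTop, 0 < η t) (hη0 : Tendsto η atTop (𝓝 0))
    (hηs : Summable fun t => P.real {ω | η t < meanError μ p t ω}) {r : ℝ} (hrα : r ≤ 1 - α)
    (hr0 : 0 < levelGain μ (1 - α) (-1) r) :
    Tendsto (fun t => ∫ ω, max (r - 𝔮 t ω) 0 ^ 2 ∂P) atTop (𝓝 0) := by
  have he : Tendsto (fun t => (2 * L + 3) * √(η t)) atTop (𝓝 0) := by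
    have := (hη0.sqrt).const_mul (2 * L + 3)
    rwa [Real.sqrt_zero, mul_zero] at this
  -- From time N on, the estimation error uses up at most half of h(r), so the drift below r is at
  -- least h(r)/2.
  obtain ⟨N, hN⟩ := eventually_atTop.1 (hη.and ((hη0.eventually_le_const one_pos).and
    ((he.eventually_le_const (half_pos hr0)).and (eventually_ge_atTop 1))))
  refine hr.tendsto_integral_max_sub_sq hγs hγ2 (half_pos hr0)
    (B := fun t => {ω | meanError μ p t ω ≤ η t}) (N := N) (fun t ht => ?_) ?_
    fun t ht ω hω hlt => ?_
  · have hm := hr.measurable_meanError (hN t ht).2.2.2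
    let := past D₀ X Y (t - 1)
    exact measurableSet_le hm measurable_const
  · refine hηs.congr fun t => congrArg P.real ?_
    ext ω
    simp
  · have h1 := hr.drift_ge hL hL0 (hN t ht).2.2.2 (hN t ht).1 (hN t ht).2.1 hω
    have h2 := levelGain_antitoneOn (μ := μ) (1 - α) (show 𝔮 t ω ∈ Iic (1 - α) from
      (hlt.trans_le hrα).le) (show r ∈ Iic (1 - α) from hrα) hlt.le
    linarith [(hN t ht).2.2.1]

end IsRun

end Convergence

/-! ### Error and power of OnlineSCI. -/

section Bounds

variable {Ω : Type*} {d K n : ℕ} [NeZero K] [MeasurableSpace Ω]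
  {P : Measure Ω} [IsProbabilityMeasure P] {μ : Measure (Feature d × Fin K)}
  [IsProbabilityMeasure μ] {D₀ : Ω → Fin n → Feature d × Fin K} {X : ℕ → Ω → Feature d}
  {Y : ℕ → Ω → Fin K} {p : ℕ → Ω → Feature d → Fin K → ℝ} {γ : ℕ → ℝ} {α q₁ : ℝ}

local notation "ℙ" => past D₀ X Y

/-- The power is estimated on the good event, whose complement costs at most δ'. For the error, the
shortfall of the threshold below q₀ is controlled on the complement too, which keeps the additive
loss at δ' after division by the selection probability. -/
theorem IsRun.exists_bounds {κ Bstar c β ν₀ ν C₁ δ' q₀ : ℝ}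
    (hr : IsRun P μ D₀ X Y p (fun j => c * (j : ℝ) ^ (-β)) α q₁)
    (hW : TopProbDensity μ κ Bstar) (hAB : 1 - α < Bstar) (hq₀ : q₀ ∈ Ioo κ (1 - α))
    (h0 : levelGain μ (1 - α) (-1) q₀ = 0) (hc : 0 < c) (hβ : β ∈ Ioo (1 / 2 : ℝ) 1)
    (hν₀ : 0 < ν₀) (hν : ν ∈ Ioc (0 : ℝ) (1 / 2)) (hC₁ : 0 < C₁)
    (hest : ∀ᶠ t : ℕ in atTop,
      P.real {ω | C₁ * Real.log t ^ ν₀ * (t : ℝ) ^ (-ν) ≤ meanError μ p t ω} ≤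
        3 / (Real.pi ^ 2 * (t : ℝ) ^ 3))
    (hδ : failureProb P Bstar (threshold (fun j => c * (j : ℝ) ^ (-β)) α q₁ X Y p) < δ')
    (hδ0 : 0 < δ') (hδ1 : δ' < 1) :
    ∃ C₀ > (0 : ℝ), ∃ T₀ : ℕ, 1 ≤ T₀ ∧ (∀ t ≥ T₀, 0 ≤ rate β ν₀ ν t) ∧
      (∀ t ≥ T₀, (sci (fun j => c * (j : ℝ) ^ (-β)) α q₁ X Y p).errorRate P X Y t ≤
        α + δ' + C₀ * rate β ν₀ ν t) ∧
      (∀ t ≥ T₀, levelGain μ 0 1 q₀ ≤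
        (sci (fun j => c * (j : ℝ) ^ (-β)) α q₁ X Y p).power P X Y t +
          C₀ * rate β ν₀ ν t + δ') := by
  set γ : ℕ → ℝ := fun j => c * (j : ℝ) ^ (-β) with hγdef
  obtain ⟨L, hL0, hL⟩ := hW.exists_mass_Icc_le
  obtain ⟨qbar, hqbar, N₀, hN₀⟩ := exists_of_failureProb_lt (hW.nonneg.trans_lt hW.lt) hδ hAB
  obtain ⟨k, hk, hkq⟩ := hW.exists_drift_le hAB hq₀ h0 hqbar.1 hqbar.2 (γ 1)
  set G := levelGain μ 1 0 qbar with hG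
  have hG0 : 0 < G := hW.levelGain_one_zero_pos hqbar.2
  have hG1 : G ≤ 1 := by
    rw [hG, levelGain_one_zero]
    exact measureReal_le_one
  have hq₀0 : 0 ≤ q₀ := hW.nonneg.trans hq₀.1.le
  set η : ℕ → ℝ := fun t => C₁ * (Real.log t ^ ν₀ * (t : ℝ) ^ (-ν)) with hη
  have hηlim : Tendsto η atTop (𝓝 0) := by
    simpa using (tendsto_log_rpow_mul_rpow_neg ν₀ hν.1).const_mul C₁
  have hη0 : ∀ t ≥ 3, 0 < η t := fun t ht => by
    have h1 := one_le_log ht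
    have h2 : (0 : ℝ) < t := by exact_mod_cast (by omega : 0 < t)
    positivity
  have helim : Tendsto (fun t => (2 * L + 3) * √(η t)) atTop (𝓝 0) := by
    have := (hηlim.sqrt).const_mul (2 * L + 3)
    rwa [Real.sqrt_zero, mul_zero] at this
  have hηs : Summable fun t => P.real {ω | η t < meanError μ p t ω} :=
    summable_measureReal_lt_meanError hest
  have hγlim : Tendsto (fun t => k * γ t) atTop (𝓝 0) := by
    have := ((tendsto_rpow_neg_nat (by linarith [hβ.1] : 0 < β)).const_mul c).const_mul k
    simpa [γ] using this
  have hγinv := eventually_inv_le_mul_rpow_neg hβ.2 (by positivity : 0 < k / 2 * c)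
  obtain ⟨N, hN⟩ := eventually_atTop.1 ((hηlim.eventually_le_const one_pos).and
    ((hγlim.eventually_le_const one_pos).and (hγinv.and
      ((helim.eventually_le_const (half_pos hG0)).and ((eventually_ge_atTop 3).and
        (exists_measureReal_compl_goodEvent_le hN₀ hηs))))))
  have hN3 : 3 ≤ N := (hN N le_rfl).2.2.2.2.1
  set A : ℕ → Set Ω := goodEvent qbar (meanError μ p) η (threshold γ α q₁ X Y p) N with hAdef
  have hAc : ∀ t, P.real (A t)ᶜ ≤ δ' := (hN N le_rfl).2.2.2.2.2
  have hA : ∀ t, MeasurableSet[ℙ (t - 1)] (A t) := fun t =>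
    hr.measurableSet_goodEvent qbar η (by omega) t
  have hA' : ∀ t, MeasurableSet (A t) := fun t => hr.model.past_le _ _ (hA t)
  have hPA : ∀ t, 1 - δ' ≤ P.real (A t) := fun t => by
    have := probReal_compl_eq_one_sub (μ := P) (hA' t)
    linarith [hAc t]
  have hgain : ∀ {a b : ℝ}, |a| ≤ 1 → |a + b| ≤ 1 → |b| ≤ 1 → ∀ t ≥ N, ∀ ω,
      meanError μ p t ω ≤ η t → |(sci γ α q₁ X Y p).gain μ a b t ω -
        levelGain μ a b (threshold γ α q₁ X Y p t ω)| ≤ (2 * L + 3) * √(η t) :=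
    fun ha hab hb t ht ω hD => hr.abs_gain_sub_le hL ha hab hb (by omega) (hη0 t (by omega))
      (hN t ht).1 hD
  have hAerr : ∀ t ≥ N, ∀ ω ∈ A t, meanError μ p t ω ≤ η t := fun t ht ω hω =>
    (hω t ⟨ht, le_rfl⟩).2
  -- Below qbar the ideal selection probability is at least G, and N was chosen so that estimation
  -- loses at most half of it.
  have hsel : ∀ t ≥ N, ∀ ω ∈ A t, G / 2 ≤ (sci γ α q₁ X Y p).gain μ 1 0 t ω :=
    fun t ht ω hω => by
      have h1 := abs_le.1 (hgain (by simp) (by simp) (by simp) t ht ω (hAerr t ht ω hω) :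
        |(sci γ α q₁ X Y p).gain μ 1 0 t ω - _| ≤ _)
      have h2 := levelGain_one_zero_antitone (μ := μ) (hω t ⟨ht, le_rfl⟩).1
      linarith [h1.1, (hN t ht).2.2.2.1]
  obtain ⟨C, hC, hCbound⟩ := hr.exists_integral_abs_sub_le hc hβ hν₀ hν hC₁ hL hL0.le hq₀0 hk
    hkq (η := η) (fun t => rfl) hN3 (fun t ht => (hN t ht).1) (fun t ht => (hN t ht).2.1)
    (fun t ht => by
      have := (hN t ht).2.2.1
      rwa [mul_assoc] at this) (half_pos hG0) (by linarith) hsel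
  set C₂ := (2 * L + 3) * √C₁ with hC₂
  have hC₂0 : 0 < C₂ := mul_pos (by positivity) (Real.sqrt_pos.2 hC₁)
  have hrate : ∀ t ≥ N, 0 ≤ rate β ν₀ ν t := fun t ht => rate_nonneg _ _ _ (by omega)
  have herr : ∀ t ≥ N, (2 * L + 3) * √(η t) ≤ C₂ * rate β ν₀ ν t := fun t ht => by
    rw [hη, Real.sqrt_mul hC₁.le, ← mul_assoc]
    exact mul_le_mul_of_nonneg_left (sqrt_log_rpow_le_rate β ν₀ ν (by omega)) hC₂0.le
  have hon : (sci γ α q₁ X Y p).IsOnline ℙ := hr.estimator.sci_isOnline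
  have hq := fun t (ht : t ≥ N) => (hr.measurable_threshold (t := t) (by omega)).sub_const q₀
  have iA : ∀ t, Integrable ((A t).indicator (1 : Ω → ℝ)) P := fun t =>
    (integrable_const (1 : ℝ)).indicator (hA' t)
  have iD : ∀ t ≥ N, Integrable (fun ω => (A t).indicator 1 ω *
      |threshold γ α q₁ X Y p t ω - q₀|) P := fun t ht => by
    refine hr.integrable_past (C := 1 * (|q₀| + 1 + γ 1)) ((measurable_indicator_one (hA t)).mul
      (continuous_abs.measurable.comp (hq t ht))) fun ω => ?_
    rw [abs_mul, abs_abs]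
    refine mul_le_mul (abs_indicator_le _ (by simp)) ?_ (abs_nonneg _) zero_le_one
    have h1 := hr.threshold_mem (t := t) (by omega) ω
    have h2 := hr.step_nonneg 1
    exact abs_le.2 ⟨by linarith [h1.1, le_abs_self q₀], by linarith [h1.2, neg_abs_le q₀]⟩
  have hselProb : ∀ t ≥ N, G / 2 * (1 - δ') ≤ ∫ ω, (sci γ α q₁ X Y p).gain μ 1 0 t ω ∂P :=
    fun t ht => by
      have hpt : ∀ ω, G / 2 * (A t).indicator 1 ω ≤ (sci γ α q₁ X Y p).gain μ 1 0 t ω :=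
        fun ω => by
          by_cases hω : ω ∈ A t
          · simpa [hω] using hsel t ht ω hω
          · rw [indicator_of_notMem hω, mul_zero]
            exact integral_nonneg fun x => indicator_nonneg (by simp) _
      have h1 := integral_mono ((iA t).const_mul _) (hon.integrable_gain hr.model (by simp)
        (by simp) (by omega)) hpt
      rw [integral_const_mul, integral_indicator_one (hA' t)] at h1
      exact (mul_le_mul_of_nonneg_left (hPA t) (half_pos hG0).le).trans h1
  have hpower : ∀ t ≥ N, levelGain μ 0 1 q₀ ≤ (sci γ α q₁ X Y p).power P X Y t +
      (L * C + C₂) * rate β ν₀ ν t + δ' := fun t ht => by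
    have hw0 : 0 ≤ levelGain μ 0 1 q₀ := integral_nonneg fun x =>
      indicator_nonneg (fun x _ => by simpa using (topProb_mem_Icc μ x).1) x
    have hw1 : levelGain μ 0 1 q₀ ≤ 1 := by
      have h1 := integral_mono (integrable_levelGain_integrand (μ := μ) 0 1 q₀)
        (integrable_const (1 : ℝ)) fun x => by
          refine (indicator_le_self' (fun x _ => by simpa using (topProb_mem_Icc μ x).1) x).trans ?_
          simpa using (topProb_mem_Icc μ x).2
      simpa [levelGain] using h1
    have hpt : ∀ ω, levelGain μ 0 1 q₀ * (A t).indicator 1 ω - L * ((A t).indicator 1 ω *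
        |threshold γ α q₁ X Y p t ω - q₀|) - (2 * L + 3) * √(η t) ≤
        (sci γ α q₁ X Y p).gain μ 0 1 t ω := fun ω => by
      by_cases hω : ω ∈ A t
      · have h1 := abs_le.1 (hgain (a := 0) (b := 1) (by simp) (by simp) (by simp) t ht ω
          (hAerr t ht ω hω))
        have h2 := abs_le.1 (lipschitz_levelGain (μ := μ) hL (a := 0) (b := 1) (by simp) (by simp)
          (threshold γ α q₁ X Y p t ω) q₀)
        simp only [indicator_of_mem hω, Pi.one_apply, mul_one, one_mul]
        linarith [h1.1, h2.1]
      · simp only [indicator_of_notMem hω, zero_mul, mul_zero, sub_zero, zero_sub]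
        have h1 : 0 ≤ (2 * L + 3) * √(η t) := by positivity
        have h2 : 0 ≤ (sci γ α q₁ X Y p).gain μ 0 1 t ω := integral_nonneg fun x =>
          indicator_nonneg (fun x _ => by simpa using (classProb_mem_Icc μ x _).1) x
        linarith
    have i1 : Integrable (fun ω => levelGain μ 0 1 q₀ * (A t).indicator 1 ω -
        L * ((A t).indicator 1 ω * |threshold γ α q₁ X Y p t ω - q₀|)) P :=
      ((iA t).const_mul _).sub ((iD t ht).const_mul L)
    have h1 := integral_mono (i1.sub (integrable_const ((2 * L + 3) * √(η t))))
      (hon.integrable_gain hr.model (by simp) (by simp) (by omega)) hpt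
    simp only [Pi.sub_apply] at h1
    rw [integral_sub i1 (integrable_const _), integral_sub ((iA t).const_mul _) ((iD t ht).const_mul L),
      integral_const_mul, integral_const_mul, integral_indicator_one (hA' t),
      ← hon.power_eq hr.model (by omega)] at h1
    simp only [integral_const, probReal_univ, one_smul] at h1
    have h2 := mul_le_mul_of_nonneg_left (hCbound t ht) hL0.le
    have h3 := mul_le_mul_of_nonneg_left (hPA t) hw0
    have h4 := mul_le_mul_of_nonneg_right hw1 hδ0.le
    linarith [herr t ht]
  -- A lower bound for the total selection probability, by `hselProb`. The margin ε makes 2Lε equal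
  -- to δ's₀/2; the squared shortfall and the estimation failures will take a quarter of δ's₀ each.
  set s₀ := G / 2 * (1 - δ') with hs₀
  have hs₀0 : 0 < s₀ := mul_pos (half_pos hG0) (by linarith)
  set ε := δ' * s₀ / (4 * L) with hε
  have hε0 : 0 < ε := by positivity
  have hLε : 2 * L * ε = δ' * s₀ / 2 := by
    rw [hε]
    field_simp
    norm_num
  have hV := hr.tendsto_integral_max_sub_sq_of_lt
    (by
      have h1 : ¬ Summable fun j : ℕ => (j : ℝ) ^ (-β) := by
        rw [Real.summable_nat_rpow]
        linarith [hβ.2]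
      rwa [summable_mul_left_iff hc.ne'])
    (by
      have h1 : Summable fun j : ℕ => (j : ℝ) ^ (-(2 * β)) :=
        Real.summable_nat_rpow.2 (by linarith [hβ.1])
      refine (h1.mul_left (c ^ 2)).congr fun j => ?_
      rw [mul_pow, ← Real.rpow_natCast (_ ^ (-β)), ← Real.rpow_mul (Nat.cast_nonneg _)]
      push_cast
      rw [show -β * 2 = -(2 * β) by ring])
    hL hL0.le (eventually_atTop.2 ⟨3, hη0⟩) hηlim hηs (r := q₀ - ε) (by linarith [hq₀.2])
    (hW.levelGain_pos hAB hq₀ h0 (by linarith))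
  have hVlim := hV.const_mul (L / ε)
  rw [mul_zero] at hVlim
  have hds : 0 < δ' * s₀ / 4 := by positivity
  obtain ⟨N₂, hN₂⟩ := eventually_atTop.1 ((hVlim.eventually_le_const hds).and
    (hηs.tendsto_atTop_zero.eventually_le_const hds))
  have hcov : ∀ t ≥ max N N₂, ∫ ω, (sci γ α q₁ X Y p).gain μ (1 - α) (-1) t ω ∂P ≤
      (L * C + C₂) * rate β ν₀ ν t + δ' * s₀ := fun t ht => by
    have htN : N ≤ t := (le_max_left _ _).trans ht
    have htN₂ : N₂ ≤ t := (le_max_right _ _).trans ht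
    set bad : Set Ω := {ω | η t < meanError μ p t ω} with hbad
    have hbadm : MeasurableSet bad := measurableSet_lt measurable_const
      ((hr.measurable_meanError (t := t) (by omega)).mono (hr.model.past_le _) le_rfl)
    have ibad : Integrable (bad.indicator (1 : Ω → ℝ)) P :=
      (integrable_const (1 : ℝ)).indicator hbadm
    set z : Ω → ℝ := fun ω => max (q₀ - ε - threshold γ α q₁ X Y p t ω) 0 with hz
    have iz : Integrable (fun ω => z ω ^ 2) P := by
      refine hr.integrable_past (t := t - 1) (C := (|q₀| + 1 + γ 1) ^ 2)
        (((measurable_const.sub (hr.measurable_threshold (by omega))).max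
          measurable_const).pow_const 2) fun ω => ?_
      have h1 := hr.threshold_mem (t := t) (by omega) ω
      have h2 := hr.step_nonneg 1
      rw [abs_pow, abs_of_nonneg (le_max_right _ _)]
      refine pow_le_pow_left₀ (le_max_right _ _) (max_le ?_ (by positivity)) 2
      linarith [h1.1, le_abs_self q₀]
    -- Three cases: a large estimation error, where the gain is at most 1; the good event, where the
    -- distance to q₀ is used; and the rest, where only a threshold below q₀ contributes.
    have hpt : ∀ ω, (sci γ α q₁ X Y p).gain μ (1 - α) (-1) t ω ≤
        L * ((A t).indicator 1 ω * |threshold γ α q₁ X Y p t ω - q₀|) + bad.indicator 1 ω +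
          L / ε * z ω ^ 2 + (2 * L * ε + (2 * L + 3) * √(η t)) := fun ω => by
      have t1 : 0 ≤ L * ((A t).indicator 1 ω * |threshold γ α q₁ X Y p t ω - q₀|) :=
        mul_nonneg hL0.le (mul_nonneg (indicator_nonneg (by simp) _) (abs_nonneg _))
      have t2 : 0 ≤ bad.indicator (1 : Ω → ℝ) ω := indicator_nonneg (by simp) _
      have t3 : 0 ≤ L / ε * z ω ^ 2 := by positivity
      have t4 : 0 ≤ 2 * L * ε := by positivity
      have t5 : 0 ≤ (2 * L + 3) * √(η t) := by positivity
      have hlip := abs_le.1 (lipschitz_levelGain (μ := μ) hL hr.abs_one_sub_level_le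
        hr.abs_one_sub_level_add_le (threshold γ α q₁ X Y p t ω) q₀)
      rw [h0, sub_zero] at hlip
      by_cases hb : ω ∈ bad
      · have := (abs_le.1 (abs_ruleGain_le (μ := μ) hr.abs_one_sub_level_le
          hr.abs_one_sub_level_add_le {x | (sci γ α q₁ X Y p).select t ω x}
          ((sci γ α q₁ X Y p).predict t ω))).2
        rw [indicator_of_mem hb, Pi.one_apply]
        have h' : (sci γ α q₁ X Y p).gain μ (1 - α) (-1) t ω ≤ 1 := this
        linarith
      · have h1 := (abs_le.1 (hgain hr.abs_one_sub_level_le hr.abs_one_sub_level_add_le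
          (by simp) t htN ω (not_lt.1 hb))).2
        by_cases hω : ω ∈ A t
        · simp only [indicator_of_mem hω, Pi.one_apply, one_mul]
          linarith [hlip.2]
        · have h2 : levelGain μ (1 - α) (-1) (threshold γ α q₁ X Y p t ω) ≤
              L / ε * z ω ^ 2 + 2 * L * ε := by
            rcases le_total q₀ (threshold γ α q₁ X Y p t ω) with hle | hle
            · linarith [TopProbDensity.levelGain_nonpos hq₀.2.le h0 hle]
            · rw [abs_sub_comm, abs_of_nonneg (sub_nonneg.2 hle)] at hlip
              have hz1 : q₀ - ε - threshold γ α q₁ X Y p t ω ≤ z ω := le_max_left _ _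
              -- This converts the shortfall into its square, the quantity known to vanish in mean.
              have hz2 : z ω ≤ ε + z ω ^ 2 / ε := by
                have h3 : 0 ≤ (z ω - ε) ^ 2 / ε := by positivity
                have h4 : (z ω - ε) ^ 2 / ε = z ω ^ 2 / ε - 2 * z ω + ε := by
                  field_simp
                  ring
                have h5 : 0 ≤ z ω ^ 2 / ε := by positivity
                linarith [le_max_right (q₀ - ε - threshold γ α q₁ X Y p t ω) 0]
              have h6 : L * (q₀ - threshold γ α q₁ X Y p t ω) ≤ L * (2 * ε + z ω ^ 2 / ε) :=
                mul_le_mul_of_nonneg_left (by linarith) hL0.le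
              have h7 : L * (2 * ε + z ω ^ 2 / ε) = L / ε * z ω ^ 2 + 2 * L * ε := by ring
              linarith [hlip.2]
          linarith
    have i1 : Integrable (fun ω => L * ((A t).indicator 1 ω *
        |threshold γ α q₁ X Y p t ω - q₀|) + bad.indicator 1 ω) P :=
      ((iD t htN).const_mul L).add ibad
    have i2 : Integrable (fun ω => L * ((A t).indicator 1 ω *
        |threshold γ α q₁ X Y p t ω - q₀|) + bad.indicator 1 ω + L / ε * z ω ^ 2) P :=
      i1.add (iz.const_mul _)
    have h1 := integral_mono (hon.integrable_gain hr.model hr.abs_one_sub_level_le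
      hr.abs_one_sub_level_add_le (by omega)) (i2.add (integrable_const _)) hpt
    simp only [Pi.add_apply] at h1
    rw [integral_add i2 (integrable_const _), integral_add i1 (iz.const_mul _),
      integral_add ((iD t htN).const_mul L) ibad, integral_const_mul, integral_const_mul,
      integral_indicator_one hbadm] at h1
    simp only [integral_const, probReal_univ, one_smul] at h1
    have h2 := mul_le_mul_of_nonneg_left (hCbound t htN) hL0.le
    linarith [herr t htN, (hN₂ t htN₂).1, (hN₂ t htN₂).2]
  -- The first summand serves the power; the second serves the error rate, where the bound is
  -- divided by a selection probability of at least s₀.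
  refine ⟨(L * C + C₂) + (L * C + C₂) / s₀, by positivity, max N N₂, by omega, fun t ht =>
    hrate t ((le_max_left _ _).trans ht), fun t ht => ?_, fun t ht => ?_⟩
  · have htN : N ≤ t := (le_max_left _ _).trans ht
    have h1 := hcov t ht
    have h2 := hselProb t htN
    have h3 := hon.errorRate_mul hr.model (t := t) (by omega)
    rw [hon.integral_gain_eq hr.model (by omega)] at h1
    rw [hon.integral_gain_eq hr.model (a := 1) (b := -1) (by omega)] at h3
    set p0 := ∫ ω, (sci γ α q₁ X Y p).gain μ 1 0 t ω ∂P
    set p1 := ∫ ω, (sci γ α q₁ X Y p).gain μ 0 1 t ω ∂P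
    have hp0 : 0 < p0 := hs₀0.trans_le h2
    have hr0 := hrate t htN
    have hCC : 0 ≤ L * C + C₂ := by positivity
    refine le_of_mul_le_mul_right ?_ hp0
    rw [h3]
    have h4 : (L * C + C₂) * rate β ν₀ ν t ≤ (L * C + C₂) / s₀ * rate β ν₀ ν t * p0 := by
      have h5 := mul_le_mul_of_nonneg_left h2
        (mul_nonneg (div_nonneg hCC hs₀0.le) hr0)
      refine le_trans (le_of_eq ?_) h5
      field_simp
    have h6 := mul_le_mul_of_nonneg_left h2 hδ0.le
    have h7 : 0 ≤ (L * C + C₂) * rate β ν₀ ν t * p0 :=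
      mul_nonneg (mul_nonneg hCC hr0) hp0.le
    linarith
  · have htN : N ≤ t := (le_max_left _ _).trans ht
    have h1 : 0 ≤ (L * C + C₂) / s₀ * rate β ν₀ ν t := mul_nonneg (by positivity) (hrate t htN)
    linarith [hpower t htN]

end Bounds

end OnlineSCI

/-! ### The main theorem. -/

theorem mainTheorem10 {d K : ℕ} [NeZero K]
    (μ : Measure (OnlineSCI.Feature d × Fin K)) [IsProbabilityMeasure μ]
    (κ Bstar α : ℝ) (hκ : 1 / (K : ℝ) ≤ κ) (hW : OnlineSCI.TopProbDensity μ κ Bstar)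
    (hα : α ∈ Ioo (0 : ℝ) 1) (hαB : 1 - Bstar < α)
    (hαW : α < 1 - ∫ x, OnlineSCI.topProb μ x ∂μ.fst) :
    ∃ q₀ ∈ Ioo κ (1 - α),
      (∀ q ∈ Ioo κ (1 - α), OnlineSCI.meanAbove μ q = 1 - α ↔ q = q₀) ∧
      ∃ C > (0 : ℝ),
        ∀ (Ω : Type*) [MeasurableSpace Ω] (P : Measure Ω) [IsProbabilityMeasure P] (n : ℕ)
          (D₀ : Ω → Fin n → OnlineSCI.Feature d × Fin K)
          (X : ℕ → Ω → OnlineSCI.Feature d) (Y : ℕ → Ω → Fin K)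
          (p : ℕ → Ω → OnlineSCI.Feature d → Fin K → ℝ) (ν₀ ν c β q₁ δ' : ℝ),
          OnlineSCI.IIDModel P μ D₀ X Y →
          OnlineSCI.IsOnlineEstimator (OnlineSCI.past D₀ X Y) p →
          0 < ν₀ → ν ∈ Ioc (0 : ℝ) (1 / 2) →
          OnlineSCI.EstimationRate P μ (OnlineSCI.past D₀ X Y) X p ν₀ ν →
          0 < c → β ∈ Ioo (1 / 2 : ℝ) 1 → q₁ ∈ Icc 0 (1 - α) →
          OnlineSCI.failureProb P Bstar
            (OnlineSCI.threshold (fun j => c * (j : ℝ) ^ (-β)) α q₁ X Y p) < δ' →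
          δ' < 1 - α →
          ∃ C₀ > (0 : ℝ), ∃ T₀ : ℕ, 1 ≤ T₀ ∧
            (∀ t ≥ T₀,
              (OnlineSCI.sci (fun j => c * (j : ℝ) ^ (-β)) α q₁ X Y p).errorRate P X Y t ≤
                α + δ' + C₀ * OnlineSCI.rate β ν₀ ν t) ∧
            (∀ t ≥ T₀,
              (OnlineSCI.oracle Ω μ q₀).power P X Y t ≤
                (OnlineSCI.sci (fun j => c * (j : ℝ) ^ (-β)) α q₁ X Y p).power P X Y t +
                  C₀ * OnlineSCI.rate β ν₀ ν t + δ') ∧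
            (∀ (R : OnlineSCI.SelectiveClassifier Ω d K) (η : ℕ → ℝ),
              R.IsOnline (OnlineSCI.past D₀ X Y) →
              (∀ t, 0 ≤ η t) → Tendsto η atTop (𝓝 0) →
              (∀ t ≥ T₀, R.errorRate P X Y t ≤ α + δ' + η t) →
              ∀ t ≥ T₀,
                R.power P X Y t ≤
                  (OnlineSCI.sci (fun j => c * (j : ℝ) ^ (-β)) α q₁ X Y p).power P X Y t +
                    C₀ * OnlineSCI.rate β ν₀ ν t + C * δ' + C * η t) := by
  have hA1 : |1 - α| ≤ 1 := abs_le.2 ⟨by linarith [hα.2], by linarith [hα.1]⟩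
  have hA2 : |1 - α + -1| ≤ 1 := abs_le.2 ⟨by linarith [hα.2], by linarith [hα.1]⟩
  have hAB : 1 - α < Bstar := by linarith
  obtain ⟨q₀, hq₀, h0⟩ := hW.exists_root hAB hA1 hA2 (by linarith)
  have hq₀0 : 0 ≤ q₀ := hW.nonneg.trans hq₀.1.le
  have hgap : 0 < 1 - α - q₀ := sub_pos.2 hq₀.2
  -- The Lagrange multiplier, determined by (1 + l) q₀ = l (1 - α). It depends only on α and the
  -- law.
  set l : ℝ := q₀ / (1 - α - q₀) with hl
  have hl0 : 0 ≤ l := div_nonneg hq₀0 hgap.le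
  have hlq : (1 + l) * q₀ = l * (1 - α) := by
    have : l * (1 - α - q₀) = q₀ := div_mul_cancel₀ _ hgap.ne'
    linarith
  -- In 1 + l, the l is the price of the enlarged error budget, and the 1 covers the power OnlineSCI
  -- loses off the good event.
  refine ⟨q₀, hq₀, fun q hq => hW.meanAbove_eq_iff hAB hq₀ h0 hq, 1 + l, by linarith, ?_⟩
  intro Ω _ P _ n D₀ X Y p ν₀ ν c β q₁ δ' hmodel hest hν₀ hν hrate hc hβ hq₁ hδ hδα
  have hδ0 : 0 < δ' := lt_of_le_of_lt
    (Real.iInf_nonneg fun q => Real.iInf_nonneg fun t => measureReal_nonneg) hδ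
  have hr : OnlineSCI.IsRun P μ D₀ X Y p (fun j => c * (j : ℝ) ^ (-β)) α q₁ :=
    { model := hmodel
      estimator := hest
      level_mem := hα
      start_mem := hq₁
      step_nonneg := fun j => by positivity
      step_anti := fun i j hi hij => mul_le_mul_of_nonneg_left
        (Real.rpow_le_rpow_of_nonpos (by exact_mod_cast hi) (by exact_mod_cast hij)
          (by linarith [hβ.1])) hc.le }
  obtain ⟨C₁, hC₁, hest'⟩ := hrate.exists_meanError hmodel hest
  obtain ⟨C₀, hC₀, T₀, hT₀, hrate0, herr, hpow⟩ := hr.exists_bounds hW hAB hq₀ h0 hc hβ hν₀ hν hC₁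
    hest' hδ hδ0 (by linarith [hα.1])
  refine ⟨C₀, hC₀, T₀, hT₀, herr, fun t ht => ?_, fun R η hR hη _ hRerr t ht => ?_⟩
  · rw [(OnlineSCI.oracle_isOnline (D₀ := D₀) (X := X) (Y := Y) μ q₀).power_eq hmodel
      (hT₀.trans ht)]
    simp only [OnlineSCI.oracle_gain, integral_const, probReal_univ, one_smul]
    exact hpow t ht
  · have h1 := hR.power_le hmodel hl0 hlq h0 (add_nonneg hδ0.le (hη t)) (hT₀.trans ht)
      (by linarith [hRerr t ht])
    linarith [hpow t ht, hη t]
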